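/- **Conventions.** "Algorithm" means deterministic Turing machine (multi-stack, equivalently multi-tape), and time is its number of steps; $|I|$ is the length of the bit string encoding $I$, and $\mathrm{poly}$ stands for a polynomial. *SAT and SETH.* An $r$-SAT instance $A$ has variables $v_1,\dots,v_n$ ($n=n(A)$) and clauses, each a set of exactly $r$ literals; its solutions are the sets $S\subseteq[n]$ such that every clause contains some $v_i$ with $i\in S$ or some $\bar v_i$ with $i\notin S$. Let $s_r$ be the infimum of all $c\ge 0$ such that some algorithm decides every $r$-SAT instance $A$ in time $2^{c\,n(A)}\cdot\mathrm{poly}(|A|)$. SETH is the statement $\lim_{r\to\infty}s_r=1$. *Decoders.* A matroid decoder is a function $f$ that maps every $I\in\{0,1\}^*$ to a matroid $f(I)=(E_{f(I)},\mathcal F_{f(I)})$, with $E_{f(I)}\subset\mathbb N$ finite and $\mathcal F_{f(I)}$ its independent sets, such that $E_{f(I)}$ can be computed from $I$ in time $\mathrm{poly}(|I|)$ and, given $I$ and $S\subseteq E_{f(I)}$, it can be decided in time $\mathrm{poly}(|I|)$ whether $S\in\mathcal F_{f(I)}$. For matroid decoders $f_1,\dots,f_\ell$, an instance of $(f_i)_{i\in[\ell]}$-decoded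 $\ell$-MI is a tuple $I=(I_1,\dots,I_\ell)$ of bit strings with $E_{f_1(I_1)}=\dots=E_{f_\ell(I_\ell)}$; the question is whether the matroids $f_1(I_1),\dots,f_\ell(I_\ell)$ have a common basis. *Matroids on the grid.* Let $n,d\ge2$. A matrix $L=(L_{i,j})\in\mathbb Z_{\ge0}^{n\times d}$ is simple-uniform (SU) if all entries are at most $n$, all column sums are equal, and their common value $k$ satisfies $2\le k\le n^d-1$. For $j\in[d]$ the $(L,j)$-partition matroid has ground set $[n]^d$ and independent sets $\{S : |\{e\in S: e_j=i\}|\le L_{i,j}\ \forall i\in[n]\}$. A set $S\subseteq[n]^d$ is $L$-perfect if $|\{e\in S:e_j=i\}|=L_{i,j}$ for all $i,j$. For $\mathcal G\subseteq 2^{[n]^d}$, the $\mathcal G$-matroid of $n,d,L$ has as bases the sets $S\subseteq[n]^d$ with $|S|=k$ that are not $L$-perfect or belong to $\mathcal G$. For an $r$-SAT instance $A$ with $n(A)=n^d$, the SAT-matroid of $n,d,L,A$ is the $\mathcal G$-matroid where $\mathcal G$ is the set of solutions of $A$, carried to $[n]^d$ by a fixed bijection $[n^d]\to[n]^d$. Grid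 points are identified with natural numbers through base-$n$ digits. **Theorem.** Assume SETH. Then there are matroid decoders $f_P$ and $f_{MS}$ such that the set of values of $f_P$ is exactly the set of all $(L,j)$-partition matroids of grids $[n]^d$ ($n,d\ge2$, $L\in\mathbb Z_{\ge0}^{n\times d}$ SU, $j\in[d]$), the set of values of $f_{MS}$ is exactly the set of all SAT-matroids of $n,d,L,A$ ($n,d\ge 2$, $L$ SU, $A$ an $r$-SAT instance for some $r$ with $n(A)=n^d$), and the following holds. For every $\ell\ge3$ and every $\varepsilon>0$, with $f_1=\dots=f_{\ell-1}=f_P$ and $f_\ell=f_{MS}$, there is no algorithm that decides every instance $I$ of $(f_i)_{i\in[\ell]}$-decoded $\ell$-MI in time $2^{(1-\varepsilon)n}\cdot\mathrm{poly}(|I|)$, where $n=|E_{f_1(I_1)}|$ is the size of the ground set. -/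

import Mathlib

open Filter Topology

namespace DecodedMI

/-! ### Algorithms

An algorithm is a Turing machine with finitely many stacks (Mathlib's `Turing.FinTM2`) with input
and output over the alphabet `{0,1}`; running time is its number of steps. -/

/-- On input `w` the machine `M` halts with output `out` after at most `t` steps. -/
def Outputs (M : Turing.TM2ComputableAux Bool Bool) (w out : List Bool) (t : ℕ) : Prop :=
  Nonempty (Turing.TM2OutputsInTime M.tm (w.map M.inputAlphabet.invFun)
    (some (out.map M.outputAlphabet.invFun)) t)

/-- On input `w` the machine `M` answers the question `P` correctly (output `1` for yes and `0`
for no), after at most `t` steps. -/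
def Answers (M : Turing.TM2ComputableAux Bool Bool) (w : List Bool) (P : Prop) (t : ℕ) : Prop :=
  (P → Outputs M w [true] t) ∧ (¬ P → Outputs M w [false] t)

/-- Encoding of a tuple of bit strings as one bit string: every bit `b` is written `1 b`, and every
string is terminated by `0`. -/
def encodeTuple (l : List (List Bool)) : List Bool :=
  l.flatMap fun w => (w.flatMap fun b => [true, b]) ++ [false]

/-- Encoding of a finite set of natural numbers: the increasing list of its elements in binary. -/
def encodeFinset (E : Finset ℕ) : List Bool :=
  encodeTuple ((E.sort (· ≤ ·)).map Computability.encodeNat)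

/-- The subset `S` of `E`, as a 0/1 vector along the increasing enumeration of `E`. -/
def indicatorBits (E S : Finset ℕ) : List Bool :=
  (E.sort (· ≤ ·)).map fun x => decide (x ∈ S)

/-! ### `r`-SAT and SETH -/

/-- An `r`-SAT instance on the variables `v_i`, `i : Fin n`. The literal `v_i` is `(i, true)` and
its negation is `(i, false)`; every clause is a set of exactly `r` literals. -/
structure SATInstance (r n : ℕ) where
  clauses : List (Finset (Fin n × Bool))
  card_eq : ∀ C ∈ clauses, C.card = r

/-- The solutions of an instance, as sets of (indices of) true variables. -/
def SATInstance.solutions {r n : ℕ} (A : SATInstance r n) : Set (Finset (Fin n)) :=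
  {S | ∀ C ∈ A.clauses, ∃ i : Fin n, ((i, true) ∈ C ∧ i ∈ S) ∨ ((i, false) ∈ C ∧ i ∉ S)}

/-- Encoding of an instance: `n` in unary, terminated by `0`, and then for every clause the bit `1`
followed by its characteristic vector, which has the two bits `[v_i ∈ C]`, `[¬ v_i ∈ C]` for each
variable. -/
def SATInstance.encode {r n : ℕ} (A : SATInstance r n) : List Bool :=
  List.replicate n true ++ false :: A.clauses.flatMap fun C =>
    true :: (List.finRange n).flatMap fun i => [decide ((i, true) ∈ C), decide ((i, false) ∈ C)]

/-- `r`-SAT can be decided in time `2 ^ (c * n(A)) * poly(|A|)`. -/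
def SATSolvable (r : ℕ) (c : ℝ) : Prop :=
  ∃ (M : Turing.TM2ComputableAux Bool Bool) (p : Polynomial ℕ), ∀ (n : ℕ) (A : SATInstance r n),
    ∃ t : ℕ, (t : ℝ) ≤ (2 : ℝ) ^ (c * (n : ℝ)) * ((p.eval A.encode.length : ℕ) : ℝ) ∧
      Answers M A.encode A.solutions.Nonempty t

/-- The infimum `s_r` of the exponents `c ≥ 0` such that `r`-SAT can be decided in time
`2 ^ (c * n(A)) * poly(|A|)`. -/
noncomputable def satExponent (r : ℕ) : ℝ :=
  sInf {c : ℝ | 0 ≤ c ∧ SATSolvable r c}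

/-- The Strong Exponential Time Hypothesis: `s_r → 1` as `r → ∞`. -/
def SETH : Prop := Tendsto satExponent atTop (𝓝 1)

/-! ### Set systems, decoders and decoded matroid intersection -/

/-- A set system on a finite set of natural numbers. -/
@[ext]
structure SetSystem where
  ground : Finset ℕ
  feasible : Set (Finset ℕ)
  subset_ground : ∀ S ∈ feasible, S ⊆ ground

/-- The set system consists of the ground set and the independent sets of a matroid. -/
def SetSystem.IsMatroid (X : SetSystem) : Prop :=
  ∃ M : Matroid ℕ, M.E = (X.ground : Set ℕ) ∧
    ∀ S : Finset ℕ, M.Indep (S : Set ℕ) ↔ S ∈ X.feasible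

/-- The feasible sets of maximum cardinality; for a matroid these are its bases. -/
def SetSystem.bases (X : SetSystem) : Set (Finset ℕ) :=
  {S | S ∈ X.feasible ∧ ∀ T ∈ X.feasible, T.card ≤ S.card}

/-- A set system decoder: the ground set can be computed, and membership of a subset of the ground
set among the feasible sets can be decided, in time polynomial in the length of the decoded
string. -/
def IsSetSystemDecoder (f : List Bool → SetSystem) : Prop :=
  Nonempty (Turing.TM2ComputableInPolyTime (id : List Bool → List Bool) encodeFinset
    (fun I => (f I).ground)) ∧
  ∃ (M : Turing.TM2ComputableAux Bool Bool) (p : Polynomial ℕ),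
    ∀ (I : List Bool) (S : Finset ℕ), S ⊆ (f I).ground →
      Answers M (encodeTuple [I, indicatorBits (f I).ground S]) (S ∈ (f I).feasible)
        (p.eval I.length)

/-- A matroid decoder. -/
def IsMatroidDecoder (f : List Bool → SetSystem) : Prop :=
  IsSetSystemDecoder f ∧ ∀ I, (f I).IsMatroid

/-- The tuple `I` of strings is an instance of `f`-decoded matroid intersection: all the decoded
ground sets are equal. -/
def IsMIInstance {ℓ : ℕ} (f : Fin ℓ → List Bool → SetSystem) (I : Fin ℓ → List Bool) : Prop :=
  ∀ i j, (f i (I i)).ground = (f j (I j)).ground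

/-- The encoding of an instance of decoded matroid intersection. -/
def encodeMI {ℓ : ℕ} (I : Fin ℓ → List Bool) : List Bool := encodeTuple (List.ofFn I)

/-- `f`-decoded `ℓ`-matroid intersection can be decided in time `2 ^ (c * n) * poly(|I|)`, where `n`
is the size of the ground set of the instance `I`. -/
def MISolvable {ℓ : ℕ} (hℓ : 0 < ℓ) (f : Fin ℓ → List Bool → SetSystem) (c : ℝ) : Prop :=
  ∃ (M : Turing.TM2ComputableAux Bool Bool) (p : Polynomial ℕ), ∀ I : Fin ℓ → List Bool,
    IsMIInstance f I →
      ∃ t : ℕ, (t : ℝ) ≤ (2 : ℝ) ^ (c * ((f ⟨0, hℓ⟩ (I ⟨0, hℓ⟩)).ground.card : ℝ)) *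
          ((p.eval (encodeMI I).length : ℕ) : ℝ) ∧
        Answers M (encodeMI I) (∃ S, ∀ i, S ∈ (f i (I i)).bases) t

/-! ### Matroids on a grid -/

/-- The grid with side length `n` and dimension `d`. -/
abbrev Grid (n d : ℕ) : Type := Fin d → Fin n

/-- Grid points as natural numbers: `e` is the number with base-`n` digits `e 0, …, e (d - 1)`. -/
def gridCode (n d : ℕ) : Grid n d ↪ ℕ :=
  finFunctionFinEquiv.toEmbedding.trans Fin.valEmbedding

/-- A family of subsets of the grid, as a set system on natural numbers. -/
def gridSystem {n d : ℕ} (𝓘 : Set (Finset (Grid n d))) : SetSystem where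
  ground := Finset.univ.map (gridCode n d)
  feasible := {T | ∃ S ∈ 𝓘, T = S.map (gridCode n d)}
  subset_ground := by
    rintro _ ⟨S, -, rfl⟩
    exact Finset.map_subset_map.2 (Finset.subset_univ S)

/-- Simple-uniform matrices. -/
structure IsSU {n d : ℕ} (L : Matrix (Fin n) (Fin d) ℕ) : Prop where
  entry_le : ∀ i j, L i j ≤ n
  two_le_sum : ∀ j, 2 ≤ ∑ i, L i j
  sum_lt : ∀ j, ∑ i, L i j < n ^ d
  sum_eq : ∀ j₁ j₂, ∑ i, L i j₁ = ∑ i, L i j₂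

/-- The number of elements of `S` whose `j`-th coordinate is `i`. -/
def sliceCard {n d : ℕ} (S : Finset (Grid n d)) (i : Fin n) (j : Fin d) : ℕ :=
  (S.filter fun e => e j = i).card

/-- The `(L, j)`-partition matroid of the grid. -/
def partitionMatroid {n d : ℕ} (L : Matrix (Fin n) (Fin d) ℕ) (j : Fin d) : SetSystem :=
  gridSystem {S | ∀ i, sliceCard S i j ≤ L i j}

/-- `L`-perfect subsets of the grid. -/
def IsPerfect {n d : ℕ} (L : Matrix (Fin n) (Fin d) ℕ) (S : Finset (Grid n d)) : Prop :=
  ∀ i j, sliceCard S i j = L i j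

/-- The bases of the `𝒢`-matroid: the sets of cardinality `∑ i, L i 0` that are not `L`-perfect or
belong to `𝒢`. -/
def gBases {n d : ℕ} (hd : 2 ≤ d) (L : Matrix (Fin n) (Fin d) ℕ) (𝒢 : Set (Finset (Grid n d))) :
    Set (Finset (Grid n d)) :=
  {S | S.card = ∑ i, L i ⟨0, by omega⟩ ∧ (¬ IsPerfect L S ∨ (IsPerfect L S ∧ S ∈ 𝒢))}

/-- The `𝒢`-matroid: its independent sets are the subsets of its bases. -/
def gMatroid {n d : ℕ} (hd : 2 ≤ d) (L : Matrix (Fin n) (Fin d) ℕ) (𝒢 : Set (Finset (Grid n d))) :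
    SetSystem :=
  gridSystem {S | ∃ B ∈ gBases hd L 𝒢, S ⊆ B}

/-- The SAT-matroid of `n, d, L, A`: the `𝒢`-matroid where `𝒢` is the set of solutions of `A`, the
variables of `A` being identified with the grid points by a fixed bijection. -/
def satMatroid {n d r : ℕ} (hd : 2 ≤ d) (L : Matrix (Fin n) (Fin d) ℕ)
    (A : SATInstance r (n ^ d)) : SetSystem :=
  gMatroid hd L
    ((fun S : Finset (Fin (n ^ d)) => S.map finFunctionFinEquiv.symm.toEmbedding) '' A.solutions)

/-- `f` is a partition-decoder: the set systems it decodes strings to are exactly the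
`(L, j)`-partition matroids of grids, for simple-uniform `L`. -/
def IsPartitionDecoder (f : List Bool → SetSystem) : Prop :=
  Set.range f = {X | ∃ (n d : ℕ) (_ : 2 ≤ n) (_ : 2 ≤ d) (L : Matrix (Fin n) (Fin d) ℕ)
    (_ : IsSU L) (j : Fin d), X = partitionMatroid L j}

/-- `f` is a matroid-SAT decoder: the set systems it decodes strings to are exactly the
SAT-matroids, for simple-uniform `L`. -/
def IsMatroidSATDecoder (f : List Bool → SetSystem) : Prop :=
  Set.range f = {X | ∃ (n d : ℕ) (_ : 2 ≤ n) (hd : 2 ≤ d) (L : Matrix (Fin n) (Fin d) ℕ)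
    (_ : IsSU L) (r : ℕ) (A : SATInstance r (n ^ d)), X = satMatroid hd L A}

end DecodedMI

/-! Suppose that decoded `ℓ`-MI were solvable in time `2 ^ ((1 - ε) N)` up to a polynomial factor,
where `N` is the size of the ground set; the case `ε ≤ 1` suffices. Then `r`-SAT on `m` variables
would be solvable with exponent `1 - ε / 2` for every `r` simultaneously, so that `s_r ≤ 1 - ε / 2`
for all `r`, against SETH.

Take the grid of dimension 2 and side `n = ⌊√m⌋ + 2`, with `N = n²` points, and regard its points as
variables, of which at least three are unused. Every set `T` of points has an `n × 2` matrix `L` of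
slice counts with entries at most `n` (`slice_le`), and setting two unused variables to true and one
to false makes `L` simple-uniform (`solutions_nonempty_iff`). For a fixed simple-uniform `L`, a
common basis of the two partition matroids and the SAT-matroid is the same as an `L`-perfect
solution (`exists_common_basis_iff`). Hence the formula is satisfiable iff one of the at most `(n +
1) ^ (2 n)` matrices gives a positive instance (`solutions_nonempty_iff_search`). This number is `2
^ O(√m log m)` and `N = m + O(√m)`, so both losses are absorbed by half of `ε`
(`exists_time_bound`). For `ℓ > 3` the second partition matroid is repeated.

That the SAT-matroid is a matroid at all is the sparse paving property: two distinct perfect sets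
never differ by a single exchange, because equal slice counts would force the exchanged points to
have the same coordinates (`not_perf_insert`).

Since time is measured on actual machines, two computational ingredients are needed. The functions
`PT` and predicates `PD` form a class closed under bounded sums, quantifiers and length-bounded
iteration, with natural numbers in unary; both decoders and the construction of instances are
expressed in it. The theorem `exists_search` turns an arbitrary machine into a subroutine that is
called for each value of a base-`(n + 1)` counter, whose digits are the entries of `L`. The decoders
read lists of unary numbers and send every malformed string to a fixed valid one, which makes their
sets of values exact. -/

namespace DecodedMI

open Turing Function

/-! ### Machine fragments -/

section Fragments

variable {K : Type} [DecidableEq K] {Γ : K → Type} {Λ Λ' σ : Type}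

/-- Relabel a statement along `f` and continue with `e` where it halts. -/
def bindStmt (f : Λ → Λ') (e : TM2.Stmt Γ Λ' σ) : TM2.Stmt Γ Λ σ → TM2.Stmt Γ Λ' σ
  | .push k g q => .push k g (bindStmt f e q)
  | .peek k g q => .peek k g (bindStmt f e q)
  | .pop k g q => .pop k g (bindStmt f e q)
  | .load g q => .load g (bindStmt f e q)
  | .branch c q₁ q₂ => .branch c (bindStmt f e q₁) (bindStmt f e q₂)
  | .goto l => .goto fun v => f (l v)
  | .halt => e

/-- Relabel a configuration along `f`, and continue with `e` if it is halted. -/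
def bindCfg (f : Λ → Λ') (e : TM2.Stmt Γ Λ' σ) (c : TM2.Cfg Γ Λ σ) : TM2.Cfg Γ Λ' σ :=
  match c.l with
  | some l => ⟨some (f l), c.var, c.stk⟩
  | none => TM2.stepAux e c.var c.stk

/-- A single machine step executes a whole statement up to `goto` or `halt`. As `e` stands in the
place of `halt`, the continuation runs within the same step, and linking programs costs no time. -/
theorem stepAux_bindStmt (f : Λ → Λ') (e : TM2.Stmt Γ Λ' σ) (q : TM2.Stmt Γ Λ σ) (v : σ)
    (S : ∀ k, List (Γ k)) :
    TM2.stepAux (bindStmt f e q) v S = bindCfg f e (TM2.stepAux q v S) := by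
  induction q generalizing v S with
  | push k g q ih => exact ih _ _
  | peek k g q ih => exact ih _ _
  | pop k g q ih => exact ih _ _
  | load g q ih => exact ih _ _
  | branch c q₁ q₂ ih₁ ih₂ =>
    simp only [bindStmt, TM2.stepAux]
    cases c v
    · exact ih₂ _ _
    · exact ih₁ _ _
  | goto l => rfl
  | halt => rfl

/-- `Steps m t c d`: the program `m` takes the configuration `c` to `d` in `t` steps. -/
inductive Steps (m : Λ → TM2.Stmt Γ Λ σ) : ℕ → TM2.Cfg Γ Λ σ → TM2.Cfg Γ Λ σ → Prop
  | refl (c) : Steps m 0 c c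
  | head {t l v S c} : Steps m t (TM2.stepAux (m l) v S) c → Steps m (t + 1) ⟨some l, v, S⟩ c

theorem Steps.bind {m : Λ → TM2.Stmt Γ Λ σ} {m' : Λ' → TM2.Stmt Γ Λ' σ} {f : Λ → Λ'}
    {e : TM2.Stmt Γ Λ' σ} (hm : ∀ l, m' (f l) = bindStmt f e (m l)) {t t' : ℕ}
    {c d : TM2.Cfg Γ Λ σ} {c' : TM2.Cfg Γ Λ' σ} (h : Steps m t c d)
    (h' : Steps m' t' (bindCfg f e d) c') : Steps m' (t + t') (bindCfg f e c) c' := by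
  induction h with
  | refl c => simpa using h'
  | @head t l v S c _ ih =>
    rw [Nat.add_right_comm]
    refine Steps.head ?_
    rw [hm, stepAux_bindStmt]
    exact ih h'

theorem Steps.iterate {m : Λ → TM2.Stmt Γ Λ σ} {t : ℕ} {c d : TM2.Cfg Γ Λ σ}
    (h : Steps m t c d) : (flip Option.bind (TM2.step m))^[t] (some c) = some d := by
  induction h with
  | refl c => rfl
  | head _ ih => rw [iterate_succ_apply]; exact ih

theorem Steps.of_iterate {m : Λ → TM2.Stmt Γ Λ σ} {t : ℕ} {c d : TM2.Cfg Γ Λ σ}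
    (h : (flip Option.bind (TM2.step m))^[t] (some c) = some d) : Steps m t c d := by
  induction t generalizing c with
  | zero => cases h; exact Steps.refl _
  | succ t ih =>
    rw [iterate_succ_apply] at h
    obtain ⟨_ | l, v, S⟩ := c
    -- A halted configuration has no successor, and iteration stays at `none`, so `some d` could not
    -- be reached.
    · have : ∀ t, (flip Option.bind (TM2.step m))^[t] none = none := fun t => by
        induction t with
        | zero => rfl
        | succ t ih => rw [iterate_succ_apply]; exact ih
      exact absurd ((this t).symm.trans h) (by simp)
    · exact Steps.head (ih h)

/-- A piece of a machine, entered at `main` and left by halting. -/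
structure Frag (Γ : K → Type) (σ : Type) where
  Λ : Type
  [fin : Fintype Λ]
  main : Λ
  code : Λ → TM2.Stmt Γ Λ σ

/-- Started with register `v` and stacks `S`, the fragment halts with stacks `S'` after at most `T`
steps. -/
def Frag.Maps (F : Frag Γ σ) (v : σ) (S S' : ∀ k, List (Γ k)) (T : ℕ) : Prop :=
  ∃ v' t, t ≤ T ∧ Steps F.code t ⟨some F.main, v, S⟩ ⟨none, v', S'⟩

theorem Frag.Maps.mono {F : Frag Γ σ} {v : σ} {S S' : ∀ k, List (Γ k)} {T T' : ℕ}
    (h : F.Maps v S S' T) (hT : T ≤ T') : F.Maps v S S' T' := by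
  obtain ⟨v', t, ht, h⟩ := h
  exact ⟨v', t, ht.trans hT, h⟩

/-- The fragment that executes one statement. -/
def Frag.prim (q : TM2.Stmt Γ Unit σ) : Frag Γ σ where
  Λ := Unit
  main := ()
  code _ := q

theorem Frag.prim_maps {q : TM2.Stmt Γ Unit σ} {v v' : σ} {S S' : ∀ k, List (Γ k)}
    (h : TM2.stepAux q v S = ⟨none, v', S'⟩) : (Frag.prim q).Maps v S S' 1 :=
  ⟨v', 1, le_rfl, Steps.head (h ▸ Steps.refl _)⟩

/-- Run one fragment after the other. -/
def Frag.seq (F G : Frag Γ σ) : Frag Γ σ where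
  Λ := F.Λ ⊕ G.Λ
  fin := have := F.fin; have := G.fin; inferInstance
  main := .inl F.main
  code := Sum.elim (fun l => bindStmt Sum.inl (.goto fun _ => .inr G.main) (F.code l))
    (fun l => bindStmt Sum.inr .halt (G.code l))

/-- `Maps` hides the register value in which `F` ends, so `G` has to work from every register value.
-/
theorem Frag.seq_maps {F G : Frag Γ σ} {v : σ} {S S' S'' : ∀ k, List (Γ k)} {T T' : ℕ}
    (hF : F.Maps v S S' T) (hG : ∀ v, G.Maps v S' S'' T') :
    (F.seq G).Maps v S S'' (T + T') := by
  obtain ⟨v', t, ht, h⟩ := hF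
  obtain ⟨v'', t', ht', h'⟩ := hG v'
  refine ⟨v'', t + t', by omega, ?_⟩
  refine Steps.bind (m' := (F.seq G).code) (f := Sum.inl) (fun l => rfl) h ?_
  exact Steps.bind (m' := (F.seq G).code) (f := Sum.inr) (fun l => rfl) h' (Steps.refl _)

/-- Pop an element from the stack `k` into the register, and run `F` or `G` depending on the
register. -/
def Frag.popIte (k : K) (f : σ → Option (Γ k) → σ) (c : σ → Bool) (F G : Frag Γ σ) :
    Frag Γ σ where
  Λ := Option (F.Λ ⊕ G.Λ)
  fin := have := F.fin; have := G.fin; inferInstance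
  main := none
  code
    | none => .pop k f <| .branch c (.goto fun _ => some (.inl F.main))
        (.goto fun _ => some (.inr G.main))
    | some (.inl l) => bindStmt (fun l => some (Sum.inl l)) .halt (F.code l)
    | some (.inr l) => bindStmt (fun l => some (Sum.inr l)) .halt (G.code l)

theorem Frag.popIte_maps_left {k : K} {f : σ → Option (Γ k) → σ} {c : σ → Bool} {F G : Frag Γ σ}
    {v : σ} {S S' : ∀ k, List (Γ k)} {T : ℕ} (hc : c (f v (S k).head?) = true)
    (h : F.Maps (f v (S k).head?) (update S k (S k).tail) S' T) :
    (Frag.popIte k f c F G).Maps v S S' (T + 1) := by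
  obtain ⟨v', t, ht, h⟩ := h
  refine ⟨v', t + 1, by omega, Steps.head ?_⟩
  have := Steps.bind (m' := (Frag.popIte k f c F G).code) (f := fun l => some (Sum.inl l))
    (fun l => rfl) h (Steps.refl _)
  simpa [Frag.popIte, TM2.stepAux, hc, bindCfg] using this

theorem Frag.popIte_maps_right {k : K} {f : σ → Option (Γ k) → σ} {c : σ → Bool} {F G : Frag Γ σ}
    {v : σ} {S S' : ∀ k, List (Γ k)} {T : ℕ} (hc : c (f v (S k).head?) = false)
    (h : G.Maps (f v (S k).head?) (update S k (S k).tail) S' T) :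
    (Frag.popIte k f c F G).Maps v S S' (T + 1) := by
  obtain ⟨v', t, ht, h⟩ := h
  refine ⟨v', t + 1, by omega, Steps.head ?_⟩
  have := Steps.bind (m' := (Frag.popIte k f c F G).code) (f := fun l => some (Sum.inr l))
    (fun l => rfl) h (Steps.refl _)
  simpa [Frag.popIte, TM2.stepAux, hc, bindCfg] using this

/-- Pop elements from the stack `k` into the register and run `F`, while the register satisfies
`c`. -/
def Frag.popLoop (k : K) (f : σ → Option (Γ k) → σ) (c : σ → Bool) (F : Frag Γ σ) :
    Frag Γ σ where
  Λ := Option F.Λ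
  fin := have := F.fin; inferInstance
  main := none
  code
    | none => .pop k f <| .branch c (.goto fun _ => some F.main) .halt
    | some l => bindStmt some (.goto fun _ => none) (F.code l)

theorem Frag.popLoop_maps_stop {k : K} {f : σ → Option (Γ k) → σ} {c : σ → Bool} {F : Frag Γ σ}
    {v : σ} {S : ∀ k, List (Γ k)} (hS : S k = []) (hc : c (f v none) = false) :
    (Frag.popLoop k f c F).Maps v S S 1 := by
  refine ⟨f v none, 1, le_rfl, Steps.head ?_⟩
  have : update S k [] = S := by rw [← hS]; exact update_eq_self k S
  simp [Frag.popLoop, TM2.stepAux, hc, hS, this, Steps.refl]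

theorem Frag.popLoop_maps_step {k : K} {f : σ → Option (Γ k) → σ} {c : σ → Bool} {F : Frag Γ σ}
    {v : σ} {S S' S'' : ∀ k, List (Γ k)} {b : Γ k} {l : List (Γ k)} {T T' : ℕ}
    (hS : S k = b :: l) (hc : c (f v (some b)) = true)
    (h : F.Maps (f v (some b)) (update S k l) S' T)
    (h' : ∀ v, (Frag.popLoop k f c F).Maps v S' S'' T') :
    (Frag.popLoop k f c F).Maps v S S'' (T + T' + 1) := by
  obtain ⟨v', t, ht, h⟩ := h
  obtain ⟨v'', t', ht', h'⟩ := h' v'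
  refine ⟨v'', t + t' + 1, by omega, Steps.head ?_⟩
  have := Steps.bind (m' := (Frag.popLoop k f c F).code) (f := some) (fun l => rfl) h h'
  simpa [Frag.popLoop, TM2.stepAux, hc, hS, bindCfg] using this

end Fragments

/-! ### Fragments on stacks of bits -/

section Bits

variable {K : Type} [DecidableEq K]

/-- Fragments whose stacks contain bits, with one register for the bit popped last. -/
abbrev BFrag (K : Type) [DecidableEq K] := Frag (fun _ : K => Bool) (Option Bool)

/-- While the stack `k` is nonempty, pop a bit and run `F`. -/
def BFrag.loop (k : K) (F : BFrag K) : BFrag K :=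
  Frag.popLoop k (fun _ b => b) Option.isSome F

theorem BFrag.loop_nil {k : K} {F : BFrag K} {v : Option Bool} {S : K → List Bool}
    (hS : S k = []) : Frag.Maps (BFrag.loop k F) v S S 1 :=
  Frag.popLoop_maps_stop hS rfl

theorem BFrag.loop_cons {k : K} {F : BFrag K} {v : Option Bool} {S S' S'' : K → List Bool}
    {b : Bool} {l : List Bool} {T T' : ℕ} (hS : S k = b :: l)
    (h : Frag.Maps F (some b) (update S k l) S' T)
    (h' : ∀ v, Frag.Maps (BFrag.loop k F) v S' S'' T') :
    Frag.Maps (BFrag.loop k F) v S S'' (T + T' + 1) :=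
  Frag.popLoop_maps_step hS rfl h h'

/-- Push the bit `b` on the stack `k`. -/
def BFrag.push (k : K) (b : Bool) : BFrag K := Frag.prim (.push k (fun _ => b) .halt)

theorem BFrag.push_maps (k : K) (b : Bool) (v : Option Bool) (S : K → List Bool) :
    Frag.Maps (BFrag.push k b) v S (update S k (b :: S k)) 1 :=
  Frag.prim_maps rfl

/-- Empty the stack `k`. -/
def BFrag.clear (k : K) : BFrag K := BFrag.loop k (Frag.prim .halt)

theorem BFrag.clear_maps (k : K) (v : Option Bool) (S : K → List Bool) :
    Frag.Maps (BFrag.clear k) v S (update S k []) (2 * (S k).length + 1) := by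
  generalize hl : S k = l
  induction l generalizing S v with
  | nil =>
    have : update S k [] = S := by rw [← hl, update_eq_self]
    rw [this]; exact BFrag.loop_nil hl
  | cons b l ih =>
    refine Frag.Maps.mono (BFrag.loop_cons (T' := 2 * l.length + 1) hl (Frag.prim_maps rfl)
      fun v => ?_) ?_
    · have := ih v (update S k l) (by simp)
      rwa [update_idem] at this
    · simp; omega

/-- Move the content of the stack `a` to the stack `b`, reversing it. -/
def BFrag.move (a b : K) : BFrag K :=
  BFrag.loop a (Frag.prim (.push b (fun v => v.getD false) .halt))

theorem BFrag.move_maps {a b : K} (hab : a ≠ b) (v : Option Bool) (S : K → List Bool) :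
    Frag.Maps (BFrag.move a b) v S (update (update S a []) b ((S a).reverse ++ S b))
      (2 * (S a).length + 1) := by
  generalize hl : S a = l
  induction l generalizing S v with
  | nil =>
    have : update (update S a []) b (List.reverse [] ++ S b) = S := by
      funext k; by_cases h : k = b <;> by_cases h' : k = a <;> simp_all
    rw [this]; exact BFrag.loop_nil hl
  | cons c l ih =>
    refine Frag.Maps.mono (BFrag.loop_cons (T' := 2 * l.length + 1) hl (Frag.prim_maps rfl)
      fun v => ?_) ?_
    · convert ih v (update (update S a l) b (c :: S b)) (by simp [hab]) using 1
      · rfl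
      · simp [hab.symm]
      · funext k; by_cases h : k = b <;> by_cases h' : k = a <;> simp_all
    · simp; omega

/-- Move the content of the stack `a` to each of the stacks `b` and `c`, reversing it. -/
def BFrag.fork (a b c : K) : BFrag K :=
  BFrag.loop a (Frag.prim (.push b (fun v => v.getD false) (.push c (fun v => v.getD false) .halt)))

theorem BFrag.fork_maps {a b c : K} (hab : a ≠ b) (hac : a ≠ c) (hbc : b ≠ c) (v : Option Bool)
    (S : K → List Bool) :
    Frag.Maps (BFrag.fork a b c) v S
      (update (update (update S a []) b ((S a).reverse ++ S b)) c ((S a).reverse ++ S c))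
      (2 * (S a).length + 1) := by
  generalize hl : S a = l
  induction l generalizing S v with
  | nil =>
    have : update (update (update S a []) b (List.reverse [] ++ S b)) c
        (List.reverse [] ++ S c) = S := by
      funext k; by_cases h : k = b <;> by_cases h' : k = a <;> by_cases h'' : k = c <;> simp_all
    rw [this]; exact BFrag.loop_nil hl
  | cons d l ih =>
    refine Frag.Maps.mono (BFrag.loop_cons (T' := 2 * l.length + 1) hl (Frag.prim_maps rfl)
      fun v => ?_) ?_
    · convert ih v (update (update (update S a l) b (d :: S b)) c (d :: S c))
        (by simp [hab, hac]) using 1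
      · rfl
      · simp [hab.symm, hac.symm, hbc.symm]
      · funext k
        by_cases h : k = b <;> by_cases h' : k = a <;> by_cases h'' : k = c <;> simp_all
    · simp; omega

/-- Push a `true` on the stack `b` for every element of the stack `a`, and empty `a`. -/
def BFrag.count (a b : K) : BFrag K := BFrag.loop a (BFrag.push b true)

theorem BFrag.count_maps {a b : K} (hab : a ≠ b) (v : Option Bool) (S : K → List Bool) :
    Frag.Maps (BFrag.count a b) v S
      (update (update S a []) b (List.replicate (S a).length true ++ S b))
      (2 * (S a).length + 1) := by
  generalize hl : S a = l
  induction l generalizing S v with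
  | nil =>
    have : update (update S a []) b (List.replicate 0 true ++ S b) = S := by
      funext k; by_cases h : k = b <;> by_cases h' : k = a <;> simp_all
    rw [List.length_nil, this]; exact BFrag.loop_nil hl
  | cons c l ih =>
    refine Frag.Maps.mono (BFrag.loop_cons (T' := 2 * l.length + 1) hl
      (BFrag.push_maps _ _ _ _) fun v => ?_) ?_
    · convert ih v (update (update S a l) b (true :: S b)) (by simp [hab]) using 1
      · rfl
      · simp [hab.symm]
      · funext k
        by_cases h : k = b <;> by_cases h' : k = a <;> simp [h, h', hab, List.replicate_succ']
    · simp; omega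

/-- Pop a bit from the stack `k`, and run `F` if the bit is `true` and `G` otherwise. -/
def BFrag.popIf (k : K) (F G : BFrag K) : BFrag K :=
  Frag.popIte k (fun _ b => b) (fun v => v.getD false) F G

end Bits

/-! ### Functions computable in polynomial time -/

/-- Functions given by a polynomial. -/
def IsPoly (p : ℕ → ℕ) : Prop := ∃ P : Polynomial ℕ, ∀ n, p n = P.eval n

theorem IsPoly.const (c : ℕ) : IsPoly fun _ => c := ⟨Polynomial.C c, by simp⟩

theorem IsPoly.id : IsPoly fun n => n := ⟨Polynomial.X, by simp⟩

theorem IsPoly.add {p q : ℕ → ℕ} : IsPoly p → IsPoly q → IsPoly fun n => p n + q n := by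
  rintro ⟨P, hP⟩ ⟨Q, hQ⟩
  exact ⟨P + Q, by simp [hP, hQ]⟩

theorem IsPoly.mul {p q : ℕ → ℕ} : IsPoly p → IsPoly q → IsPoly fun n => p n * q n := by
  rintro ⟨P, hP⟩ ⟨Q, hQ⟩
  exact ⟨P * Q, by simp [hP, hQ]⟩

theorem IsPoly.comp {p q : ℕ → ℕ} : IsPoly p → IsPoly q → IsPoly fun n => p (q n) := by
  rintro ⟨P, hP⟩ ⟨Q, hQ⟩
  exact ⟨P.comp Q, by simp [hP, hQ]⟩

/-- Coefficients in `ℕ` are nonnegative. This is what allows time bounds to be evaluated at any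
upper bound for the size. -/
theorem IsPoly.mono {p : ℕ → ℕ} (hp : IsPoly p) {m n : ℕ} (h : m ≤ n) : p m ≤ p n := by
  obtain ⟨P, hP⟩ := hp
  rw [hP, hP]
  clear hP
  induction P using Polynomial.induction_on' with
  | add P Q hP hQ =>
    simp only [Polynomial.eval_add]
    exact add_le_add hP hQ
  | monomial k c =>
    simp only [Polynomial.eval_monomial]
    gcongr

/-- Types whose elements are represented by one string. -/
class Enc (β : Type) where
  enc : β → List Bool

export Enc (enc)

instance : Enc ℕ := ⟨fun n => List.replicate n true⟩

instance : Enc (List Bool) := ⟨id⟩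

@[simp] theorem enc_list (w : List Bool) : enc w = w := rfl

@[simp] theorem enc_nat (n : ℕ) : enc n = List.replicate n true := rfl

/-- Types whose elements are represented by finitely many strings. -/
class Ctx (α : Type) where
  R : Type
  [fin : Fintype R]
  rep : α → R → List Bool
  size : α → ℕ
  length_rep_le : ∀ a r, (rep a r).length ≤ size a

export Ctx (rep size length_rep_le)

instance : Ctx (List Bool) where
  R := Unit
  rep w _ := w
  size := List.length
  length_rep_le _ _ := le_rfl

/-- The pair is stored by adding one stack, `none`, to those of the first component. It plays the
role of a local variable, such as a loop index, pushed onto a context. -/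
instance {α β : Type} [Ctx α] [Enc β] : Ctx (α × β) where
  R := Option (Ctx.R α)
  fin := have := Ctx.fin (α := α); inferInstance
  rep x r := r.elim (enc x.2) (rep x.1)
  size x := size x.1 + (enc x.2).length
  length_rep_le
    | _, none => Nat.le_add_left _ _
    | x, some r => (length_rep_le x.1 r).trans (Nat.le_add_right _ _)

theorem Frag.Maps.to {K : Type} [DecidableEq K] {Γ : K → Type} {σ : Type} {F : Frag Γ σ} {v : σ}
    {S S' S'' : ∀ k, List (Γ k)} {T T' : ℕ}
    (h : F.Maps v S S' T) (hS : S' = S'') (hT : T ≤ T') : F.Maps v S S'' T' :=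
  hS ▸ h.mono hT

/-- The fragment `F` pushes `f a` on the stack `τ none` in time `p (size a)`, if `a` is stored on
the stacks `ι` and the stacks `τ (some i)` are empty. -/
def Pushes {α β : Type} [Ctx α] [Enc β] {K T : Type} [DecidableEq K] (F : BFrag K)
    (ι : Ctx.R α → K) (τ : Option T → K) (f : α → β) (p : ℕ → ℕ) : Prop :=
  ∀ (a : α) (S : K → List Bool), (∀ r, S (ι r) = rep a r) → (∀ i, S (τ (some i)) = []) →
    ∀ v, Frag.Maps F v S (update S (τ none) (enc (f a) ++ S (τ none))) (p (size a))

/-- Functions computable in polynomial time. -/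
def PT {α β : Type} [Ctx α] [Enc β] (f : α → β) : Prop :=
  ∃ (T : Type) (_ : Fintype T) (p : ℕ → ℕ), IsPoly p ∧ (∀ a, (enc (f a)).length ≤ p (size a)) ∧
    ∀ (K : Type) [DecidableEq K] (ι : Ctx.R α → K) (τ : Option T → K), Injective τ →
      (∀ r i, ι r ≠ τ i) → ∃ F : BFrag K, Pushes F ι τ f p

namespace PT

variable {α β γ : Type} [Ctx α] [Enc β] [Enc γ]

theorem nil : PT fun _ : α => ([] : List Bool) := by
  refine ⟨Empty, inferInstance, fun _ => 1, IsPoly.const 1, by simp, fun K _ ι τ _ _ =>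
    ⟨Frag.prim .halt, fun a S _ _ v => ?_⟩⟩
  exact (Frag.prim_maps rfl).to (by simp) le_rfl

theorem bit (b : Bool) : PT fun _ : α => [b] := by
  refine ⟨Empty, inferInstance, fun _ => 1, IsPoly.const 1, by simp, fun K _ ι τ _ _ =>
    ⟨BFrag.push (τ none) b, fun a S _ _ v => ?_⟩⟩
  exact (BFrag.push_maps _ _ _ _).to (by simp) le_rfl

/-- Reading a stack destroys it. Its content is therefore moved to a work stack and forked from
there to the output and back to the source; the two reversals cancel. -/
theorem ofCtx (r : Ctx.R α) : PT fun a : α => rep a r := by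
  refine ⟨Unit, inferInstance, fun n => 4 * n + 2,
    ((IsPoly.const 4).mul IsPoly.id).add (IsPoly.const 2), fun a => ?_, fun K _ ι τ hτ hι =>
    ⟨(BFrag.move (ι r) (τ (some ()))).seq (BFrag.fork (τ (some ())) (ι r) (τ none)),
      fun a S hS hT v => ?_⟩⟩
  · have := length_rep_le a r
    simp only [enc_list]
    omega
  · have h1 : ι r ≠ τ none := hι r _
    have h2 : ι r ≠ τ (some ()) := hι r _
    have h3 : τ (some ()) ≠ τ none := fun h => by simpa using hτ h
    have h4 := hT ()
    have h5 := hS r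
    refine Frag.Maps.to (Frag.seq_maps (BFrag.move_maps h2 v S) fun v =>
      BFrag.fork_maps h2.symm h3 h1 v _) ?_ ?_
    · funext k
      by_cases k1 : k = τ none
      · subst k1; simp [h2, h3.symm, h1.symm, h4, h5]
      · by_cases k2 : k = ι r
        · subst k2; simp [h1, h2, h4]
        · by_cases k3 : k = τ (some ())
          · subst k3; simp [h3, h2.symm, h4]
          · simp [k1, k2, k3]
    · have := length_rep_le a r
      simp [h4, h5]
      omega

theorem id : PT fun w : List Bool => w := ofCtx (α := List Bool) ()

theorem snd : PT fun x : α × β => x.2 := ofCtx (α := α × β) none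

/-- `g` runs before `f`, because what is pushed last is on top. The two fragments get disjoint
families of work stacks, and the first leaves the stacks of the second empty. -/
theorem append {f g : α → List Bool} : PT f → PT g → PT fun a => f a ++ g a := by
  rintro ⟨T, _, p, hp, hlp, hf⟩ ⟨U, _, q, hq, hlq, hg⟩
  refine ⟨T ⊕ U, inferInstance, fun n => q n + p n, hq.add hp, fun a => ?_,
    fun K _ ι τ hτ hι => ?_⟩
  · have := hlp a
    have := hlq a
    simp only [enc_list, List.length_append] at *
    omega
  · obtain ⟨F, hF⟩ := hf K ι (τ ∘ Option.map .inl)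
      (hτ.comp (Option.map_injective Sum.inl_injective)) fun r i => hι r _
    obtain ⟨G, hG⟩ := hg K ι (τ ∘ Option.map .inr)
      (hτ.comp (Option.map_injective Sum.inr_injective)) fun r i => hι r _
    refine ⟨G.seq F, fun a S hS hT v => ?_⟩
    refine Frag.Maps.to (Frag.seq_maps (hG a S hS (fun i => hT _) v) fun v =>
      hF a _ ?_ ?_ v) ?_ le_rfl
    · intro r; simp [hι, hS]
    · intro i; simp [hτ.eq_iff, hT]
    · simp

theorem weaken {f : α → γ} : PT f → PT fun x : α × β => f x.1 := by
  rintro ⟨T, _, p, hp, hlp, hf⟩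
  refine ⟨T, inferInstance, p, hp, fun a => (hlp _).trans (hp.mono (Nat.le_add_right _ _)),
    fun K _ ι τ hτ hι => ?_⟩
  obtain ⟨F, hF⟩ := hf K (ι ∘ some) τ hτ fun r i => hι _ i
  exact ⟨F, fun a S hS hT v => (hF a.1 S (fun r => hS (some r)) hT v).mono
    (hp.mono (Nat.le_add_right _ _))⟩

theorem injective_elim {T U : Type} {f : T → U} (hf : Injective f) :
    Injective fun i : Option T => i.elim (some none) fun i => some (some (f i)) := by
  rintro (_ | i) (_ | j) h
  · rfl
  · simp at h
  · simp at h
  · simpa using hf (by simpa using h)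

/-- The pop takes place on a work stack: on the output stack it would remove an older bit when `g a`
is empty. Two moves then restore the order. -/
theorem tail {g : α → List Bool} : PT g → PT fun a => (g a).tail := by
  rintro ⟨U, _, q, hq, hlq, hg⟩
  refine ⟨Option (Option U), inferInstance, fun n => q n + (1 + (2 * q n + 1 + (2 * q n + 1))),
    hq.add ((IsPoly.const 1).add ((((IsPoly.const 2).mul hq).add (IsPoly.const 1)).add
      (((IsPoly.const 2).mul hq).add (IsPoly.const 1)))),
    fun a => ?_, fun K _ ι τ hτ hι => ?_⟩
  · have := hlq a
    simp only [enc_list, List.length_tail] at *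
    omega
  · set c := τ (some none) with hc
    set d := τ (some (some none)) with hd
    obtain ⟨G, hG⟩ := hg K ι
      (τ ∘ fun i => i.elim (some none) fun i => some (some (some i)))
      (hτ.comp (injective_elim (Option.some_injective _))) fun r i => hι r _
    refine ⟨G.seq ((Frag.prim (.pop c (fun _ v => v) .halt)).seq
      ((BFrag.move c d).seq (BFrag.move d (τ none)))), fun a S hS hT v => ?_⟩
    have hco : τ none ≠ c := fun h => by simpa using hτ h
    have hdo : τ none ≠ d := fun h => by simpa using hτ h
    have hcd : c ≠ d := fun h => by simpa using hτ h
    have hSc : S c = [] := hT none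
    have hSd : S d = [] := hT (some none)
    have h1 := hlq a
    refine Frag.Maps.to (Frag.seq_maps (hG a S hS (fun i => hT _) v) fun v =>
      Frag.seq_maps (Frag.prim_maps rfl) fun v => Frag.seq_maps (BFrag.move_maps hcd v _) fun v =>
        BFrag.move_maps hdo.symm v _) ?_ ?_
    · funext k
      by_cases k1 : k = c
      · subst k1; simp [hco.symm, hcd, hSc]
      · by_cases k2 : k = τ none
        · subst k2; simp [← hc, hco, hdo, hSc, hSd, hcd.symm]
        · by_cases k3 : k = d
          · subst k3; simp [hdo.symm, hSd]
          · simp [← hc, k1, k2, k3]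
    · simp [← hc, hSc, hSd, hcd.symm] at h1 ⊢
      omega

theorem length {g : α → List Bool} : PT g → PT fun a => (g a).length := by
  rintro ⟨U, _, q, hq, hlq, hg⟩
  refine ⟨Option U, inferInstance, fun n => q n + (2 * q n + 1),
    hq.add (((IsPoly.const 2).mul hq).add (IsPoly.const 1)),
    fun a => ?_, fun K _ ι τ hτ hι => ?_⟩
  · have := hlq a
    simp only [enc_list, enc_nat, List.length_replicate] at *
    omega
  · set c := τ (some none) with hc
    obtain ⟨G, hG⟩ := hg K ι
      (τ ∘ fun i => i.elim (some none) fun i => some (some i))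
      (hτ.comp (injective_elim (f := fun i => i) injective_id)) fun r i => hι r _
    refine ⟨G.seq (BFrag.count c (τ none)), fun a S hS hT v => ?_⟩
    have hco : τ none ≠ c := fun h => by simpa using hτ h
    have hSc : S c = [] := hT none
    have h1 := hlq a
    refine Frag.Maps.to (Frag.seq_maps (hG a S hS (fun i => hT _) v) fun v =>
      BFrag.count_maps hco.symm v _) ?_ ?_
    · funext k
      by_cases k1 : k = c
      · subst k1; simp [hco.symm, hSc]
      · by_cases k2 : k = τ none
        · subst k2; simp [← hc, hco, hSc]
        · simp [← hc, k1, k2]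
    · simp [← hc, hSc] at h1 ⊢
      omega

theorem ifHead {g : α → List Bool} {f f' : α → γ} : PT g → PT f → PT f' →
    PT fun a => if (g a).head? = some true then f a else f' a := by
  rintro ⟨U, _, q, hq, hlq, hg⟩ ⟨T, _, p, hp, hlp, hf⟩ ⟨T', _, p', hp', hlp', hf'⟩
  refine ⟨Option (U ⊕ T ⊕ T'), inferInstance, fun n => q n + (2 * q n + 1 + (p n + p' n) + 1),
    hq.add (((((IsPoly.const 2).mul hq).add (IsPoly.const 1)).add (hp.add hp')).add
      (IsPoly.const 1)), fun a => ?_, fun K _ ι τ hτ hι => ?_⟩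
  · have := hlp a
    have := hlp' a
    dsimp only
    split_ifs <;> omega
  · set c := τ (some none) with hc
    obtain ⟨G, hG⟩ := hg K ι
      (τ ∘ fun i => i.elim (some none) fun i => some (some (.inl i)))
      (hτ.comp (injective_elim Sum.inl_injective)) fun r i => hι r _
    obtain ⟨F, hF⟩ := hf K ι (τ ∘ fun i => i.map fun i => some (.inr (.inl i)))
      (hτ.comp (Option.map_injective fun i j h => by simpa using h)) fun r i => hι r _
    obtain ⟨F', hF'⟩ := hf' K ι (τ ∘ fun i => i.map fun i => some (.inr (.inr i)))
      (hτ.comp (Option.map_injective fun i j h => by simpa using h)) fun r i => hι r _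
    refine ⟨G.seq (BFrag.popIf c ((BFrag.clear c).seq F) ((BFrag.clear c).seq F')),
      fun a S hS hT v => ?_⟩
    have hco : τ none ≠ c := fun h => by simpa using hτ h
    have hSc : S c = [] := hT none
    have h1 := hlq a
    -- After the test, clearing the rest of the tested string restores the original stacks, so
    -- either branch starts as if the test had not happened.
    have hrest : update (update (update S c (enc (g a) ++ S c)) c (enc (g a)).tail) c [] = S := by
      rw [update_idem, update_idem, ← hSc, update_eq_self]
    have key : ∀ {f : α → γ} {p : ℕ → ℕ} {T : Type} {τ' : Option T → K} {F : BFrag K},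
        Pushes F ι τ' f p → τ' none = τ none → (∀ i, S (τ' (some i)) = []) → ∀ v,
        Frag.Maps ((BFrag.clear c).seq F) v
          (update (update S c (enc (g a) ++ S c)) c (enc (g a)).tail)
          (update S (τ none) (enc (f a) ++ S (τ none))) (2 * q (size a) + 1 + p (size a)) := by
      intro f p T τ' F hF hn hT v
      refine Frag.Maps.to (Frag.seq_maps (BFrag.clear_maps c v _) fun v => ?_) rfl
        (Nat.add_le_add_right ?_ _)
      · rw [hrest, ← hn]
        exact hF a S hS hT v
      · simp at h1 ⊢
        omega
    refine Frag.Maps.to (Frag.seq_maps (hG a S hS (fun i => hT _) v) fun v => ?_) rfl le_rfl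
    have hst : (update S c (enc (g a) ++ S c)) c = enc (g a) := by simp [hSc]
    by_cases h : (g a).head? = some true
    · simp only [h, if_true]
      refine Frag.Maps.mono (Frag.popIte_maps_left ?_ ?_)
        (?_ : 2 * q (size a) + 1 + p (size a) + 1 ≤ _)
      · simp [← hc, hSc, h]
      · convert key hF rfl (fun i => hT _) _ using 1
        simp [← hc, hSc]
      · omega
    · simp only [h, if_false]
      refine Frag.Maps.mono (Frag.popIte_maps_right ?_ ?_)
        (?_ : 2 * q (size a) + 1 + p' (size a) + 1 ≤ _)
      · cases hg : g a with
        | nil => simp [← hc, hSc]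
        | cons b l => simp_all [← hc]
      · convert key hF' rfl (fun i => hT _) _ using 1
        simp [← hc, hSc]
      · omega

/-- The loop counter is a unary stack which is at the same time the stack of the index `i` in the
context of `f`. It counts down, so the blocks are pushed from the last to the first and end up in
the right order. -/
theorem flatMap {m : α → ℕ} {f : α × ℕ → List Bool} : PT m → PT f →
    PT fun a => (List.range (m a)).flatMap fun i => f (a, i) := by
  rintro ⟨U, _, q, hq, hlq, hg⟩ ⟨T, _, p, hp, hlp, hf⟩
  have hle : ∀ a, ∀ i < m a, p (size (a, i)) ≤ p (size a + q (size a)) := fun a i hi =>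
    hp.mono (Nat.add_le_add_left (le_trans (by simp [hi.le]) (hlq a)) _)
  have hlen : ∀ a, ∀ k ≤ m a, ((List.range k).flatMap fun i => f (a, i)).length ≤
      k * p (size a + q (size a)) := by
    intro a k hk
    induction k with
    | zero => simp
    | succ k ih =>
      have h1 := ih (by omega)
      have h2 := (hlp (a, k)).trans (hle a k hk)
      simp [List.range_succ, add_mul] at h1 h2 ⊢
      omega
  refine ⟨Option (T ⊕ U), inferInstance,
    fun n => q n + (q n * (p (n + q n) + 1) + 1),
    hq.add ((hq.mul ((hp.comp (IsPoly.id.add hq)).add (IsPoly.const 1))).add (IsPoly.const 1)),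
    fun a => ?_, fun K _ ι τ hτ hι => ?_⟩
  · have h1 := hlen a (m a) le_rfl
    have h2 : m a ≤ q (size a) := by simpa using hlq a
    have h3 := Nat.mul_le_mul h2 (le_refl (p (size a + q (size a))))
    simp only [enc_list, mul_add]
    omega
  · set c := τ (some none) with hc
    obtain ⟨F, hF⟩ := hf K (fun r => r.elim c ι)
      (τ ∘ fun i => i.map fun i => some (.inl i))
      (hτ.comp (Option.map_injective fun i j h => by simpa using h)) (by
        rintro (_ | r) i
        · intro h
          have := hτ h
          cases i <;> simp at this
        · exact hι r _)
    obtain ⟨G, hG⟩ := hg K ι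
      (τ ∘ fun i => i.elim (some none) fun i => some (some (.inr i)))
      (hτ.comp (injective_elim Sum.inr_injective)) fun r i => hι r _
    refine ⟨G.seq (BFrag.loop c F), fun a S hS hT v => ?_⟩
    have hcι : ∀ r, ι r ≠ c := fun r => hι r _
    have hco : τ none ≠ c := fun h => by simpa using hτ h
    have hSc : S c = [] := hT none
    have loop : ∀ k ≤ m a, ∀ out v, Frag.Maps (BFrag.loop c F) v
        (update (update S (τ none) out) c (List.replicate k true))
        (update S (τ none) (((List.range k).flatMap fun i => f (a, i)) ++ out))
        (k * (p (size a + q (size a)) + 1) + 1) := by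
      intro k hk
      induction k with
      | zero =>
        intro out v
        refine Frag.Maps.to (BFrag.loop_nil (by simp)) ?_ (by simp)
        funext k
        by_cases k1 : k = c
        · subst k1; simp [hco.symm, hSc]
        · simp [k1]
      | succ k ih =>
        intro out v
        refine Frag.Maps.to (BFrag.loop_cons (by rw [update_self, List.replicate_succ])
          (hF (a, k) _ ?_ ?_ _) fun v => ?_) rfl
          (?_ : _ + (k * (p (size a + q (size a)) + 1) + 1) + 1 ≤ _)
        · rintro (_ | r)
          · simp [rep]
          · simp [hcι, hι, hS, rep]
        · intro i
          simp [hc, hτ.eq_iff, hT]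
        · convert ih (by omega) (f (a, k) ++ out) v using 1
          · funext j
            by_cases k1 : j = c
            · subst k1; simp [hco.symm]
            · by_cases k2 : j = τ none
              · subst k2; simp [hco]
              · simp [k1, k2]
          · simp [List.range_succ]
        · have := hle a k hk
          rw [add_mul]
          omega
    refine Frag.Maps.mono (Frag.seq_maps (hG a S hS (fun i => hT _) v) fun v => ?_)
      (?_ : _ + (m a * (p (size a + q (size a)) + 1) + 1) ≤ _)
    · convert loop (m a) le_rfl (S (τ none)) v using 1
      · simp [← hc, hSc]
      · rfl
    · have : m a ≤ q (size a) := by simpa using hlq a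
      dsimp only
      gcongr

/-- Iterates whose values have polynomial length. -/
theorem iterate {m : α → ℕ} {g : α → β} {h : α × β → β} (hm : PT m) (hg : PT g) (hh : PT h)
    {s : ℕ → ℕ} (hs : IsPoly s)
    (hls : ∀ a, ∀ i ≤ m a, (enc ((fun x => h (a, x))^[i] (g a))).length ≤ s (size a)) :
    PT fun a => (fun x => h (a, x))^[m a] (g a) := by
  obtain ⟨T, _, p, hp, hlp, hm⟩ := hm
  obtain ⟨U, _, q, hq, -, hg⟩ := hg
  obtain ⟨V, _, r, hr, -, hh⟩ := hh
  refine ⟨Option (Option (Option (Option (T ⊕ U ⊕ V)))), inferInstance,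
    fun n => p n + (q n + (p n * (r (n + s n) + 6 * s n + 4) + 1 + (2 * s n + 1 + (2 * s n + 1)))),
    hp.add (hq.add (((hp.mul (((hr.comp (IsPoly.id.add hs)).add ((IsPoly.const 6).mul hs)).add
      (IsPoly.const 4))).add (IsPoly.const 1)).add ((((IsPoly.const 2).mul hs).add
      (IsPoly.const 1)).add (((IsPoly.const 2).mul hs).add (IsPoly.const 1))))),
    fun a => ?_, fun K _ ι τ hτ hι => ?_⟩
  · have := hls a (m a) le_rfl
    dsimp only
    omega
  · set c := τ (some none) with hc
    set x := τ (some (some none)) with hx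
    set y := τ (some (some (some none))) with hy
    set z := τ (some (some (some (some none)))) with hz
    obtain ⟨M, hM⟩ := hm K ι (τ ∘ fun i => i.elim (some none)
        fun i => some (some (some (some (some (.inl i))))))
      (hτ.comp (by rintro (_ | i) (_ | j) h <;> simp at h ⊢; exact h)) fun r i => hι r _
    obtain ⟨G, hG⟩ := hg K ι (τ ∘ fun i => i.elim (some (some none))
        fun i => some (some (some (some (some (.inr (.inl i)))))))
      (hτ.comp (by rintro (_ | i) (_ | j) h <;> simp at h ⊢; exact h)) fun r i => hι r _
    obtain ⟨H, hH⟩ := hh K (fun r => r.elim x ι) (τ ∘ fun i => i.elim (some (some (some none)))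
        fun i => some (some (some (some (some (.inr (.inr i)))))))
      (hτ.comp (by rintro (_ | i) (_ | j) h <;> simp at h ⊢; exact h)) (by
        rintro (_ | r) i
        · intro h
          have := hτ h
          cases i <;> simp at this
        · exact hι r _)
    have hcx : c ≠ x := fun h => by simpa using hτ h
    have hcy : c ≠ y := fun h => by simpa using hτ h
    have hcz : c ≠ z := fun h => by simpa using hτ h
    have hxy : x ≠ y := fun h => by simpa using hτ h
    have hxz : x ≠ z := fun h => by simpa using hτ h
    have hyz : y ≠ z := fun h => by simpa using hτ h
    have hoc : τ none ≠ c := fun h => by simpa using hτ h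
    have hox : τ none ≠ x := fun h => by simpa using hτ h
    have hoy : τ none ≠ y := fun h => by simpa using hτ h
    have hoz : τ none ≠ z := fun h => by simpa using hτ h
    have hιc : ∀ r, ι r ≠ c := fun r => hι r _
    have hιx : ∀ r, ι r ≠ x := fun r => hι r _
    refine ⟨M.seq (G.seq ((BFrag.loop c (H.seq ((BFrag.clear x).seq
      ((BFrag.move y z).seq (BFrag.move z x))))).seq
      ((BFrag.move x y).seq (BFrag.move y (τ none))))), fun a S hS hT v => ?_⟩
    have hSc : S c = [] := hT none
    have hSx : S x = [] := hT (some none)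
    have hSy : S y = [] := hT (some (some none))
    have hSz : S z = [] := hT (some (some (some none)))
    -- The loop invariant: `x` holds the `i`-th iterate, and `c` holds in unary the number `k` of
    -- rounds that remain.
    let st : ℕ → ℕ → K → List Bool := fun i k =>
      update (update S x (enc ((fun x => h (a, x))^[i] (g a)))) c (List.replicate k true)
    have loop : ∀ k i, i + k = m a → ∀ v, Frag.Maps (BFrag.loop c (H.seq ((BFrag.clear x).seq
        ((BFrag.move y z).seq (BFrag.move z x))))) v (st i k) (st (m a) 0)
        (k * (r (size a + s (size a)) + 6 * s (size a) + 4) + 1) := by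
      intro k
      induction k with
      | zero =>
        intro i hi v
        obtain rfl : i = m a := hi
        exact Frag.Maps.to (BFrag.loop_nil (by simp [st])) rfl (by simp)
      | succ k ih =>
        intro i hi v
        have hl := hls a i (by omega)
        have hl' := hls a (i + 1) (by omega)
        have step : ∀ v, Frag.Maps (H.seq ((BFrag.clear x).seq
            ((BFrag.move y z).seq (BFrag.move z x)))) v (st i k) (st (i + 1) k)
            (r (size a + s (size a)) + 6 * s (size a) + 3) := by
          intro v
          have hH1 := hH (a, (fun x => h (a, x))^[i] (g a)) (st i k) (by
            rintro (_ | r)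
            · simp [st, rep, hcx.symm]
            · simp [st, hιc, hιx, hS, rep]) (by
            intro j
            simp [st, hc, hx, hτ.eq_iff, hT])
          have hsz : r (size (a, (fun x => h (a, x))^[i] (g a))) ≤ r (size a + s (size a)) :=
            hr.mono (Nat.add_le_add_left hl _)
          rw [iterate_succ_apply'] at hl'
          refine Frag.Maps.to (Frag.seq_maps (hH1 v) fun v => Frag.seq_maps
            (BFrag.clear_maps x v _) fun v => Frag.seq_maps (BFrag.move_maps hyz v _) fun v =>
            BFrag.move_maps hxz.symm v _) ?_ ?_
          · simp only [comp_apply, Option.elim_none, ← hy]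
            funext j
            by_cases k1 : j = x
            · subst k1
              simp [st, hxy, hxz, hxy.symm, hcx.symm, hyz.symm, hcy.symm, hcz.symm, hxz.symm,
                hSy, hSz, iterate_succ_apply']
            · by_cases k2 : j = y
              · subst k2; simp [st, hxy.symm, hyz, hcy.symm, hSy]
              · by_cases k3 : j = z
                · subst k3; simp [st, hxz.symm, hcz.symm, hSz]
                · simp [st, k1, k2, k3, update_apply]
          · simp only [comp_apply, Option.elim_none, ← hy]
            simp [st, hxy, hxy.symm, hcx.symm, hyz.symm, hcy.symm, hcz.symm, hxz.symm,
                hSy, hSz] at hl hl' ⊢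
            omega
        refine Frag.Maps.to (BFrag.loop_cons (b := true) (l := List.replicate k true)
          (by simp [st, List.replicate_succ]) ?_
          fun v => ih (i + 1) (by omega) v) rfl
          (?_ : (r (size a + s (size a)) + 6 * s (size a) + 3) + _ + 1 ≤ _)
        · convert step (some true) using 1
          simp [st]
        · rw [add_mul]
          omega
    have hl := hls a (m a) le_rfl
    refine Frag.Maps.to (Frag.seq_maps (hM a S hS (fun i => hT _) v) fun v =>
      Frag.seq_maps (hG a _ ?_ ?_ v) fun v =>
      Frag.seq_maps (?_ : Frag.Maps _ v _ (st (m a) 0)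
        (m a * (r (size a + s (size a)) + 6 * s (size a) + 4) + 1)) fun v =>
      Frag.seq_maps (BFrag.move_maps hxy v _) fun v => BFrag.move_maps hoy.symm v _) ?_ ?_
    · intro r; simp [← hc, hιc, hS]
    · intro i; simp [hτ.eq_iff, hT]
    · convert loop (m a) 0 (by omega) v using 1
      simp only [comp_apply, Option.elim_none, ← hc, ← hx, st]
      funext j
      by_cases k1 : j = c
      · subst k1; simp [hcx, hSc]
      · by_cases k2 : j = x
        · subst k2; simp [hcx.symm, hSx]
        · simp [k1, k2]
    · simp only [st]
      funext j
      by_cases k1 : j = c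
      · subst k1; simp [hcx, hSc, hcy, hoc.symm]
      · by_cases k2 : j = x
        · subst k2; simp [hxy, hox.symm, hSx]
        · by_cases k3 : j = y
          · subst k3; simp [hoy.symm, hSy]
          · by_cases k4 : j = τ none
            · subst k4; simp [hox, hoc, hoy, hxy.symm, hcx.symm, hcy.symm, hSy]
            · simp [k1, k2, k3, k4]
    · have h1 : m a ≤ p (size a) := by simpa using hlp a
      have h2 := Nat.mul_le_mul_right (r (size a + s (size a)) + 6 * s (size a) + 4) h1
      simp [st, hcx.symm, hxy.symm, hcy.symm, hSy]
      omega

end PT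

/-! ### From fragments to machines -/

section Machines

theorem initList_stk (tm : FinTM2) (s : List (tm.Γ tm.k₀)) :
    initList tm s = ⟨some tm.main, tm.initialState, update (fun _ => []) tm.k₀ s⟩ := by
  unfold initList
  congr 1
  funext k
  by_cases h : k = tm.k₀
  · subst h; simp
  · simp [h]

theorem haltList_stk (tm : FinTM2) (s : List (tm.Γ tm.k₁)) :
    haltList tm s = ⟨none, tm.initialState, update (fun _ => []) tm.k₁ s⟩ := by
  unfold haltList
  congr 1
  funext k
  by_cases h : k = tm.k₁
  · subst h; simp
  · simp [h]

/-- The machine that runs a fragment. -/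
noncomputable def Frag.toAux {K : Type} [DecidableEq K] [Fintype K] {Γ : K → Type} {σ : Type}
    [Fintype σ] (F : Frag Γ σ) (v₀ : σ) (k₀ k₁ : K) (e₀ : Γ k₀ ≃ Bool) (e₁ : Γ k₁ ≃ Bool) :
    TM2ComputableAux Bool Bool where
  tm :=
    { k₀ := k₀
      k₁ := k₁
      Γ := Γ
      Λ := F.Λ
      main := F.main
      ΛFin := F.fin
      σ := σ
      initialState := v₀
      Γk₀Fin := Fintype.ofEquiv Bool e₀.symm
      -- The final configuration `haltList` requires the initial register value, so it is reloaded
      -- in the halting step.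
      m := fun l => bindStmt id (.load (fun _ => v₀) .halt) (F.code l) }
  inputAlphabet := e₀
  outputAlphabet := e₁

theorem Frag.toAux_outputs {K : Type} [DecidableEq K] [Fintype K] {Γ : K → Type} {σ : Type}
    [Fintype σ] (F : Frag Γ σ) (v₀ : σ) (k₀ k₁ : K) (e₀ : Γ k₀ ≃ Bool) (e₁ : Γ k₁ ≃ Bool)
    {w out : List Bool} {T : ℕ}
    (h : F.Maps v₀ (update (fun _ => []) k₀ (w.map e₀.symm))
      (update (fun _ => []) k₁ (out.map e₁.symm)) T) :
    Outputs (F.toAux v₀ k₀ k₁ e₀ e₁) w out T := by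
  obtain ⟨v', t, ht, h⟩ := h
  have := Steps.bind (m' := (F.toAux v₀ k₀ k₁ e₀ e₁).tm.m) (f := id)
    (e := .load (fun _ => v₀) .halt) (fun l => rfl) h (Steps.refl _)
  refine ⟨⟨⟨t, ?_⟩, ht⟩⟩
  rw [initList_stk, Option.map_some, haltList_stk]
  exact Steps.iterate this

theorem Outputs.steps {M : TM2ComputableAux Bool Bool} {w out : List Bool} {T : ℕ}
    (h : Outputs M w out T) : ∃ t ≤ T, Steps M.tm.m t
      ⟨some M.tm.main, M.tm.initialState,
        update (fun _ => []) M.tm.k₀ (w.map M.inputAlphabet.symm)⟩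
      ⟨none, M.tm.initialState, update (fun _ => []) M.tm.k₁ (out.map M.outputAlphabet.symm)⟩ := by
  obtain ⟨⟨⟨t, h⟩, ht⟩⟩ := h
  rw [initList_stk, Option.map_some, haltList_stk] at h
  exact ⟨t, ht, Steps.of_iterate h⟩

/-- A fragment preserves its input, while a halting machine may have a nonempty stack only at the
output; hence the final `clear`. -/
theorem PT.exists_outputs {f : List Bool → List Bool} (hf : PT f) :
    ∃ (M : TM2ComputableAux Bool Bool) (p : ℕ → ℕ), IsPoly p ∧
      ∀ w, Outputs M w (f w) (p w.length) := by
  classical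
  obtain ⟨T, _, p, hp, hlp, hf⟩ := hf
  obtain ⟨F, hF⟩ := hf (Option T ⊕ Unit) Sum.inr Sum.inl Sum.inl_injective (by simp)
  refine ⟨(F.seq (BFrag.clear (Sum.inr ()))).toAux none (Sum.inr ()) (Sum.inl none)
    (Equiv.refl _) (Equiv.refl _), fun n => p n + (2 * n + 1),
    hp.add (((IsPoly.const 2).mul IsPoly.id).add (IsPoly.const 1)), fun w => ?_⟩
  refine Frag.toAux_outputs _ _ _ _ _ _ ?_
  refine Frag.Maps.to (Frag.seq_maps (hF w _ ?_ ?_ _) fun v => BFrag.clear_maps _ v _) ?_ ?_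
  · rintro ⟨⟩; simp [rep]
  · simp
  · funext k
    rcases k with k | ⟨⟩
    · by_cases hk : k = none
      · subst hk; simp
      · simp [hk]
    · simp
  · simp [size]

end Machines

/-! ### Two families of stacks -/

section Join

variable {K₁ K₂ : Type} [DecidableEq K₁] [DecidableEq K₂] {Γ₁ : K₁ → Type} {Γ₂ : K₂ → Type}
  {Λ σ₁ σ₂ : Type}

/-- The union of two families of stacks. -/
def join (S₁ : ∀ k, List (Γ₁ k)) (S₂ : ∀ k, List (Γ₂ k)) : ∀ k, List (Sum.elim Γ₁ Γ₂ k)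
  | .inl k => S₁ k
  | .inr k => S₂ k

theorem join_update_left (S₁ : ∀ k, List (Γ₁ k)) (S₂ : ∀ k, List (Γ₂ k)) (k : K₁)
    (x : List (Γ₁ k)) : update (join S₁ S₂) (Sum.inl k) x = join (update S₁ k x) S₂ := by
  funext j
  rcases j with j | j
  · by_cases h : j = k
    · subst h; exact (update_self (Sum.inl j) _ _).trans (update_self j x S₁).symm
    · exact (update_of_ne (by simpa using h) _ _).trans (update_of_ne h _ _).symm
  · exact update_of_ne (by simp) _ _

theorem join_update_right (S₁ : ∀ k, List (Γ₁ k)) (S₂ : ∀ k, List (Γ₂ k)) (k : K₂)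
    (x : List (Γ₂ k)) : update (join S₁ S₂) (Sum.inr k) x = join S₁ (update S₂ k x) := by
  funext j
  rcases j with j | j
  · exact update_of_ne (by simp) _ _
  · by_cases h : j = k
    · subst h; exact (update_self (Sum.inr j) _ _).trans (update_self j x S₂).symm
    · exact (update_of_ne (by simpa using h) _ _).trans (update_of_ne h _ _).symm

/-- Execute a statement on the left family of stacks. -/
def leftStmt : TM2.Stmt Γ₁ Λ σ₁ → TM2.Stmt (Sum.elim Γ₁ Γ₂) Λ (σ₁ × σ₂)
  | .push k g q => .push (Sum.inl k) (fun v => g v.1) (leftStmt q)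
  | .peek k g q => .peek (Sum.inl k) (fun v x => (g v.1 x, v.2)) (leftStmt q)
  | .pop k g q => .pop (Sum.inl k) (fun v x => (g v.1 x, v.2)) (leftStmt q)
  | .load g q => .load (fun v => (g v.1, v.2)) (leftStmt q)
  | .branch c q₁ q₂ => .branch (fun v => c v.1) (leftStmt q₁) (leftStmt q₂)
  | .goto l => .goto fun v => l v.1
  | .halt => .halt

/-- Execute a statement on the right family of stacks. -/
def rightStmt : TM2.Stmt Γ₂ Λ σ₂ → TM2.Stmt (Sum.elim Γ₁ Γ₂) Λ (σ₁ × σ₂)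
  | .push k g q => .push (Sum.inr k) (fun v => g v.2) (rightStmt q)
  | .peek k g q => .peek (Sum.inr k) (fun v x => (v.1, g v.2 x)) (rightStmt q)
  | .pop k g q => .pop (Sum.inr k) (fun v x => (v.1, g v.2 x)) (rightStmt q)
  | .load g q => .load (fun v => (v.1, g v.2)) (rightStmt q)
  | .branch c q₁ q₂ => .branch (fun v => c v.2) (rightStmt q₁) (rightStmt q₂)
  | .goto l => .goto fun v => l v.2
  | .halt => .halt

/-- A configuration on the left family of stacks, with a register and the right family added. -/
def leftCfg (u : σ₂) (S₂ : ∀ k, List (Γ₂ k)) (c : TM2.Cfg Γ₁ Λ σ₁) :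
    TM2.Cfg (Sum.elim Γ₁ Γ₂) Λ (σ₁ × σ₂) :=
  ⟨c.l, (c.var, u), join c.stk S₂⟩

/-- A configuration on the right family of stacks, with a register and the left family added. -/
def rightCfg (u : σ₁) (S₁ : ∀ k, List (Γ₁ k)) (c : TM2.Cfg Γ₂ Λ σ₂) :
    TM2.Cfg (Sum.elim Γ₁ Γ₂) Λ (σ₁ × σ₂) :=
  ⟨c.l, (u, c.var), join S₁ c.stk⟩

theorem stepAux_leftStmt (q : TM2.Stmt Γ₁ Λ σ₁) (v : σ₁) (u : σ₂) (S₁ : ∀ k, List (Γ₁ k))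
    (S₂ : ∀ k, List (Γ₂ k)) :
    TM2.stepAux (leftStmt q) (v, u) (join S₁ S₂) = leftCfg u S₂ (TM2.stepAux q v S₁) := by
  induction q generalizing v S₁ with
  | push k g q ih =>
    simp only [leftStmt, TM2.stepAux]
    rw [← ih, ← join_update_left]
    rfl
  | peek k g q ih => exact ih _ _
  | pop k g q ih =>
    simp only [leftStmt, TM2.stepAux]
    rw [← ih, ← join_update_left]
    rfl
  | load g q ih => exact ih _ _
  | branch c q₁ q₂ ih₁ ih₂ =>
    simp only [leftStmt, TM2.stepAux]
    cases c v
    · exact ih₂ _ _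
    · exact ih₁ _ _
  | goto l => rfl
  | halt => rfl

theorem stepAux_rightStmt (q : TM2.Stmt Γ₂ Λ σ₂) (v : σ₂) (u : σ₁) (S₁ : ∀ k, List (Γ₁ k))
    (S₂ : ∀ k, List (Γ₂ k)) :
    TM2.stepAux (rightStmt q) (u, v) (join S₁ S₂) = rightCfg u S₁ (TM2.stepAux q v S₂) := by
  induction q generalizing v S₂ with
  | push k g q ih =>
    simp only [rightStmt, TM2.stepAux]
    rw [← ih, ← join_update_right]
    rfl
  | peek k g q ih => exact ih _ _
  | pop k g q ih =>
    simp only [rightStmt, TM2.stepAux]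
    rw [← ih, ← join_update_right]
    rfl
  | load g q ih => exact ih _ _
  | branch c q₁ q₂ ih₁ ih₂ =>
    simp only [rightStmt, TM2.stepAux]
    cases c v
    · exact ih₂ _ _
    · exact ih₁ _ _
  | goto l => rfl
  | halt => rfl

theorem Steps.left {m : Λ → TM2.Stmt Γ₁ Λ σ₁} {t : ℕ} {c d : TM2.Cfg Γ₁ Λ σ₁}
    (h : Steps m t c d) (u : σ₂) (S₂ : ∀ k, List (Γ₂ k)) :
    Steps (fun l => leftStmt (m l)) t (leftCfg u S₂ c) (leftCfg u S₂ d) := by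
  induction h with
  | refl c => exact Steps.refl _
  | head _ ih =>
    refine Steps.head ?_
    rw [stepAux_leftStmt]
    exact ih

theorem Steps.right {m : Λ → TM2.Stmt Γ₂ Λ σ₂} {t : ℕ} {c d : TM2.Cfg Γ₂ Λ σ₂}
    (h : Steps m t c d) (u : σ₁) (S₁ : ∀ k, List (Γ₁ k)) :
    Steps (fun l => rightStmt (m l)) t (rightCfg u S₁ c) (rightCfg u S₁ d) := by
  induction h with
  | refl c => exact Steps.refl _
  | head _ ih =>
    refine Steps.head ?_
    rw [stepAux_rightStmt]
    exact ih

/-- A fragment acting on the left family of stacks. -/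
def Frag.left (F : Frag Γ₁ σ₁) (Γ₂ : K₂ → Type) (σ₂ : Type) :
    Frag (Sum.elim Γ₁ Γ₂) (σ₁ × σ₂) where
  Λ := F.Λ
  fin := F.fin
  main := F.main
  code l := leftStmt (F.code l)

theorem Frag.left_maps {F : Frag Γ₁ σ₁} {S₁ S₁' : ∀ k, List (Γ₁ k)} {T : ℕ}
    (h : ∀ v, F.Maps v S₁ S₁' T) (S₂ : ∀ k, List (Γ₂ k)) (v : σ₁ × σ₂) :
    (F.left Γ₂ σ₂).Maps v (join S₁ S₂) (join S₁' S₂) T := by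
  obtain ⟨v', t, ht, h⟩ := h v.1
  exact ⟨(v', v.2), t, ht, h.left v.2 S₂⟩

/-- A machine acting on the right family of stacks, started in its initial state. -/
def Frag.right (M : FinTM2) (Γ₁ : K₁ → Type) (σ₁ : Type) :
    Frag (Sum.elim Γ₁ M.Γ) (σ₁ × M.σ) :=
  (Frag.prim (.load (fun v => (v.1, M.initialState)) .halt)).seq
    { Λ := M.Λ
      fin := M.ΛFin
      main := M.main
      code := fun l => rightStmt (M.m l) }

/-- The leading `load` resets the register of the machine, and a correct run leaves only the output
stack nonempty. This makes the machine reusable as a subroutine. -/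
theorem Frag.right_maps {M : TM2ComputableAux Bool Bool} {w out : List Bool} {T : ℕ}
    (h : Outputs M w out T) (S₁ : ∀ k, List (Γ₁ k)) (v : σ₁ × M.tm.σ) :
    (Frag.right M.tm Γ₁ σ₁).Maps v
      (join S₁ (update (fun _ => []) M.tm.k₀ (w.map M.inputAlphabet.symm)))
      (join S₁ (update (fun _ => []) M.tm.k₁ (out.map M.outputAlphabet.symm))) (1 + T) := by
  obtain ⟨t, ht, h⟩ := h.steps
  exact ⟨_, _, Nat.add_le_add_left ht 1,
    Steps.bind (m' := (Frag.right M.tm Γ₁ σ₁).code) (f := Sum.inl) (c := ⟨some (), v, _⟩)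
      (fun l => rfl) (Steps.head (Steps.refl _))
      (Steps.bind (m' := (Frag.right M.tm Γ₁ σ₁).code) (f := Sum.inr) (fun l => rfl)
        (h.right v.1 S₁) (Steps.refl _))⟩

end Join

/-! ### Exhaustive search with a machine as a subroutine -/

section Search

variable {T : Type}

/-- Seven stacks and further stacks that are empty. -/
def stacks7 (g : Fin 7 → List Bool) : Fin 7 ⊕ T → List Bool := Sum.elim g fun _ => []

theorem stacks7_update [DecidableEq T] (g : Fin 7 → List Bool) (i : Fin 7) (x : List Bool) :
    update (stacks7 g : Fin 7 ⊕ T → List Bool) (Sum.inl i) x = stacks7 (update g i x) :=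
  Sum.update_elim_inl

theorem stacks7_inl (g : Fin 7 → List Bool) (i : Fin 7) :
    (stacks7 g : Fin 7 ⊕ T → List Bool) (Sum.inl i) = g i := rfl

/-- The stacks of the search: the input `w`, the state `s`, two work stacks, the stack `go` that is
nonempty while the search goes on, a work stack, the result, and the stacks in `T`. -/
def searchStacks (w s go res : List Bool) : Fin 7 ⊕ T → List Bool :=
  stacks7 ![w, s, [], [], go, [], res]

/-- Move the content of the Boolean stack `a` to the input stack of a machine. -/
def feed (M : TM2ComputableAux Bool Bool) {K : Type} [DecidableEq K] (a : K) :
    Frag (Sum.elim (fun _ : K => Bool) M.tm.Γ) (Option Bool × M.tm.σ) :=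
  Frag.popLoop (Sum.inl a) (fun v b => (b, v.2)) (fun v => v.1.isSome)
    (Frag.prim (.push (Sum.inr M.tm.k₀) (fun v => M.inputAlphabet.symm (v.1.getD false)) .halt))

theorem feed_maps (M : TM2ComputableAux Bool Bool) {K : Type} [DecidableEq K] (a : K)
    (S₁ : K → List Bool) (S₂ : ∀ k, List (M.tm.Γ k)) (v : Option Bool × M.tm.σ) :
    (feed M a).Maps v (join S₁ S₂)
      (join (update S₁ a []) (update S₂ M.tm.k₀
        ((S₁ a).reverse.map M.inputAlphabet.symm ++ S₂ M.tm.k₀))) (2 * (S₁ a).length + 1) := by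
  generalize hl : S₁ a = l
  induction l generalizing S₁ S₂ v with
  | nil =>
    have : update S₁ a [] = S₁ := by rw [← hl, update_eq_self]
    simp only [this, List.reverse_nil, List.map_nil, List.nil_append, update_eq_self]
    exact Frag.popLoop_maps_stop hl rfl
  | cons b l ih =>
    refine Frag.Maps.mono (Frag.popLoop_maps_step (k := Sum.inl a) (T' := 2 * l.length + 1)
      (b := b) (l := l) hl rfl
      (S' := join (update S₁ a l) (update S₂ M.tm.k₀ (M.inputAlphabet.symm b ::
        S₂ M.tm.k₀))) (Frag.prim_maps (v' := (some b, v.2)) ?_) fun v => ?_) ?_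
    · rw [join_update_left, ← join_update_right]
      rfl
    · have := ih (update S₁ a l) (update S₂ M.tm.k₀ (M.inputAlphabet.symm b :: S₂ M.tm.k₀)) v
        (by simp)
      simp only [update_idem, update_self] at this
      simpa [feed] using this
    · simp; omega

theorem popIte_join_left {K₁ K₂ σ : Type} [DecidableEq K₁] [DecidableEq K₂] {Γ₁ : K₁ → Type}
    {Γ₂ : K₂ → Type} {k : K₂} {f : σ → Option (Γ₂ k) → σ} {c : σ → Bool}
    {F G : Frag (Sum.elim Γ₁ Γ₂) σ} {v : σ} {S₁ : ∀ k, List (Γ₁ k)} {S₂ : ∀ k, List (Γ₂ k)}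
    {S' : ∀ k, List (Sum.elim Γ₁ Γ₂ k)} {x : Γ₂ k} {l : List (Γ₂ k)} {T : ℕ}
    (hS : S₂ k = x :: l) (hc : c (f v (some x)) = true)
    (h : F.Maps (f v (some x)) (join S₁ (update S₂ k l)) S' T) :
    (Frag.popIte (Sum.inr k) f c F G).Maps v (join S₁ S₂) S' (T + 1) := by
  refine Frag.popIte_maps_left ?_ ?_
  · change c (f v (S₂ k).head?) = true
    rw [hS]
    exact hc
  · change F.Maps (f v (S₂ k).head?) (update (join S₁ S₂) (Sum.inr k) (S₂ k).tail) S' T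
    rw [join_update_right, hS]
    exact h

theorem popIte_join_right {K₁ K₂ σ : Type} [DecidableEq K₁] [DecidableEq K₂] {Γ₁ : K₁ → Type}
    {Γ₂ : K₂ → Type} {k : K₂} {f : σ → Option (Γ₂ k) → σ} {c : σ → Bool}
    {F G : Frag (Sum.elim Γ₁ Γ₂) σ} {v : σ} {S₁ : ∀ k, List (Γ₁ k)} {S₂ : ∀ k, List (Γ₂ k)}
    {S' : ∀ k, List (Sum.elim Γ₁ Γ₂ k)} {x : Γ₂ k} {l : List (Γ₂ k)} {T : ℕ}
    (hS : S₂ k = x :: l) (hc : c (f v (some x)) = false)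
    (h : G.Maps (f v (some x)) (join S₁ (update S₂ k l)) S' T) :
    (Frag.popIte (Sum.inr k) f c F G).Maps v (join S₁ S₂) S' (T + 1) := by
  refine Frag.popIte_maps_right ?_ ?_
  · change c (f v (S₂ k).head?) = false
    rw [hS]
    exact hc
  · change G.Maps (f v (S₂ k).head?) (update (join S₁ S₂) (Sum.inr k) (S₂ k).tail) S' T
    rw [join_update_right, hS]
    exact h

theorem injective_optionElim {T U : Type} {f : T → U} {x : U} (hf : Injective f)
    (hx : ∀ i, x ≠ f i) : Injective fun i : Option T => i.elim x f := by
  rintro (_ | i) (_ | j) h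
  · rfl
  · exact absurd h (hx j)
  · exact absurd h.symm (hx i)
  · exact congrArg some (hf h)

/-- Run a machine on the content of the Boolean stack `a`, reversed, and then run `F` or `G`
depending on its answer. -/
def query (M : TM2ComputableAux Bool Bool) {K : Type} [DecidableEq K] (a : K) (F G : BFrag K) :
    Frag (Sum.elim (fun _ : K => Bool) M.tm.Γ) (Option Bool × M.tm.σ) :=
  (feed M a).seq ((Frag.right M.tm (fun _ : K => Bool) (Option Bool)).seq
    (Frag.popIte (Sum.inr M.tm.k₁) (fun v x => (x.map M.outputAlphabet, v.2))
      (fun v => v.1.getD false) (F.left _ _) (G.left _ _)))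

theorem query_maps {M : TM2ComputableAux Bool Bool} {K : Type} [DecidableEq K] {a : K}
    {F G : BFrag K} {S S' : K → List Bool} {w : List Bool} {b : Bool} {τ T : ℕ}
    (hw : S a = w.reverse) (hM : Outputs M w [b] τ)
    (h : ∀ v, Frag.Maps (if b then F else G) v (update S a []) S' T)
    (v : Option Bool × M.tm.σ) :
    (query M a F G).Maps v (join S fun _ => []) (join S' fun _ => [])
      (2 * w.length + τ + T + 3) := by
  refine Frag.Maps.mono (Frag.seq_maps (feed_maps M a S _ v) fun v =>
    Frag.seq_maps (T := 1 + τ) (T' := T + 1) (S' := join (update S a [])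
      (update (fun _ => []) M.tm.k₁ ([b].map M.outputAlphabet.symm))) ?_ fun v => ?_) ?_
  · have := Frag.right_maps hM (update S a []) v
    simpa [hw] using this
  -- The answer is a single bit, so popping it leaves all stacks of `M` empty, ready for the next
  -- query.
  · have e : update (update (fun _ => []) M.tm.k₁ ([b].map M.outputAlphabet.symm))
        M.tm.k₁ [] = fun _ => [] := by
      rw [update_idem, update_eq_self_iff]
    cases b
    · refine popIte_join_right (l := []) (update_self M.tm.k₁ _ _) (by simp) ?_
      rw [e]
      exact Frag.left_maps h _ _
    · refine popIte_join_left (l := []) (update_self M.tm.k₁ _ _) (by simp) ?_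
      rw [e]
      exact Frag.left_maps h _ _
  · simp [hw]; omega

variable [DecidableEq T]

/-- A fragment that computes `f w` from the stack `w`, or `f (w, s)` from the stacks `w` and `s`. -/
structure SearchPushes {α β : Type} [Ctx α] [Enc β] (F : BFrag (Fin 7 ⊕ T)) (ι : Ctx.R α → Fin 7)
    (o : Fin 7) (f : α → β) (p : ℕ → ℕ) : Prop where
  maps : ∀ (a : α) (S : Fin 7 ⊕ T → List Bool), (∀ r, S (.inl (ι r)) = rep a r) →
    (∀ t, S (.inr t) = []) → ∀ v,
      Frag.Maps F v S (update S (.inl o) (enc (f a) ++ S (.inl o))) (p (size a))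
  isPoly : IsPoly p
  length_le : ∀ a, (enc (f a)).length ≤ p (size a)

/-- The positions of the strings `s` and `w`. -/
def searchRegs (r : Option Unit) : Fin 7 := r.elim 1 fun _ => 0

/-- Compute the first state. -/
def searchInit (F : BFrag (Fin 7 ⊕ T)) : BFrag (Fin 7 ⊕ T) := F.seq (BFrag.push (.inl 4) true)

theorem searchInit_maps {F : BFrag (Fin 7 ⊕ T)} {f : List Bool → List Bool} {p : ℕ → ℕ}
    (hF : SearchPushes F (fun _ => 0) 1 f p) (w : List Bool) (v : Option Bool) :
    Frag.Maps (searchInit F) v (searchStacks w [] [] []) (searchStacks w (f w) [true] [])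
      (p w.length + 1) := by
  refine Frag.Maps.to (Frag.seq_maps (hF.maps w _ (fun _ => rfl) (fun _ => rfl) v) fun v =>
    BFrag.push_maps _ _ v _) ?_ le_rfl
  simp only [searchStacks, stacks7_update, stacks7_inl]
  congr 1
  funext k
  fin_cases k <;> simp

/-- Compute the question to be asked. -/
def searchInst (F : BFrag (Fin 7 ⊕ T)) : BFrag (Fin 7 ⊕ T) := F.seq (BFrag.move (.inl 2) (.inl 3))

theorem searchInst_maps {F : BFrag (Fin 7 ⊕ T)} {f : List Bool × List Bool → List Bool}
    {p : ℕ → ℕ} (hF : SearchPushes F searchRegs 2 f p) (w s : List Bool) (v : Option Bool) :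
    Frag.Maps (searchInst F) v (searchStacks w s [] [])
      (update (searchStacks w s [] []) (.inl 3) (f (w, s)).reverse)
      (p (w.length + s.length) + (2 * p (w.length + s.length) + 1)) := by
  have hl := hF.length_le (w, s)
  refine Frag.Maps.to (Frag.seq_maps (hF.maps (w, s) _ ?_ (fun _ => rfl) v) fun v =>
    BFrag.move_maps (by simp) v _) ?_ ?_
  · rintro (_ | r) <;> rfl
  · simp only [searchStacks, stacks7_update, stacks7_inl]
    congr 1
    funext k
    fin_cases k <;> simp
  · simp [searchStacks, stacks7_inl, size] at hl ⊢
    omega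

/-- Stop the search with answer no, or compute the next state. -/
def searchNext (F G : BFrag (Fin 7 ⊕ T)) : BFrag (Fin 7 ⊕ T) :=
  F.seq (BFrag.popIf (.inl 5)
    ((BFrag.clear (.inl 5)).seq (BFrag.push (.inl 6) false))
    ((BFrag.clear (.inl 5)).seq (G.seq ((BFrag.clear (.inl 1)).seq
      ((BFrag.move (.inl 2) (.inl 3)).seq ((BFrag.move (.inl 3) (.inl 1)).seq
        (BFrag.push (.inl 4) true)))))))

theorem searchNext_maps {F G : BFrag (Fin 7 ⊕ T)} {f g : List Bool × List Bool → List Bool}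
    {p q : ℕ → ℕ} (hF : SearchPushes F searchRegs 5 f p) (hG : SearchPushes G searchRegs 2 g q)
    (w s : List Bool) (v : Option Bool) :
    Frag.Maps (searchNext F G) v (searchStacks w s [] [])
      (if (f (w, s)).head? = some true then searchStacks w s [] [false]
        else searchStacks w (g (w, s)) [true] [])
      (3 * p (w.length + s.length) + 5 * q (w.length + s.length) + 2 * s.length + 6) := by
  have hl := hF.length_le (w, s)
  have hl' := hG.length_le (w, s)
  simp only [size, enc_list] at hl hl'
  have hr : ∀ x, update (update (update (searchStacks w s [] []) (Sum.inl 5 : Fin 7 ⊕ T) x)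
      (Sum.inl 5) x.tail) (Sum.inl 5) [] = searchStacks w s [] [] := by
    intro x
    rw [update_idem, update_idem, update_eq_self_iff]
    rfl
  have e0 : update (searchStacks w s [] [] : Fin 7 ⊕ T → List Bool) (Sum.inl 5)
      (enc (f (w, s)) ++ searchStacks w s [] [] (Sum.inl 5 : Fin 7 ⊕ T)) =
      update (searchStacks w s [] []) (Sum.inl 5) (f (w, s)) := by
    simp [searchStacks, stacks7_update, stacks7_inl]
  refine Frag.Maps.mono (Frag.seq_maps (hF.maps (w, s) _ ?_ (fun _ => rfl) v) fun v => ?_)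
    (?_ : p (w.length + s.length) + (2 * p (w.length + s.length) + 5 * q (w.length + s.length) +
      2 * s.length + 6) ≤ _)
  · rintro (_ | r) <;> rfl
  · rw [e0]
    by_cases h : (f (w, s)).head? = some true
    · rw [if_pos h]
      refine Frag.Maps.to (Frag.popIte_maps_left (by simp [h]) (Frag.seq_maps
        (BFrag.clear_maps _ _ _) fun v => BFrag.push_maps _ _ v _)) ?_ ?_
      · rw [update_self, hr]
        simp only [searchStacks, stacks7_update, stacks7_inl]
        congr 1
        funext k
        fin_cases k <;> simp
      · simp
        omega
    · rw [if_neg h]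
      refine Frag.Maps.to (Frag.popIte_maps_right ?_ (Frag.seq_maps
        (BFrag.clear_maps _ _ _) fun v => Frag.seq_maps (hG.maps (w, s) _ ?_ ?_ v) fun v =>
        Frag.seq_maps (BFrag.clear_maps _ v _) fun v =>
        Frag.seq_maps (BFrag.move_maps (by simp) v _) fun v =>
        Frag.seq_maps (BFrag.move_maps (by simp) v _) fun v => BFrag.push_maps _ _ v _)) ?_ ?_
      · cases hf : f (w, s) <;> simp_all
      · rw [update_self, hr]
        rintro (_ | r) <;> rfl
      · rw [update_self, hr]
        intro i; rfl
      · rw [update_self, hr]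
        simp only [searchStacks, stacks7_update, stacks7_inl]
        congr 1
        funext k
        fin_cases k <;> simp
      · simp only [update_self, hr]
        simp [size, searchStacks, stacks7_update, stacks7_inl]
        omega
  · omega

/-- Empty the stacks at the end of the search. -/
def searchClean : BFrag (Fin 7 ⊕ T) := (BFrag.clear (.inl 0)).seq (BFrag.clear (.inl 1))

theorem searchClean_maps (w s : List Bool) (b : Bool) (v : Option Bool) :
    Frag.Maps (searchClean (T := T)) v (searchStacks w s [] [b]) (searchStacks [] [] [] [b])
      (2 * w.length + 1 + (2 * s.length + 1)) := by
  refine Frag.Maps.to (Frag.seq_maps (BFrag.clear_maps _ v _) fun v =>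
    BFrag.clear_maps _ v _) ?_ ?_
  · simp only [searchStacks, stacks7_update]
    congr 1
    funext k
    fin_cases k <;> simp
  · simp [searchStacks, stacks7_inl]

/-- One round of the search. -/
def searchRound (M : TM2ComputableAux Bool Bool) (F₁ F₂ F₃ : BFrag (Fin 7 ⊕ T)) :
    Frag (Sum.elim (fun _ : Fin 7 ⊕ T => Bool) M.tm.Γ) (Option Bool × M.tm.σ) :=
  ((searchInst F₁).left M.tm.Γ M.tm.σ).seq
    (query M (.inl 3) (BFrag.push (.inl 6) true) (searchNext F₃ F₂))

open Classical in
theorem searchRound_maps {M : TM2ComputableAux Bool Bool} {F₁ F₂ F₃ : BFrag (Fin 7 ⊕ T)}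
    {f₁ f₂ f₃ : List Bool × List Bool → List Bool} {p₁ p₂ p₃ : ℕ → ℕ}
    (hF₁ : SearchPushes F₁ searchRegs 2 f₁ p₁) (hF₂ : SearchPushes F₂ searchRegs 2 f₂ p₂)
    (hF₃ : SearchPushes F₃ searchRegs 5 f₃ p₃) {w s : List Bool} {Q : Prop} {τ m : ℕ}
    (hm : w.length + s.length ≤ m) (hM : Answers M (f₁ (w, s)) Q τ)
    (v : Option Bool × M.tm.σ) :
    (searchRound M F₁ F₂ F₃).Maps v (join (searchStacks w s [] []) fun _ => [])
      (join (if Q then searchStacks w s [] [true] else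
        if (f₃ (w, s)).head? = some true then searchStacks w s [] [false]
        else searchStacks w (f₂ (w, s)) [true] []) fun _ => [])
      (τ + (5 * p₁ m + 3 * p₃ m + 5 * p₂ m + 2 * m + 20)) := by
  have hl := hF₁.length_le (w, s)
  have hout : Outputs M (f₁ (w, s)) [decide Q] τ := by
    by_cases hQ : Q
    · simpa [hQ] using hM.1 hQ
    · simpa [hQ] using hM.2 hQ
  have m1 := hF₁.isPoly.mono hm
  have m2 := hF₂.isPoly.mono hm
  have m3 := hF₃.isPoly.mono hm
  have hu : ∀ x, update (update (searchStacks w s [] [] : Fin 7 ⊕ T → List Bool) (.inl 3) x)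
      (.inl 3) [] = searchStacks w s [] [] := by
    intro x
    rw [update_idem, update_eq_self_iff]
    rfl
  refine Frag.Maps.to (Frag.seq_maps (Frag.left_maps (searchInst_maps hF₁ w s) _ v) fun v =>
    query_maps (w := f₁ (w, s)) (update_self _ _ _) hout (S' := if Q then
        searchStacks w s [] [true] else
        if (f₃ (w, s)).head? = some true then searchStacks w s [] [false]
        else searchStacks w (f₂ (w, s)) [true] []) (T := 3 * p₃ m + 5 * p₂ m + 2 * m + 7)
        (fun v => ?_) v) rfl ?_
  · rw [hu]
    by_cases hQ : Q
    · simp only [hQ, decide_true, if_true]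
      refine Frag.Maps.to (BFrag.push_maps _ _ v _) ?_ (by omega)
      simp only [searchStacks, stacks7_update, stacks7_inl]
      congr 1
      funext k
      fin_cases k <;> simp
    · simp only [hQ, decide_false, if_false, Bool.false_eq_true]
      exact (searchNext_maps hF₃ hF₂ w s v).mono (by omega)
  · simp only [size, enc_list] at hl
    omega

/-- The loop of the search. -/
def searchLoop (M : TM2ComputableAux Bool Bool) (F₁ F₂ F₃ : BFrag (Fin 7 ⊕ T)) :
    Frag (Sum.elim (fun _ : Fin 7 ⊕ T => Bool) M.tm.Γ) (Option Bool × M.tm.σ) :=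
  Frag.popLoop (Sum.inl (.inl 4)) (fun v b => (b, v.2)) (fun v => v.1.isSome)
    (searchRound M F₁ F₂ F₃)

theorem searchLoop_stop {M : TM2ComputableAux Bool Bool} {F₁ F₂ F₃ : BFrag (Fin 7 ⊕ T)}
    (w s : List Bool) (b : Bool) (v : Option Bool × M.tm.σ) :
    (searchLoop M F₁ F₂ F₃).Maps v (join (searchStacks w s [] [b]) fun _ => [])
      (join (searchStacks w s [] [b]) fun _ => []) 1 :=
  Frag.popLoop_maps_stop (k := Sum.inl (Sum.inl 4)) rfl rfl

theorem searchLoop_step {M : TM2ComputableAux Bool Bool} {F₁ F₂ F₃ : BFrag (Fin 7 ⊕ T)}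
    {w s : List Bool} {S S' : ∀ k, List (Sum.elim (fun _ : Fin 7 ⊕ T => Bool) M.tm.Γ k)}
    {t t' : ℕ}
    (h : ∀ v, (searchRound M F₁ F₂ F₃).Maps v (join (searchStacks w s [] []) fun _ => []) S t)
    (h' : ∀ v, (searchLoop M F₁ F₂ F₃).Maps v S S' t') (v : Option Bool × M.tm.σ) :
    (searchLoop M F₁ F₂ F₃).Maps v (join (searchStacks w s [true] []) fun _ => []) S'
      (t + t' + 1) := by
  refine Frag.popLoop_maps_step (k := Sum.inl (Sum.inl 4)) (b := true) (l := []) rfl rfl ?_ h'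
  have : join (update (searchStacks w s [true] []) (Sum.inl 4) [] : Fin 7 ⊕ T → List Bool)
      (fun k : M.tm.K => ([] : List (M.tm.Γ k))) =
      join (searchStacks w s [] []) fun _ => [] := by
    simp only [searchStacks, stacks7_update]
    congr 2
    funext k
    fin_cases k <;> simp
  have h := h (some true, v.2)
  rw [← this, ← join_update_left] at h
  exact h

-- Induction on the number `k + 1` of rounds that remain; there is at least one, since `fin` is
-- tested only after the query. All earlier queries were negative, so stopping at the first yes, or
-- at the last no, leaves the truth value of the existential statement.
open Classical in
theorem searchLoop_maps {M : TM2ComputableAux Bool Bool} {F₁ F₂ F₃ : BFrag (Fin 7 ⊕ T)}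
    {f₁ f₂ f₃ : List Bool × List Bool → List Bool} {p₁ p₂ p₃ : ℕ → ℕ}
    (hF₁ : SearchPushes F₁ searchRegs 2 f₁ p₁) (hF₂ : SearchPushes F₂ searchRegs 2 f₂ p₂)
    (hF₃ : SearchPushes F₃ searchRegs 5 f₃ p₃) {w : List Bool} {st : ℕ → List Bool}
    (hst : ∀ i, st (i + 1) = f₂ (w, st i)) {n τ m : ℕ} {Q : ℕ → Prop}
    (hm : ∀ i < n, w.length + (st i).length ≤ m)
    (hfin : ∀ i < n, ((f₃ (w, st i)).head? = some true ↔ i + 1 = n))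
    (hM : ∀ i < n, Answers M (f₁ (w, st i)) (Q i) τ) (k i : ℕ) (hk : i + (k + 1) = n)
    (hQ : ∀ j < i, ¬ Q j) :
    ∃ s, w.length + s.length ≤ m ∧ ∀ v : Option Bool × M.tm.σ,
      (searchLoop M F₁ F₂ F₃).Maps v (join (searchStacks w (st i) [true] []) fun _ => [])
        (join (searchStacks w s [] [decide (∃ j < n, Q j)]) fun _ => [])
        ((k + 1) * (τ + (5 * p₁ m + 3 * p₃ m + 5 * p₂ m + 2 * m + 21)) + 1) := by
  induction k generalizing i with
  | zero =>
    refine ⟨st i, hm i (by omega), fun v => ?_⟩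
    refine Frag.Maps.mono (searchLoop_step (fun v => ?_) (searchLoop_stop _ _ _) v)
      (?_ : (τ + (5 * p₁ m + 3 * p₃ m + 5 * p₂ m + 2 * m + 20)) + 1 + 1 ≤ _)
    · convert searchRound_maps hF₁ hF₂ hF₃ (hm i (by omega)) (hM i (by omega)) _ using 2
      have : (∃ j < n, Q j) ↔ Q i := by
        constructor
        · rintro ⟨j, hj, h⟩
          by_cases hji : j = i
          · exact hji ▸ h
          · exact absurd h (hQ j (by omega))
        · exact fun h => ⟨i, by omega, h⟩
      rw [if_pos ((hfin i (by omega)).2 (by omega))]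
      by_cases h : Q i <;> simp [this, h]
    · omega
  | succ k ih =>
    by_cases h : Q i
    · refine ⟨st i, hm i (by omega), fun v => ?_⟩
      refine Frag.Maps.mono (searchLoop_step (fun v => ?_) (searchLoop_stop _ _ _) v)
        (?_ : (τ + (5 * p₁ m + 3 * p₃ m + 5 * p₂ m + 2 * m + 20)) + 1 + 1 ≤ _)
      · convert searchRound_maps hF₁ hF₂ hF₃ (hm i (by omega)) (hM i (by omega)) _ using 2
        have : ∃ j < n, Q j := ⟨i, by omega, h⟩
        simp [this, h]
      · rw [add_mul]
        omega
    · obtain ⟨s, hs, ih⟩ := ih (i + 1) (by omega) (fun j hj => by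
        by_cases hji : j = i
        · exact hji ▸ h
        · exact hQ j (by omega))
      refine ⟨s, hs, fun v => ?_⟩
      refine Frag.Maps.mono (searchLoop_step (fun v => ?_) ih v)
        (?_ : (τ + (5 * p₁ m + 3 * p₃ m + 5 * p₂ m + 2 * m + 20)) + _ + 1 ≤ _)
      · convert searchRound_maps hF₁ hF₂ hF₃ (hm i (by omega)) (hM i (by omega)) _ using 2
        rw [if_neg h, if_neg (fun h => by have := (hfin i (by omega)).1 h; omega), hst]
      · rw [add_mul (k + 1) 1]
        omega

/-- Search through the states `s₀ = init w, …, sₙ₋₁`, where `sᵢ₊₁ = next (w, sᵢ)` and `sₙ₋₁` is the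
first state satisfying `fin`, for a state on which the machine answers yes. -/
theorem exists_search (M : TM2ComputableAux Bool Bool) {init : List Bool → List Bool}
    {inst next fin : List Bool × List Bool → List Bool} (h_init : PT init) (h_inst : PT inst)
    (h_next : PT next) (h_fin : PT fin) :
    ∃ (M' : TM2ComputableAux Bool Bool) (p : ℕ → ℕ), IsPoly p ∧
      ∀ (w : List Bool) (st : ℕ → List Bool) (n m τ : ℕ) (Q : ℕ → Prop), 0 < n →
        st 0 = init w → (∀ i, st (i + 1) = next (w, st i)) →
        (∀ i < n, w.length + (st i).length ≤ m) →
        (∀ i < n, ((fin (w, st i)).head? = some true ↔ i + 1 = n)) →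
        (∀ i < n, Answers M (inst (w, st i)) (Q i) τ) →
        Answers M' w (∃ i < n, Q i) (n * (τ + p m) + p m) := by
  classical
  obtain ⟨T₀, _, p₀, hp₀, hl₀, h_init⟩ := h_init
  obtain ⟨T₁, _, p₁, hp₁, hl₁, h_inst⟩ := h_inst
  obtain ⟨T₂, _, p₂, hp₂, hl₂, h_next⟩ := h_next
  obtain ⟨T₃, _, p₃, hp₃, hl₃, h_fin⟩ := h_fin
  -- The four fragments share the seven named stacks and have private work stacks in different
  -- summands. Stacks 0 and 1 hold `w` and the state, so outputs computed from both lie above 1.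
  have hι : ∀ {V : Type} (o : Fin 7) (g : V → T₀ ⊕ T₁ ⊕ T₂ ⊕ T₃), 1 < o →
      ∀ (r : Option Unit) (i : Option V), (Sum.inl (searchRegs r) : Fin 7 ⊕ (T₀ ⊕ T₁ ⊕ T₂ ⊕ T₃)) ≠
        i.elim (Sum.inl o) fun i => Sum.inr (g i) := by
    rintro V o g ho (_ | r) (_ | i) h
    · simp only [searchRegs, Option.elim, Sum.inl.injEq] at h; omega
    · simp at h
    · simp only [searchRegs, Option.elim, Sum.inl.injEq] at h; omega
    · simp at h
  have hτ : ∀ {V : Type} (o : Fin 7) (g : V → T₀ ⊕ T₁ ⊕ T₂ ⊕ T₃), Injective g →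
      Injective fun i : Option V => i.elim (Sum.inl o : Fin 7 ⊕ (T₀ ⊕ T₁ ⊕ T₂ ⊕ T₃))
        fun i => Sum.inr (g i) := fun o g hg =>
    injective_optionElim (Sum.inr_injective.comp hg) (by simp)
  obtain ⟨F₀, hF₀⟩ := h_init (Fin 7 ⊕ (T₀ ⊕ T₁ ⊕ T₂ ⊕ T₃)) (fun _ => .inl 0) _
    (hτ 1 Sum.inl Sum.inl_injective) (by rintro r (_ | i) h <;> simp at h)
  obtain ⟨F₁, hF₁⟩ := h_inst (Fin 7 ⊕ (T₀ ⊕ T₁ ⊕ T₂ ⊕ T₃)) (fun r => .inl (searchRegs r)) _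
    (hτ 2 (fun i => .inr (.inl i)) (Sum.inr_injective.comp Sum.inl_injective))
    (hι _ _ (by decide))
  obtain ⟨F₂, hF₂⟩ := h_next (Fin 7 ⊕ (T₀ ⊕ T₁ ⊕ T₂ ⊕ T₃)) (fun r => .inl (searchRegs r)) _
    (hτ 2 (fun i => .inr (.inr (.inl i)))
      (Sum.inr_injective.comp (Sum.inr_injective.comp Sum.inl_injective))) (hι _ _ (by decide))
  obtain ⟨F₃, hF₃⟩ := h_fin (Fin 7 ⊕ (T₀ ⊕ T₁ ⊕ T₂ ⊕ T₃)) (fun r => .inl (searchRegs r)) _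
    (hτ 5 (fun i => .inr (.inr (.inr i)))
      (Sum.inr_injective.comp (Sum.inr_injective.comp Sum.inr_injective))) (hι _ _ (by decide))
  have hF₀ : SearchPushes F₀ (fun _ => 0) 1 init p₀ :=
    ⟨fun a S hS hT v => hF₀ a S hS (fun i => hT _) v, hp₀, hl₀⟩
  have hF₁ : SearchPushes F₁ searchRegs 2 inst p₁ :=
    ⟨fun a S hS hT v => hF₁ a S hS (fun i => hT _) v, hp₁, hl₁⟩
  have hF₂ : SearchPushes F₂ searchRegs 2 next p₂ :=
    ⟨fun a S hS hT v => hF₂ a S hS (fun i => hT _) v, hp₂, hl₂⟩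
  have hF₃ : SearchPushes F₃ searchRegs 5 fin p₃ :=
    ⟨fun a S hS hT v => hF₃ a S hS (fun i => hT _) v, hp₃, hl₃⟩
  have := M.tm.kFin
  have := M.tm.σFin
  refine ⟨(((searchInit F₀).left M.tm.Γ M.tm.σ).seq ((searchLoop M F₁ F₂ F₃).seq
    (searchClean.left M.tm.Γ M.tm.σ))).toAux (none, M.tm.initialState) (.inl (.inl 0))
    (.inl (.inl 6)) (Equiv.refl Bool) (Equiv.refl Bool),
    fun m => p₀ m + (5 * p₁ m + 3 * p₃ m + 5 * p₂ m + 2 * m + 21) + 4 * m + 10, ?_,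
    fun w st n m τ Q hn h0 hst hm hfin hM => ?_⟩
  · exact ((hp₀.add (((((IsPoly.const 5).mul hp₁).add ((IsPoly.const 3).mul hp₃)).add
      ((IsPoly.const 5).mul hp₂)).add ((IsPoly.const 2).mul IsPoly.id) |>.add
      (IsPoly.const 21))).add ((IsPoly.const 4).mul IsPoly.id)).add (IsPoly.const 10)
  · obtain ⟨s, hs, hloop⟩ := searchLoop_maps hF₁ hF₂ hF₃ hst hm hfin hM (n - 1) 0 (by omega)
      (by simp)
    have hnil : (stacks7 (fun _ => []) : Fin 7 ⊕ (T₀ ⊕ T₁ ⊕ T₂ ⊕ T₃) → List Bool) =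
        fun _ => [] := by
      funext k
      rcases k with k | k <;> rfl
    have hstk : ∀ (k : Fin 7) (x : List Bool) (w out : List Bool),
        (searchStacks w [] [] out : Fin 7 ⊕ (T₀ ⊕ T₁ ⊕ T₂ ⊕ T₃) → List Bool) =
          update (fun _ => []) (Sum.inl k) x →
        (join (searchStacks w [] [] out : Fin 7 ⊕ (T₀ ⊕ T₁ ⊕ T₂ ⊕ T₃) → List Bool)
          fun k : M.tm.K => ([] : List (M.tm.Γ k))) =
          update (fun k => ([] : List (Sum.elim (fun _ : Fin 7 ⊕ (T₀ ⊕ T₁ ⊕ T₂ ⊕ T₃) => Bool)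
            M.tm.Γ k))) (Sum.inl (Sum.inl k)) x := by
      intro k x w out h
      rw [h, ← join_update_left]
      congr 1
      funext j
      rcases j with j | j <;> rfl
    have key : Outputs ((((searchInit F₀).left M.tm.Γ M.tm.σ).seq ((searchLoop M F₁ F₂ F₃).seq
        (searchClean.left M.tm.Γ M.tm.σ))).toAux (none, M.tm.initialState) (.inl (.inl 0))
        (.inl (.inl 6)) (Equiv.refl Bool) (Equiv.refl Bool)) w [decide (∃ j < n, Q j)]
        (n * (τ + (p₀ m + (5 * p₁ m + 3 * p₃ m + 5 * p₂ m + 2 * m + 21) + 4 * m + 10)) +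
          (p₀ m + (5 * p₁ m + 3 * p₃ m + 5 * p₂ m + 2 * m + 21) + 4 * m + 10)) := by
      refine Frag.toAux_outputs _ _ _ _ _ _ ?_
      have h1 := hstk 0 (w.map (Equiv.refl Bool).symm) w [] (by
        rw [show w.map (Equiv.refl Bool).symm = w from List.map_id w]
        simp only [searchStacks]
        rw [← hnil, stacks7_update]
        congr 1
        funext k
        fin_cases k <;> simp)
      have h2 := hstk 6 ([decide (∃ j < n, Q j)].map (Equiv.refl Bool).symm) []
        [decide (∃ j < n, Q j)] (by
        simp only [searchStacks]
        rw [← hnil, stacks7_update]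
        congr 1
        funext k
        fin_cases k <;> simp)
      have hmain := Frag.seq_maps (Frag.left_maps (searchInit_maps hF₀ w) (fun _ => [])
          ((none, M.tm.initialState) : Option Bool × M.tm.σ)) fun v =>
        Frag.seq_maps (h0 ▸ hloop v) fun v => Frag.left_maps (searchClean_maps w s _) _ v
      rw [h1, h2] at hmain
      refine Frag.Maps.mono hmain ?_
      have hw : w.length ≤ m := by have := hm 0 hn; omega
      have hp := hp₀.mono hw
      have hn1 : n - 1 + 1 = n := by omega
      rw [hn1]
      have : n * (τ + (5 * p₁ m + 3 * p₃ m + 5 * p₂ m + 2 * m + 21)) ≤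
        n * (τ + (p₀ m + (5 * p₁ m + 3 * p₃ m + 5 * p₂ m + 2 * m + 21) + 4 * m + 10)) :=
        Nat.mul_le_mul_left _ (by omega)
      omega
    constructor
    · intro h; simpa [h] using key
    · intro h; simpa [h] using key

end Search

open Finset

section Library

variable {α β γ : Type} [Ctx α] [Enc β] [Enc γ]

/-! ### Polynomial-time arithmetic in unary -/

theorem PT.congr {f g : α → β} (hf : PT f) (h : ∀ a, f a = g a) : PT g := funext h ▸ hf

theorem PT.of_enc {f : α → β} (hf : PT fun a => enc (f a)) : PT f := hf

theorem PT.enc {f : α → β} (hf : PT f) : PT fun a => enc (f a) := hf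

theorem PT.exists_bound {f : α → β} (hf : PT f) :
    ∃ s, IsPoly s ∧ ∀ a, (DecodedMI.enc (f a)).length ≤ s (size a) := by
  obtain ⟨_, _, p, hp, h, -⟩ := hf
  exact ⟨p, hp, h⟩

theorem PT.list (l : List Bool) : PT fun _ : α => l := by
  induction l with
  | nil => exact PT.nil
  | cons b l ih => exact (PT.bit b).append ih

theorem PT.const (n : ℕ) : PT fun _ : α => n := PT.of_enc (PT.list _)

theorem PT.add {f g : α → ℕ} (hf : PT f) (hg : PT g) : PT fun a => f a + g a :=
  PT.of_enc ((PT.append hf.enc hg.enc).congr fun a => by simp)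

theorem PT.flatMap' {m : α → ℕ} {f : α → ℕ → List Bool} (hm : PT m)
    (hf : PT fun x : α × ℕ => f x.1 x.2) : PT fun a => (List.range (m a)).flatMap (f a) :=
  PT.flatMap hm hf

/-- In unary, a sum is a concatenation of strings. -/
theorem PT.sum {m : α → ℕ} {f : α → ℕ → ℕ} (hm : PT m) (hf : PT fun x : α × ℕ => f x.1 x.2) :
    PT fun a => ∑ i ∈ range (m a), f a i := by
  refine PT.of_enc ((PT.flatMap' hm (f := fun a i => DecodedMI.enc (f a i)) hf.enc).congr
    fun a => ?_)
  generalize m a = k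
  induction k with
  | zero => simp
  | succ k ih => rw [List.range_succ, List.flatMap_append, ih, Finset.sum_range_succ]; simp

theorem PT.mul {f g : α → ℕ} (hf : PT f) (hg : PT g) : PT fun a => f a * g a :=
  (PT.sum hf (f := fun a _ => g a) hg.weaken).congr fun a => by simp

theorem PT.pred {f : α → ℕ} (hf : PT f) : PT fun a => f a - 1 :=
  PT.of_enc (hf.enc.tail.congr fun a => by simp)

theorem PT.iterate' {m : α → ℕ} {g : α → β} {h : α → β → β} (hm : PT m) (hg : PT g)
    (hh : PT fun x : α × β => h x.1 x.2) {s : ℕ → ℕ} (hs : IsPoly s)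
    (hls : ∀ a, ∀ i ≤ m a, (DecodedMI.enc ((h a)^[i] (g a))).length ≤ s (size a)) :
    PT fun a => (h a)^[m a] (g a) :=
  PT.iterate hm hg hh hs hls

theorem PT.sub {f g : α → ℕ} (hf : PT f) (hg : PT g) : PT fun a => f a - g a := by
  obtain ⟨s, hs, hb⟩ := hf.exists_bound
  have key : ∀ x i, (fun y => y - 1)^[i] x = x - i := fun x i => by
    induction i with
    | zero => rfl
    | succ i ih => rw [iterate_succ_apply', ih]; omega
  refine (PT.iterate' hg hf (h := fun _ x => x - 1) PT.snd.pred hs fun a i _ => ?_).congr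
    fun a => key _ _
  have := hb a
  simp only [key, enc_nat, List.length_replicate] at *
  omega

/-! ### Predicates decidable in polynomial time -/

open Classical in
/-- Predicates decidable in polynomial time. -/
def PD (P : α → Prop) : Prop := PT fun a => if P a then [true] else []

theorem PD.congr {P Q : α → Prop} (hP : PD P) (h : ∀ a, P a ↔ Q a) : PD Q :=
  (funext fun a => propext (h a)) ▸ hP

theorem PD.ite {P : α → Prop} [∀ a, Decidable (P a)] {f g : α → β} (hP : PD P) (hf : PT f)
    (hg : PT g) : PT fun a => if P a then f a else g a :=
  (PT.ifHead hP hf hg).congr fun a => by by_cases h : P a <;> simp [h]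

theorem PD.head {f : α → List Bool} (hf : PT f) : PD fun a => (f a).head? = some true := by
  classical exact (PT.ifHead hf (PT.bit true) PT.nil).congr fun a => by congr

theorem PD.pos {f : α → ℕ} (hf : PT f) : PD fun a => 0 < f a :=
  (PD.head hf.enc).congr fun a => by cases h : f a <;> simp [List.replicate_succ]

theorem PD.not {P : α → Prop} (hP : PD P) : PD fun a => ¬ P a := by
  classical
  exact (PD.pos (hP.ite (PT.const 0) (PT.const 1))).congr fun a => by
    by_cases h : P a <;> simp [h]

theorem PD.and {P Q : α → Prop} (hP : PD P) (hQ : PD Q) : PD fun a => P a ∧ Q a := by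
  classical
  exact (PD.pos (hP.ite (hQ.ite (PT.const 1) (PT.const 0)) (PT.const 0))).congr fun a => by
    by_cases h : P a <;> by_cases h' : Q a <;> simp [h, h']

theorem PD.or {P Q : α → Prop} (hP : PD P) (hQ : PD Q) : PD fun a => P a ∨ Q a := by
  classical
  exact (PD.pos (hP.ite (PT.const 1) (hQ.ite (PT.const 1) (PT.const 0)))).congr fun a => by
    by_cases h : P a <;> by_cases h' : Q a <;> simp [h, h']

theorem PD.lt {f g : α → ℕ} (hf : PT f) (hg : PT g) : PD fun a => f a < g a :=
  (PD.pos (hg.sub hf)).congr fun a => by omega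

theorem PD.le {f g : α → ℕ} (hf : PT f) (hg : PT g) : PD fun a => f a ≤ g a :=
  (PD.lt hg hf).not.congr fun a => by omega

theorem PD.eq {f g : α → ℕ} (hf : PT f) (hg : PT g) : PD fun a => f a = g a :=
  ((PD.le hf hg).and (PD.le hg hf)).congr fun a => by omega

theorem PD.ex {m : α → ℕ} {P : α → ℕ → Prop} (hm : PT m) (hP : PD fun x : α × ℕ => P x.1 x.2) :
    PD fun a => ∃ i < m a, P a i := by
  classical
  refine (PD.pos (PT.sum hm (f := fun a i => if P a i then 1 else 0)
    (hP.ite (PT.const 1) (PT.const 0)))).congr fun a => ?_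
  simp only [Finset.sum_pos_iff, Finset.mem_range]
  refine exists_congr fun i => and_congr_right fun _ => ?_
  by_cases h : P a i <;> simp [h]

theorem PD.all {m : α → ℕ} {P : α → ℕ → Prop} (hm : PT m) (hP : PD fun x : α × ℕ => P x.1 x.2) :
    PD fun a => ∀ i < m a, P a i :=
  (PD.ex (P := fun a i => ¬ P a i) hm hP.not).not.congr fun a => by simp

theorem PD.bit {P : α → Prop} [∀ a, Decidable (P a)] (hP : PD P) :
    PT fun a => [decide (P a)] :=
  (hP.ite (PT.bit true) (PT.bit false)).congr fun a => by by_cases h : P a <;> simp [h]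

theorem PD.bits {m : α → ℕ} {P : α → ℕ → Prop} [∀ a i, Decidable (P a i)] (hm : PT m)
    (hP : PD fun x : α × ℕ => P x.1 x.2) :
    PT fun a => (List.range (m a)).map fun i => decide (P a i) :=
  (PT.flatMap' hm (f := fun a i => [decide (P a i)]) hP.bit).congr fun a => by
    rw [List.map_eq_flatMap]

/-! ### Division, powers and roots -/

theorem PT.min {f g : α → ℕ} (hf : PT f) (hg : PT g) : PT fun a => min (f a) (g a) :=
  ((PD.le hf hg).ite hf hg).congr fun a => by rw [min_def]

/-- For a positive divisor, the quotient counts the `i < f a` with `(i + 1) * g a ≤ f a`. Division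
by zero is treated apart to give `0`. -/
theorem PT.div {f g : α → ℕ} (hf : PT f) (hg : PT g) : PT fun a => f a / g a := by
  have h : PT fun a => ∑ i ∈ range (f a), if (i + 1) * g a ≤ f a then 1 else 0 :=
    PT.sum hf ((PD.le ((PT.snd.add (PT.const 1)).mul hg.weaken) hf.weaken).ite
      (PT.const 1) (PT.const 0))
  refine ((PD.pos hg).ite h (PT.const 0)).congr fun a => ?_
  rcases Nat.eq_zero_or_pos (g a) with h0 | h0
  · simp [h0]
  · rw [if_pos h0, ← Finset.card_filter]
    have : (range (f a)).filter (fun i => (i + 1) * g a ≤ f a) = range (f a / g a) := by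
      ext i
      simp only [mem_filter, Finset.mem_range, ← Nat.le_div_iff_mul_le h0]
      have := Nat.div_le_self (f a) (g a)
      omega
    rw [this, card_range]

theorem PT.mod {f g : α → ℕ} (hf : PT f) (hg : PT g) : PT fun a => f a % g a :=
  (hf.sub (hg.mul (hf.div hg))).congr fun a => by
    have := Nat.mod_add_div (f a) (g a)
    omega

/-- The power may be too long to be written in unary, so the division by `g a` is iterated instead.
-/
theorem PT.divPow {f g h : α → ℕ} (hf : PT f) (hg : PT g) (hh : PT h) :
    PT fun a => f a / g a ^ h a := by
  obtain ⟨s, hs, hb⟩ := hf.exists_bound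
  have key : ∀ x n i : ℕ, (fun y => y / n)^[i] x = x / n ^ i := fun x n i => by
    induction i with
    | zero => simp
    | succ i ih => rw [iterate_succ_apply', ih, Nat.div_div_eq_div_mul, pow_succ]
  refine (PT.iterate' hh hf (h := fun a x => x / g a) (PT.snd.div hg.weaken) hs
    fun a i _ => ?_).congr fun a => key _ _ _
  have := hb a
  simp only [key, enc_nat, List.length_replicate] at *
  exact (Nat.div_le_self _ _).trans this

/-- To avoid an exponentially long power, the successive products are truncated at `h a + 1`, which
does not affect the comparison with `h a`. -/
theorem PD.powEq {f g h : α → ℕ} (hf : PT f) (hg : PT g) (hh : PT h) :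
    PD fun a => f a ^ g a = h a := by
  obtain ⟨s, hs, hb⟩ := hh.exists_bound
  have key : ∀ n B i, (fun y => min (y * n) B)^[i] (min 1 B) = min (n ^ i) B := fun n B i => by
    induction i with
    | zero => simp
    | succ i ih =>
      rw [iterate_succ_apply', ih, pow_succ]
      rcases Nat.eq_zero_or_pos n with rfl | hn
      · simp
      · rcases le_total (n ^ i) B with h | h
        · rw [min_eq_left h]
        · rw [min_eq_right h, min_eq_right (Nat.le_mul_of_pos_right B hn),
            min_eq_right (h.trans (Nat.le_mul_of_pos_right _ hn))]
  have : PT fun a => min (f a ^ g a) (h a + 1) := by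
    refine (PT.iterate' hg ((PT.const 1).min (hh.add (PT.const 1)))
      (h := fun a y => min (y * f a) (h a + 1))
      ((PT.snd.mul hf.weaken).min (hh.add (PT.const 1)).weaken)
      (hs.add (IsPoly.const 1)) fun a i _ => ?_).congr fun a => key _ _ _
    have := hb a
    simp only [key, enc_nat, List.length_replicate] at *
    omega
  exact (PD.eq this hh).congr fun a => by omega

theorem PT.sqrt {f : α → ℕ} (hf : PT f) : PT fun a => (f a).sqrt := by
  have h : PT fun a => ∑ i ∈ range (f a), if (i + 1) * (i + 1) ≤ f a then 1 else 0 :=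
    PT.sum hf ((PD.le ((PT.snd.add (PT.const 1)).mul (PT.snd.add (PT.const 1)))
      hf.weaken).ite (PT.const 1) (PT.const 0))
  refine h.congr fun a => ?_
  rw [← Finset.card_filter]
  have : (range (f a)).filter (fun i => (i + 1) * (i + 1) ≤ f a) = range (f a).sqrt := by
    ext i
    simp only [mem_filter, Finset.mem_range, ← Nat.le_sqrt]
    have := Nat.sqrt_le_self (f a)
    omega
  rw [this, card_range]

/-! ### Strings -/

theorem PT.drop {f : α → List Bool} {n : α → ℕ} (hf : PT f) (hn : PT n) :
    PT fun a => (f a).drop (n a) := by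
  obtain ⟨s, hs, hb⟩ := hf.exists_bound
  have key : ∀ (l : List Bool) i, List.tail^[i] l = l.drop i := fun l i => by
    induction i with
    | zero => rfl
    | succ i ih => rw [iterate_succ_apply', ih, List.tail_drop]
  refine (PT.iterate' hn hf (h := fun _ l => l.tail) PT.snd.tail hs fun a i _ => ?_).congr
    fun a => key _ _
  have := hb a
  change (List.tail^[i] (f a)).length ≤ _
  rw [key, List.length_drop]
  simp only [enc_list] at this
  omega

theorem PD.get {f : α → List Bool} {n : α → ℕ} (hf : PT f) (hn : PT n) :
    PD fun a => (f a)[n a]? = some true :=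
  (PD.head (hf.drop hn)).congr fun a => by simp

/-- The number of elements `true` at the front of a string. -/
def leadingOnes (w : List Bool) : ℕ := (w.takeWhile id).length

theorem leadingOnes_eq (w : List Bool) :
    ∑ i ∈ range w.length, (if ∀ j < i + 1, w[j]? = some true then 1 else 0) = leadingOnes w := by
  induction w with
  | nil => rfl
  | cons b w ih =>
    rw [List.length_cons, Finset.sum_range_succ']
    cases b
    · have : ∀ i, ¬ ∀ j < i + 1, (false :: w)[j]? = some true := fun i h => by
        have := h 0 (by omega)
        simp at this
      simp only [if_neg (this _)]
      simp [leadingOnes]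
    · have : ∀ i, (∀ j < i + 1 + 1, (true :: w)[j]? = some true) ↔
          ∀ j < i + 1, w[j]? = some true := fun i => by
        constructor
        · intro h j hj
          simpa using h (j + 1) (by omega)
        · rintro h (_ | j) hj
          · simp
          · simpa using h j (by omega)
      simp only [this]
      rw [ih]
      simp [leadingOnes]

theorem PT.leadingOnes {f : α → List Bool} (hf : PT f) : PT fun a => leadingOnes (f a) := by
  have h : PT fun a => ∑ i ∈ range (f a).length,
      (if ∀ j < i + 1, (f a)[j]? = some true then 1 else 0) :=
    PT.sum hf.length ((PD.all (PT.snd.add (PT.const 1))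
      (P := fun x j => (f x.1)[j]? = some true) (PD.get hf.weaken.weaken PT.snd)).ite
      (PT.const 1) (PT.const 0))
  exact h.congr fun a => leadingOnes_eq _

/-! ### Lists of natural numbers as strings -/

/-- A list of natural numbers, in unary. -/
def encodeSeq (l : List ℕ) : List Bool := l.flatMap fun n => List.replicate n true ++ [false]

/-- The `i`-th number of a list of natural numbers in unary. -/
def field (w : List Bool) (i : ℕ) : ℕ :=
  leadingOnes ((fun v => v.drop (leadingOnes v + 1))^[i] w)

theorem leadingOnes_replicate (n : ℕ) (v : List Bool) :
    leadingOnes (List.replicate n true ++ false :: v) = n := by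
  induction n with
  | zero => simp [leadingOnes]
  | succ n ih => simp [leadingOnes, List.replicate_succ]

theorem field_encodeSeq (l : List ℕ) (i : ℕ) : field (encodeSeq l) i = l.getD i 0 := by
  have h1 := leadingOnes_replicate
  induction i generalizing l with
  | zero =>
    cases l with
    | nil => rfl
    | cons n l => simp [field, encodeSeq, h1]
  | succ i ih =>
    cases l with
    | nil => exact ih []
    | cons n l =>
      rw [List.getD_cons_succ, ← ih]
      simp only [field, iterate_succ_apply]
      congr 2
      simp [encodeSeq, h1, List.drop_append]

theorem PT.field {f : α → List Bool} {n : α → ℕ} (hf : PT f) (hn : PT n) :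
    PT fun a => field (f a) (n a) := by
  obtain ⟨s, hs, hb⟩ := hf.exists_bound
  refine PT.leadingOnes (PT.iterate' hn hf
    (h := fun _ v => v.drop (DecodedMI.leadingOnes v + 1))
    (PT.snd.drop (PT.snd.leadingOnes.add (PT.const 1))) hs fun a i _ => ?_)
  refine le_trans ?_ (hb a)
  simp only [enc_list]
  induction i with
  | zero => simp
  | succ i ih =>
    rw [iterate_succ_apply', List.length_drop]
    omega

theorem encodeSeq_range (n : ℕ) (f : ℕ → ℕ) :
    encodeSeq ((List.range n).map f) =
      (List.range n).flatMap fun i => List.replicate (f i) true ++ [false] := by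
  simp [encodeSeq, List.flatMap_map]

theorem PT.encodeSeq {n : α → ℕ} {f : α → ℕ → ℕ} (hn : PT n)
    (hf : PT fun x : α × ℕ => f x.1 x.2) : PT fun a => encodeSeq ((List.range (n a)).map (f a)) :=
  (PT.flatMap' hn (f := fun a i => DecodedMI.enc (f a i) ++ [false])
    (hf.enc.append (PT.bit false))).congr fun _ => (encodeSeq_range _ _).symm

theorem field_encodeSeq_range {n : ℕ} (f : ℕ → ℕ) {i : ℕ} (hi : i < n) :
    field (encodeSeq ((List.range n).map f)) i = f i := by
  rw [field_encodeSeq, List.getD_eq_getElem _ _ (by simpa using hi)]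
  simp

/-! ### Encodings -/

/-- A string in the encoding of a tuple. -/
def encodeItem (w : List Bool) : List Bool := (w.flatMap fun b => [true, b]) ++ [false]

theorem encodeTuple_eq (l : List (List Bool)) : encodeTuple l = l.flatMap encodeItem := rfl

theorem PT.encodeItem {f : α → List Bool} (hf : PT f) : PT fun a => encodeItem (f a) := by
  have h : PT fun a => (List.range (f a).length).flatMap
      (fun i => [true] ++ [decide ((f a)[i]? = some true)]) ++ [false] :=
    (PT.flatMap' hf.length ((PT.bit true).append
      (PD.bit (PD.get hf.weaken PT.snd)))).append (PT.bit false)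
  refine h.congr fun a => ?_
  rw [DecodedMI.encodeItem]
  congr 1
  generalize f a = w
  induction w with
  | nil => rfl
  | cons b w ih =>
    rw [List.length_cons, List.range_succ_eq_map, List.flatMap_cons, List.flatMap_map,
      List.flatMap_cons, ← ih]
    cases b <;> simp

/-- `encodeNat` writes the least significant bit first. Zero is excluded because its encoding is the
empty string. -/
theorem encodeNat_two_mul_add (n b : ℕ) (hb : b < 2) (h : 0 < 2 * n + b) :
    Computability.encodeNat (2 * n + b) = decide (b = 1) :: Computability.encodeNat n := by
  have h1 : ((2 * n + b : ℕ) : Num) = if b = 1 then (n : Num).bit1 else (n : Num).bit0 := by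
    have := Num.ofNat'_bit (decide (b = 1)) n
    rw [Num.ofNat'_eq, Num.ofNat'_eq] at this
    obtain rfl | rfl : b = 0 ∨ b = 1 := by omega
    · simpa [Nat.bit] using this
    · simpa [Nat.bit] using this
  rw [Computability.encodeNat, Computability.encodeNat, h1]
  have h2 : (n : Num) = 0 ↔ n = 0 := by
    exact_mod_cast Nat.cast_inj (R := Num) (m := n) (n := 0)
  cases hn : (n : Num) with
  | zero =>
    obtain rfl := h2.1 hn
    obtain rfl : b = 1 := by omega
    rfl
  | pos m => split_ifs with hb <;> simp [Num.bit1, Num.bit0, Computability.encodeNum,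
      Computability.encodePosNum, hb]

/-- Positions beyond the leading bit contribute the empty string, so any range of length at least
`n` will do. -/
theorem encodeNat_eq (n m : ℕ) (h : n ≤ m) : Computability.encodeNat n =
    (List.range m).flatMap fun i => if n / 2 ^ i = 0 then [] else [decide (n / 2 ^ i % 2 = 1)] := by
  induction m generalizing n with
  | zero => obtain rfl : n = 0 := by omega
            rfl
  | succ m ih =>
    rw [List.range_succ_eq_map, List.flatMap_cons, List.flatMap_map]
    have h2 : ∀ i, n / 2 ^ (i + 1) = n / 2 / 2 ^ i := fun i => by
      rw [Nat.div_div_eq_div_mul, pow_succ']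
    simp only [Nat.succ_eq_add_one, h2]
    rw [← ih (n / 2) (by omega)]
    rcases Nat.eq_zero_or_pos n with rfl | hn
    · rfl
    · have := encodeNat_two_mul_add (n / 2) (n % 2) (Nat.mod_lt _ two_pos) (by omega)
      rw [Nat.div_add_mod] at this
      rw [this, if_neg (by simp; omega)]
      simp

theorem PT.encodeNat {f : α → ℕ} (hf : PT f) : PT fun a => Computability.encodeNat (f a) := by
  have h : PT fun a => (List.range (f a)).flatMap fun i =>
      if f a / 2 ^ i = 0 then [] else [decide (f a / 2 ^ i % 2 = 1)] := by
    have hd : PT fun x : α × ℕ => f x.1 / 2 ^ x.2 := hf.weaken.divPow (PT.const 2) PT.snd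
    exact PT.flatMap' hf ((PD.eq hd (PT.const 0)).ite PT.nil
      (PD.bit (PD.eq (hd.mod (PT.const 2)) (PT.const 1))))
  exact h.congr fun a => (encodeNat_eq _ _ le_rfl).symm

theorem encodeFinset_range (n : ℕ) : encodeFinset (range n) =
    (List.range n).flatMap fun i => encodeItem (Computability.encodeNat i) := by
  have : (range n).sort (· ≤ ·) = List.range n := Finset.sort_range n
  rw [encodeFinset, this, encodeTuple_eq, List.flatMap_map]

theorem indicatorBits_range (n : ℕ) (S : Finset ℕ) :
    indicatorBits (range n) S = (List.range n).map fun x => decide (x ∈ S) := by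
  have : (range n).sort (· ≤ ·) = List.range n := Finset.sort_range n
  rw [indicatorBits, this]

theorem PT.encodeFinset_range {f : α → ℕ} (hf : PT f) : PT fun a => encodeFinset (range (f a)) :=
  (PT.flatMap' hf (f := fun _ i => DecodedMI.encodeItem (Computability.encodeNat i))
    PT.snd.encodeNat.encodeItem).congr fun _ => (DecodedMI.encodeFinset_range _).symm

/-! ### Parsing encoded tuples -/

/-- The number of bits in the first string of an encoded tuple. -/
def firstLength (w : List Bool) : ℕ := leadingOnes ((List.range w.length).map fun i =>
  decide (w[2 * i]? = some true))

/-- The first string of an encoded tuple. -/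
def firstItem (w : List Bool) : List Bool :=
  (List.range (firstLength w)).map fun i => decide (w[2 * i + 1]? = some true)

/-- An encoded tuple without its first string. -/
def dropItem (w : List Bool) : List Bool := w.drop (2 * firstLength w + 1)

theorem PT.firstLength {f : α → List Bool} (hf : PT f) : PT fun a => firstLength (f a) :=
  PT.leadingOnes (PD.bits (P := fun a i => (f a)[2 * i]? = some true) hf.length
    (PD.get hf.weaken ((PT.const 2).mul PT.snd)))

theorem PT.firstItem {f : α → List Bool} (hf : PT f) : PT fun a => firstItem (f a) :=
  PD.bits (P := fun a i => (f a)[2 * i + 1]? = some true) hf.firstLength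
    (PD.get hf.weaken (((PT.const 2).mul PT.snd).add (PT.const 1)))

theorem PT.dropItem {f : α → List Bool} (hf : PT f) : PT fun a => dropItem (f a) :=
  hf.drop (((PT.const 2).mul hf.firstLength).add (PT.const 1))

theorem flatMap_pair_getElem? (w v : List Bool) (i : ℕ) (hi : i < w.length) :
    ((w.flatMap fun b => [true, b]) ++ v)[2 * i]? = some true ∧
      ((w.flatMap fun b => [true, b]) ++ v)[2 * i + 1]? = w[i]? := by
  induction w generalizing i with
  | nil => simp at hi
  | cons b w ih =>
    cases i with
    | zero => simp
    | succ i => simpa [Nat.mul_succ] using ih i (by simpa using hi)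

theorem length_flatMap_pair (w : List Bool) :
    (w.flatMap fun b => [true, b]).length = 2 * w.length := by
  simp [List.length_flatMap, mul_comm]

/-- The even positions carry the markers: `true` before each bit of `w` and the terminator `false`
at position `2 * w.length`. Whatever follows does not matter. -/
theorem firstLength_encodeItem (w v : List Bool) :
    firstLength (encodeItem w ++ v) = w.length := by
  have hl := length_flatMap_pair w
  have he : encodeItem w ++ v = (w.flatMap fun b => [true, b]) ++ (false :: v) := by
    simp [encodeItem]
  rw [he]
  have h : ∀ m, w.length < m → (List.range m).map
      (fun i => decide (((w.flatMap fun b => [true, b]) ++ (false :: v))[2 * i]? = some true)) =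
      List.replicate w.length true ++ false :: ((List.range (m - w.length - 1)).map
        fun i => decide (((w.flatMap fun b => [true, b]) ++
          (false :: v))[2 * (w.length + 1 + i)]? = some true)) := by
    intro m hm
    refine List.ext_getElem (by simp; omega) fun i h1 h2 => ?_
    rw [List.getElem_map, List.getElem_range]
    rcases lt_trichotomy i w.length with hi | rfl | hi
    · rw [List.getElem_append_left (by simpa using hi),
        (flatMap_pair_getElem? w _ i hi).1]
      simp
    · rw [List.getElem_append_right (by simp), List.getElem?_append_right hl.le, hl]
      simp
    · rw [List.getElem_append_right (by simpa using hi.le)]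
      obtain ⟨k, rfl⟩ : ∃ k, i = w.length + 1 + k := ⟨i - (w.length + 1), by omega⟩
      have : w.length + 1 + k - w.length = k + 1 := by omega
      simp [this]
  rw [firstLength, h _ (by simp; omega), leadingOnes_replicate]

theorem firstItem_encodeItem (w v : List Bool) : firstItem (encodeItem w ++ v) = w := by
  rw [firstItem, firstLength_encodeItem]
  refine List.ext_getElem (by simp) fun i h1 h2 => ?_
  rw [List.getElem_map, List.getElem_range, encodeItem, List.append_assoc,
    (flatMap_pair_getElem? w _ i h2).2, List.getElem?_eq_getElem h2]
  simp

theorem dropItem_encodeItem (w v : List Bool) : dropItem (encodeItem w ++ v) = v := by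
  rw [dropItem, firstLength_encodeItem]
  exact List.drop_left' (by simp [encodeItem, mul_comm])

end Library

/-! ### Matroids from finite independence systems -/

theorem SetSystem.isMatroid_of (X : SetSystem) (h_empty : ∅ ∈ X.feasible)
    (h_subset : ∀ I J, J ∈ X.feasible → I ⊆ J → I ∈ X.feasible)
    (h_aug : ∀ I J, I ∈ X.feasible → J ∈ X.feasible → I.card < J.card →
      ∃ e ∈ J, e ∉ I ∧ insert e I ∈ X.feasible) : X.IsMatroid :=
  ⟨(IndepMatroid.ofFinset (X.ground : Set ℕ) (· ∈ X.feasible) h_empty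
    (fun I J => h_subset I J) (fun I J => h_aug I J)
    fun I hI => by exact_mod_cast X.subset_ground I hI).matroid, rfl, fun S => by
      rw [IndepMatroid.matroid_Indep, IndepMatroid.ofFinset_indep]⟩

/-! ### Grid matroids on natural numbers -/

/-- The `j`-th digit of `x` in base `n`. -/
def digit (n j x : ℕ) : ℕ := x / n ^ j % n

theorem digit_lt {n : ℕ} (hn : 0 < n) (j x : ℕ) : digit n j x < n := Nat.mod_lt _ hn

theorem digit_gridCode {n d : ℕ} (e : Grid n d) (j : Fin d) :
    digit n j (gridCode n d e) = e j := by
  obtain ⟨x, rfl⟩ := finFunctionFinEquiv.symm.surjective e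
  change digit n j (finFunctionFinEquiv (finFunctionFinEquiv.symm x) : Fin (n ^ d)) = _
  rw [Equiv.apply_symm_apply]
  rfl

theorem map_gridCode_univ (n d : ℕ) : (univ.map (gridCode n d) : Finset ℕ) = range (n ^ d) := by
  ext x
  simp only [Finset.mem_map, Finset.mem_univ, true_and, Finset.mem_range]
  constructor
  · rintro ⟨e, rfl⟩
    exact (finFunctionFinEquiv e).2
  · intro hx
    exact ⟨finFunctionFinEquiv.symm ⟨x, hx⟩, by simp [gridCode]⟩

theorem digits_injective {n d a b : ℕ} (ha : a < n ^ d) (hb : b < n ^ d)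
    (h : ∀ j < d, digit n j a = digit n j b) : a = b := by
  have : finFunctionFinEquiv.symm (⟨a, ha⟩ : Fin (n ^ d)) = finFunctionFinEquiv.symm ⟨b, hb⟩ :=
    funext fun j => Fin.ext (h j j.2)
  simpa using this

/-- The number of elements of `T` whose `j`-th digit is `i`. -/
def slice (n j : ℕ) (T : Finset ℕ) (i : ℕ) : ℕ := (T.filter fun x => digit n j x = i).card

theorem slice_mono {n j i : ℕ} {S T : Finset ℕ} (h : S ⊆ T) : slice n j S i ≤ slice n j T i :=
  card_le_card (filter_subset_filter _ h)

theorem slice_insert {n j i e : ℕ} {T : Finset ℕ} (h : e ∉ T) :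
    slice n j (insert e T) i = slice n j T i + if digit n j e = i then 1 else 0 := by
  rw [slice, filter_insert]
  split_ifs with he
  · rw [card_insert_of_notMem (by simp [h])]
    rfl
  · rfl

theorem sum_slice {n : ℕ} (hn : 0 < n) (j : ℕ) (T : Finset ℕ) :
    ∑ i ∈ range n, slice n j T i = T.card :=
  (card_eq_sum_card_fiberwise fun x _ => by simpa using digit_lt hn j x).symm

theorem slice_map {n d : ℕ} (S : Finset (Grid n d)) (i : Fin n) (j : Fin d) :
    slice n j (S.map (gridCode n d)) i = sliceCard S i j := by
  rw [slice, filter_map, card_map, sliceCard]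
  congr 1
  refine filter_congr fun e _ => ?_
  rw [Function.comp_apply, digit_gridCode, Fin.ext_iff]

theorem exists_map_gridCode {n d : ℕ} {T : Finset ℕ} (hT : T ⊆ range (n ^ d)) :
    ∃ S : Finset (Grid n d), T = S.map (gridCode n d) := by
  rw [← map_gridCode_univ] at hT
  obtain ⟨S, -, h⟩ := subset_map_iff.1 hT
  exact ⟨S, h⟩

theorem gridSystem_eq {n d : ℕ} {𝓘 : Set (Finset (Grid n d))} {X : SetSystem}
    (hX : X.ground = range (n ^ d)) (h : ∀ S, S ∈ 𝓘 ↔ S.map (gridCode n d) ∈ X.feasible) :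
    gridSystem 𝓘 = X := by
  refine SetSystem.ext ((map_gridCode_univ n d).trans hX.symm) (Set.ext fun T => ⟨?_, fun hT => ?_⟩)
  · rintro ⟨S, hS, rfl⟩
    exact (h S).1 hS
  · obtain ⟨S, rfl⟩ := exists_map_gridCode (hX ▸ X.subset_ground T hT)
    exact ⟨S, (h S).2 hT, rfl⟩

/-- The partition matroid on `{0, …, n ^ d - 1}` given by the `j`-th digit in base `n`. -/
def digitMatroid (n d j : ℕ) (c : ℕ → ℕ) : SetSystem where
  ground := range (n ^ d)
  feasible := {T | T ⊆ range (n ^ d) ∧ ∀ i < n, slice n j T i ≤ c i}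
  subset_ground _ h := h.1

theorem partitionMatroid_eq {n d : ℕ} (L : Matrix (Fin n) (Fin d) ℕ) (j : Fin d) (c : ℕ → ℕ)
    (hc : ∀ i : Fin n, L i j = c i) : partitionMatroid L j = digitMatroid n d j c := by
  refine gridSystem_eq rfl fun S => ?_
  simp only [digitMatroid, Set.mem_ofPred_eq]
  rw [← map_gridCode_univ, and_iff_right (map_subset_map.2 (subset_univ S))]
  refine ⟨fun h i hi => ?_, fun h i => ?_⟩
  · exact ((slice_map S ⟨i, hi⟩ j).trans_le (h _)).trans_eq (hc _)
  · rw [← slice_map, hc]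
    exact h i i.2

/-- If `I` is smaller than `J`, some slice of `I` is smaller than that of `J`. An element of `J` in
this slice but not in `I` can be added, since the capacity there is not exhausted. -/
theorem digitMatroid_isMatroid {n : ℕ} (hn : 0 < n) (d j : ℕ) (c : ℕ → ℕ) :
    (digitMatroid n d j c).IsMatroid := by
  refine SetSystem.isMatroid_of _ ⟨by simp, fun i _ => by simp [slice]⟩
    (fun I J hJ h => ⟨h.trans hJ.1, fun i hi => (slice_mono h).trans (hJ.2 i hi)⟩)
    fun I J hI hJ h => ?_
  rw [← sum_slice hn j I, ← sum_slice hn j J] at h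
  obtain ⟨i, hi, hlt⟩ := exists_lt_of_sum_lt h
  obtain ⟨e, heJ, heI⟩ := exists_mem_notMem_of_card_lt_card hlt
  simp only [Finset.mem_filter, not_and] at heJ heI
  have he : e ∉ I := fun h => heI h heJ.2
  refine ⟨e, heJ.1, he, insert_subset (hJ.1 heJ.1) hI.1, fun i' hi' => ?_⟩
  rw [slice_insert he]
  split_ifs with h'
  · obtain rfl : i = i' := heJ.2.symm.trans h'
    exact Nat.succ_le_of_lt (hlt.trans_le (hJ.2 i hi'))
  · exact hI.2 i' hi'

/-! ### Perfect sets and the sparse paving matroid -/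

/-- The sets whose digits are distributed as prescribed by `L`. -/
def Perf (n d : ℕ) (L : ℕ → ℕ → ℕ) (T : Finset ℕ) : Prop :=
  ∀ i < n, ∀ j < d, slice n j T i = L i j

/-- If both sets were perfect, then for each `j` the slice of `b` at the `j`-th digit of `a` would
have to be raised too, so `a` and `b` would agree in all digits. This is the sparse paving property:
perfect sets are not related by a single exchange. -/
theorem not_perf_insert {n d : ℕ} {L : ℕ → ℕ → ℕ} {I : Finset ℕ} {a b : ℕ} (hn : 0 < n)
    (ha : a < n ^ d) (hb : b < n ^ d) (haI : a ∉ I) (hbI : b ∉ I) (hab : a ≠ b) :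
    ¬ Perf n d L (insert a I) ∨ ¬ Perf n d L (insert b I) := by
  by_contra! h
  refine hab (digits_injective ha hb fun j hj => ?_)
  have h1 := h.1 _ (digit_lt hn j a) j hj
  have h2 := h.2 _ (digit_lt hn j a) j hj
  rw [slice_insert haI, if_pos rfl] at h1
  rw [slice_insert hbI] at h2
  split_ifs at h2 with h3
  · exact h3.symm
  · omega

/-- The sparse paving matroid on `{0, …, n ^ d - 1}` in which the bases are those sets of the
right cardinality which are not perfect or satisfy `P`. -/
def pavingMatroid (n d : ℕ) (L : ℕ → ℕ → ℕ) (P : Finset ℕ → Prop) : SetSystem where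
  ground := range (n ^ d)
  feasible := {T | T ⊆ range (n ^ d) ∧ (T.card < ∑ i ∈ range n, L i 0 ∨
    T.card = ∑ i ∈ range n, L i 0 ∧ (¬ Perf n d L T ∨ P T))}
  subset_ground _ h := h.1

theorem exists_basis_superset {n d : ℕ} {L : ℕ → ℕ → ℕ} {I : Finset ℕ} {k : ℕ} (hn : 0 < n)
    (hk : k < n ^ d) (hI : I ⊆ range (n ^ d)) (hlt : I.card < k) :
    ∃ B, I ⊆ B ∧ B ⊆ range (n ^ d) ∧ B.card = k ∧ ¬ Perf n d L B := by
  -- Enlarge `I` to `k - 1` elements. As `k < n ^ d`, at least two points remain outside, and at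
  -- most one of them completes `U` to a perfect set.
  obtain ⟨U, hIU, hU, hUc⟩ := exists_subsuperset_card_eq hI (n := k - 1) (by omega)
    (by rw [card_range]; omega)
  have : 1 < (range (n ^ d) \ U).card := by
    rw [card_sdiff_of_subset hU, card_range]
    omega
  obtain ⟨a, ha, b, hb, hab⟩ := one_lt_card.1 this
  simp only [Finset.mem_sdiff, Finset.mem_range] at ha hb
  have hc : ∀ x ∉ U, (insert x U).card = k := fun x hx => by
    rw [card_insert_of_notMem hx]
    omega
  rcases not_perf_insert (L := L) hn ha.1 hb.1 ha.2 hb.2 hab with h | h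
  · exact ⟨_, hIU.trans (subset_insert _ _), insert_subset (by simpa using ha.1) hU, hc a ha.2, h⟩
  · exact ⟨_, hIU.trans (subset_insert _ _), insert_subset (by simpa using hb.1) hU, hc b hb.2, h⟩

/-- Below the rank every set is independent, so augmentation matters only from `k - 1` to `k`
elements. If `J \ I` is a single point, adding it gives `J` itself; otherwise there are two
candidates, and by `not_perf_insert` one of them gives a set that is not perfect. -/
theorem pavingMatroid_isMatroid {n d : ℕ} {L : ℕ → ℕ → ℕ} {P : Finset ℕ → Prop} (hn : 0 < n)
    (hk : 0 < ∑ i ∈ range n, L i 0) : (pavingMatroid n d L P).IsMatroid := by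
  refine SetSystem.isMatroid_of _ ⟨by simp, Or.inl (by simpa using hk)⟩
    (fun I J hJ h => ⟨h.trans hJ.1, ?_⟩) fun I J hI hJ h => ?_
  · rcases h.eq_or_ssubset with rfl | h'
    · exact hJ.2
    · have h1 := card_lt_card h'
      have h2 := hJ.2
      exact Or.inl (by omega)
  · have h1 : J.card ≤ ∑ i ∈ range n, L i 0 := by
      have := hJ.2
      omega
    have hins : ∀ e ∈ J, insert e I ⊆ range (n ^ d) := fun e he => insert_subset (hJ.1 he) hI.1
    rcases (show I.card + 1 ≤ ∑ i ∈ range n, L i 0 by omega).lt_or_eq with h2 | h2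
    · obtain ⟨e, heJ, heI⟩ := exists_mem_notMem_of_card_lt_card h
      exact ⟨e, heJ, heI, hins e heJ, Or.inl (by rwa [card_insert_of_notMem heI])⟩
    · have hJc : J.card = ∑ i ∈ range n, L i 0 := by omega
      have hb : ∀ e ∈ J, e ∉ I → (¬ Perf n d L (insert e I) ∨ P (insert e I)) →
          ∃ e ∈ J, e ∉ I ∧ insert e I ∈ (pavingMatroid n d L P).feasible := fun e he he' hP =>
        ⟨e, he, he', hins e he, Or.inr ⟨by rw [card_insert_of_notMem he', h2], hP⟩⟩
      have hd : 0 < (J \ I).card := by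
        have := le_card_sdiff I J
        omega
      rcases (show 1 ≤ (J \ I).card from hd).eq_or_lt with h3 | h3
      · obtain ⟨e, he⟩ := card_eq_one.1 h3.symm
        have heJ : e ∈ J ∧ e ∉ I := Finset.mem_sdiff.1 (he ▸ mem_singleton_self e)
        have : insert e I = J := by
          refine (eq_of_subset_of_card_le (fun x hx => ?_) ?_).symm
          · by_cases hxI : x ∈ I
            · exact mem_insert_of_mem hxI
            · have : x ∈ J \ I := Finset.mem_sdiff.2 ⟨hx, hxI⟩
              rw [he, mem_singleton] at this
              exact this ▸ mem_insert_self _ _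
          · rw [card_insert_of_notMem heJ.2]
            omega
        refine hb e heJ.1 heJ.2 (this ▸ ?_)
        rcases hJ.2 with h4 | h4
        · omega
        · exact h4.2
      · obtain ⟨a, ha, b, hb', hab⟩ := one_lt_card.1 h3
        rw [Finset.mem_sdiff] at ha hb'
        have h5 : ∀ x ∈ J, x < n ^ d := fun x hx => Finset.mem_range.1 (hJ.1 hx)
        rcases not_perf_insert (L := L) hn (h5 a ha.1) (h5 b hb'.1) ha.2 hb'.2 hab with h4 | h4
        · exact hb a ha.1 ha.2 (Or.inl h4)
        · exact hb b hb'.1 hb'.2 (Or.inl h4)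

/-! ### Clauses as characteristic vectors -/

/-- The position of a literal in a characteristic vector. -/
def litIndex {N : ℕ} (x : Fin N × Bool) : ℕ := 2 * x.1 + if x.2 then 0 else 1

theorem litIndex_injective {N : ℕ} : Function.Injective (litIndex (N := N)) := by
  rintro ⟨i, b⟩ ⟨j, c⟩ h
  cases b <;> cases c <;> simp [litIndex, Prod.ext_iff, Fin.ext_iff] at h ⊢ <;> omega

open Classical in
/-- The clause with characteristic vector `B`. -/
noncomputable def clauseOf (N : ℕ) (B : ℕ → Prop) : Finset (Fin N × Bool) :=
  univ.filter fun x => B (litIndex x)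

theorem mem_clauseOf {N : ℕ} {B : ℕ → Prop} {x : Fin N × Bool} :
    x ∈ clauseOf N B ↔ B (litIndex x) := by
  simp [clauseOf]

open Classical in
theorem card_clauseOf (N : ℕ) (B : ℕ → Prop) :
    (clauseOf N B).card = ((range (2 * N)).filter B).card := by
  rw [← card_map ⟨litIndex, litIndex_injective⟩]
  congr 1
  ext q
  simp only [mem_clauseOf, Finset.mem_map, Finset.mem_filter, Function.Embedding.coeFn_mk,
    Finset.mem_range]
  constructor
  · rintro ⟨x, hx, rfl⟩
    refine ⟨?_, hx⟩
    have := x.1.2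
    rw [litIndex]
    split_ifs <;> omega
  · rintro ⟨hq, hB⟩
    have : litIndex ((⟨q / 2, by omega⟩, decide (q % 2 = 0)) : Fin N × Bool) = q := by
      simp only [litIndex, decide_eq_true_eq]
      split_ifs <;> omega
    exact ⟨_, this.symm ▸ hB, this⟩

/-- The set `T` of true variables satisfies the clauses with characteristic vectors `B c`. -/
def ClauseSat (N m : ℕ) (B : ℕ → ℕ → Prop) (T : Finset ℕ) : Prop :=
  ∀ c < m, ∃ q < 2 * N, B c q ∧ (q % 2 = 0 ↔ q / 2 ∈ T)

/-- Position `q` belongs to the variable `q / 2`, and the literal is positive iff `q` is even; so a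
literal at `q` is true iff evenness of `q` is equivalent to membership of `q / 2`. -/
theorem mem_solutions_iff {r N m : ℕ} {B : ℕ → ℕ → Prop} {A : SATInstance r N}
    (hA : A.clauses = (List.range m).map fun c => clauseOf N (B c)) (S : Finset (Fin N)) :
    S ∈ A.solutions ↔ ClauseSat N m B (S.map Fin.valEmbedding) := by
  simp only [SATInstance.solutions, Set.mem_ofPred_eq, hA, List.mem_map, List.mem_range,
    forall_exists_index, and_imp, forall_apply_eq_imp_iff₂, ClauseSat]
  refine forall₂_congr fun c _ => ⟨?_, ?_⟩
  · rintro ⟨i, ⟨hC, hS⟩ | ⟨hC, hS⟩⟩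
    · refine ⟨2 * i, by omega, by simpa [mem_clauseOf, litIndex] using hC, ?_⟩
      simpa [Fin.ext_iff] using ⟨i, hS, rfl⟩
    · refine ⟨2 * i + 1, by omega, by simpa [mem_clauseOf, litIndex] using hC, ?_⟩
      have : (2 * (i : ℕ) + 1) / 2 = i := by omega
      rw [this, iff_comm]
      refine iff_of_false ?_ (by omega)
      simp only [Finset.mem_map, Fin.valEmbedding_apply, not_exists, not_and]
      intro x hx h
      exact hS (Fin.ext h ▸ hx)
  · rintro ⟨q, hq, hB, h⟩
    refine ⟨⟨q / 2, by omega⟩, ?_⟩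
    have h1 : q / 2 ∈ S.map Fin.valEmbedding ↔ (⟨q / 2, by omega⟩ : Fin N) ∈ S := by
      rw [← mem_map' (s := S) Fin.valEmbedding]
      rfl
    rw [h1] at h
    by_cases h0 : q % 2 = 0
    · refine Or.inl ⟨?_, h.1 h0⟩
      have : 2 * (q / 2) = q := by omega
      simpa [mem_clauseOf, litIndex, this] using hB
    · refine Or.inr ⟨?_, fun h2 => h0 (h.2 h2)⟩
      have : 2 * (q / 2) + 1 = q := by omega
      simpa [mem_clauseOf, litIndex, this] using hB

theorem exists_clauseOf {r N : ℕ} (A : SATInstance r N) :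
    ∃ B : ℕ → ℕ → Prop,
      A.clauses = (List.range A.clauses.length).map fun c => clauseOf N (B c) := by
  refine ⟨fun c q => ∃ h : c < A.clauses.length, ∃ x ∈ A.clauses[c], litIndex x = q,
    List.ext_getElem (by simp) fun c h1 h2 => ?_⟩
  ext x
  simp only [List.getElem_map, List.getElem_range, mem_clauseOf, h1,
    exists_true_left]
  exact ⟨fun h => ⟨x, h, rfl⟩, fun ⟨y, h, hy⟩ => litIndex_injective hy ▸ h⟩

/-- Independence is given by containment in a basis on one side and by cardinality on the other.
They agree because every set of fewer than `k` points extends to a non-perfect set of `k` points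
(`exists_basis_superset`); here `k < n ^ d` enters. -/
theorem satMatroid_eq {n d r m : ℕ} (hd : 2 ≤ d) {L : Matrix (Fin n) (Fin d) ℕ} (hL : IsSU L)
    {L' : ℕ → ℕ → ℕ} (hLL : ∀ i j, L i j = L' i j) {A : SATInstance r (n ^ d)}
    {B : ℕ → ℕ → Prop}
    (hA : A.clauses = (List.range m).map fun c => clauseOf (n ^ d) (B c)) :
    satMatroid hd L A = pavingMatroid n d L' (ClauseSat (n ^ d) m B) := by
  have hsum : ∑ i ∈ range n, L' i 0 = ∑ i, L i ⟨0, by omega⟩ := by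
    rw [← Fin.sum_univ_eq_sum_range (fun i => L' i 0)]
    exact sum_congr rfl fun i _ => (hLL i ⟨0, by omega⟩).symm
  have hperf : ∀ S : Finset (Grid n d), IsPerfect L S ↔ Perf n d L' (S.map (gridCode n d)) :=
    fun S => ⟨fun h i hi j hj => ((slice_map S ⟨i, hi⟩ ⟨j, hj⟩).trans (h _ _)).trans (hLL _ _),
      fun h i j => ((slice_map S i j).symm.trans (h i i.2 j j.2)).trans (hLL i j).symm⟩
  have hsol : ∀ S : Finset (Grid n d), S ∈ (fun S : Finset (Fin (n ^ d)) =>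
      S.map finFunctionFinEquiv.symm.toEmbedding) '' A.solutions ↔
      ClauseSat (n ^ d) m B (S.map (gridCode n d)) := fun S => by
    have h1 : S.map (gridCode n d) =
        (S.map finFunctionFinEquiv.toEmbedding).map Fin.valEmbedding := by
      rw [Finset.map_map]
      rfl
    rw [h1, ← mem_solutions_iff hA]
    constructor
    · rintro ⟨U, hU, rfl⟩
      simp only [Finset.map_map, Function.Embedding.equiv_symm_toEmbedding_trans_toEmbedding,
        Finset.map_refl, hU]
    · intro h
      exact ⟨_, h, by
        simp only [Finset.map_map, Function.Embedding.equiv_toEmbedding_trans_symm_toEmbedding,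
          Finset.map_refl]⟩
  have hB : ∀ S : Finset (Grid n d), S ∈ gBases hd L ((fun S : Finset (Fin (n ^ d)) =>
      S.map finFunctionFinEquiv.symm.toEmbedding) '' A.solutions) ↔
      (S.map (gridCode n d)).card = ∑ i ∈ range n, L' i 0 ∧
        (¬ Perf n d L' (S.map (gridCode n d)) ∨
          ClauseSat (n ^ d) m B (S.map (gridCode n d))) := fun S => by
    rw [gBases, Set.mem_ofPred_eq, card_map, hsum, hperf, hsol]
    tauto
  have hn : 0 < n := by
    by_contra! h
    have := hL.two_le_sum ⟨0, by omega⟩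
    obtain rfl : n = 0 := by omega
    simp at this
  refine gridSystem_eq rfl fun S => ?_
  have hS : S.map (gridCode n d) ⊆ range (n ^ d) := by
    rw [← map_gridCode_univ]
    exact map_subset_map.2 (subset_univ S)
  constructor
  · rintro ⟨U, hU, hSU⟩
    rw [hB] at hU
    rcases hSU.eq_or_ssubset with rfl | h'
    · exact ⟨hS, Or.inr hU⟩
    · refine ⟨hS, Or.inl ?_⟩
      rw [← hU.1, card_map, card_map]
      exact card_lt_card h'
  · rintro ⟨-, h | h⟩
    · obtain ⟨T, hST, hT, hTc, hTP⟩ := exists_basis_superset (L := L') hn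
        (hsum ▸ hL.sum_lt _) hS h
      obtain ⟨U, rfl⟩ := exists_map_gridCode hT
      exact ⟨U, (hB U).2 ⟨hTc, Or.inl hTP⟩, map_subset_map.1 hST⟩
    · exact ⟨S, (hB S).2 h, Subset.rfl⟩

/-! ### Common bases -/

/-- The paving matroid has a non-perfect basis whatever `P` is, so its rank is `k`, and a common
basis has `k` elements. Its slices are bounded by the entries of `L` and have the same sum, hence
they are equal to them: it is perfect, and being a basis it must satisfy `P`. Conversely, a perfect
set has `k` elements, the largest size possible in each of the matroids. -/
theorem exists_common_basis_iff {n k : ℕ} {L : ℕ → ℕ → ℕ} {P : Finset ℕ → Prop} (hn : 0 < n)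
    (hk : k < n ^ 2) (hL : ∀ j < 2, ∑ i ∈ range n, L i j = k) (hk0 : 0 < k) :
    (∃ S, (∀ j < 2, S ∈ (digitMatroid n 2 j fun i => L i j).bases) ∧
      S ∈ (pavingMatroid n 2 L P).bases) ↔
    ∃ S ⊆ range (n ^ 2), Perf n 2 L S ∧ P S := by
  have hle : ∀ j < 2, ∀ T ∈ (digitMatroid n 2 j fun i => L i j).feasible, T.card ≤ k := by
    intro j hj T hT
    rw [← sum_slice hn j, ← hL j hj]
    exact sum_le_sum fun i hi => hT.2 i (Finset.mem_range.1 hi)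
  constructor
  · rintro ⟨S, hS, hSF, hSm⟩
    have hSc : S.card = k := by
      obtain ⟨B, -, hB, hBc, hBP⟩ := exists_basis_superset (L := L) (I := ∅) hn hk (by simp)
        (by simpa using hk0)
      have h1 := hSm B ⟨hB, Or.inr ⟨by rw [hBc, hL 0 two_pos], Or.inl hBP⟩⟩
      have h2 := hle 0 two_pos S (hS 0 two_pos).1
      omega
    have hp : Perf n 2 L S := fun i hi j hj => by
      have h1 : ∑ i ∈ range n, slice n j S i = ∑ i ∈ range n, L i j := by
        rw [sum_slice hn, hL j hj, hSc]
      exact (sum_eq_sum_iff_of_le fun i hi => (hS j hj).1.2 i (Finset.mem_range.1 hi)).1 h1 i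
        (Finset.mem_range.2 hi)
    refine ⟨S, hSF.1, hp, ?_⟩
    rcases hSF.2 with h | h
    · rw [hL 0 two_pos] at h
      omega
    · exact h.2.resolve_left (not_not.2 hp)
  · rintro ⟨S, hS, hp, hP⟩
    have hSc : S.card = k := by
      rw [← sum_slice hn 0, ← hL 0 two_pos]
      exact sum_congr rfl fun i hi => hp i (Finset.mem_range.1 hi) 0 two_pos
    refine ⟨S, fun j hj => ⟨⟨hS, fun i hi => (hp i hi j hj).le⟩, fun T hT => ?_⟩,
      ⟨hS, Or.inr ⟨hSc.trans (hL 0 two_pos).symm, Or.inr hP⟩⟩, fun T hT => ?_⟩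
    · rw [hSc]
      exact hle j hj T hT
    · rw [hSc, ← hL 0 two_pos]
      have := hT.2
      omega

/-- In dimension 2, a point of a slice is determined by its other digit. Thus slice counts always
satisfy the entry bound of simple-uniform matrices. -/
theorem slice_le {n : ℕ} {S : Finset ℕ} (hS : S ⊆ range (n ^ 2)) {i j : ℕ} (hj : j < 2) :
    slice n j S i ≤ n := by
  rcases Nat.eq_zero_or_pos n with rfl | hn
  · have : S = ∅ := by simpa using hS
    simp [this, slice]
  have h : Set.InjOn (digit n (1 - j))
      ((S.filter fun x => digit n j x = i : Finset ℕ) : Set ℕ) := by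
    intro a ha b hb hab
    simp only [coe_filter, Set.mem_ofPred_eq] at ha hb
    refine digits_injective (Finset.mem_range.1 (hS ha.1)) (Finset.mem_range.1 (hS hb.1))
      fun j' hj' => ?_
    rcases eq_or_ne j' j with rfl | hne
    · rw [ha.2, hb.2]
    · obtain rfl : j' = 1 - j := by omega
      exact hab
  rw [slice, ← card_image_of_injOn h]
  refine (card_le_card (t := range n) fun x hx => ?_).trans_eq (card_range n)
  obtain ⟨y, -, rfl⟩ := Finset.mem_image.1 hx
  exact Finset.mem_range.2 (digit_lt hn _ _)

attribute [local irreducible] field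

/-! ### Decoders given by polynomial-time functions -/

theorem PD.iff {α : Type} [Ctx α] {P Q : α → Prop} (hP : PD P) (hQ : PD Q) :
    PD fun a => (P a ↔ Q a) :=
  ((hP.and hQ).or (hP.not.and hQ.not)).congr fun a => by tauto

theorem Outputs.mono {M : TM2ComputableAux Bool Bool} {w v : List Bool} {s t : ℕ}
    (h : Outputs M w v s) (hst : s ≤ t) : Outputs M w v t :=
  h.map fun h => ⟨h.toEvalsTo, h.steps_le_m.trans hst⟩

theorem indicator_get (N x : ℕ) (S : Finset ℕ) :
    ((List.range N).map fun x => decide (x ∈ S))[x]? = some true ↔ x < N ∧ x ∈ S := by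
  by_cases h : x < N <;> simp [h]

/-- The time must be polynomial in `w` alone, although the query also contains a vector of length `N
w`. This is fine because `N` is computed in unary and is therefore polynomially bounded. The
predicate `Q` acts on strings and is decidable in every context. -/
theorem isSetSystemDecoder_of {f : List Bool → SetSystem} {N : List Bool → ℕ}
    (hN : PT N) (hf : ∀ w, (f w).ground = range (N w)) {Q : List Bool → List Bool → Prop}
    (hQ : ∀ {α : Type} [Ctx α] {g h : α → List Bool}, PT g → PT h → PD fun a => Q (g a) (h a))
    (hfQ : ∀ w, ∀ S ⊆ range (N w), S ∈ (f w).feasible ↔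
      Q w ((List.range (N w)).map fun x => decide (x ∈ S))) :
    IsSetSystemDecoder f := by
  classical
  constructor
  · obtain ⟨M, p, ⟨P, hP⟩, hM⟩ := PT.exists_outputs hN.encodeFinset_range
    refine ⟨⟨M, P, fun w => ?_⟩⟩
    have := hM w
    rw [← hf, hP] at this
    exact Classical.choice this
  · obtain ⟨M, p, hp, hM⟩ := PT.exists_outputs ((hQ PT.id.firstItem PT.id.dropItem.firstItem).bit)
    obtain ⟨s, hs, hNs⟩ := hN.exists_bound
    -- The query has length `2 * w.length + 1 + (2 * N w + 1)`.
    obtain ⟨P, hP⟩ := hp.comp ((((IsPoly.const 2).mul IsPoly.id).add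
      ((IsPoly.const 2).mul hs)).add (IsPoly.const 2))
    refine ⟨M, P, fun w S hS => ?_⟩
    rw [hf] at hS
    set v := encodeTuple [w, indicatorBits (f w).ground S] with hv
    have hv' : v = encodeItem w ++ (encodeItem ((List.range (N w)).map fun x => decide (x ∈ S)) ++
        []) := by
      rw [hv, encodeTuple_eq, hf, indicatorBits_range]
      simp
    have h1 := hM v
    rw [hv', firstItem_encodeItem, dropItem_encodeItem, firstItem_encodeItem, ← hv',
      ← hfQ w S hS] at h1
    have h2 : p v.length ≤ P.eval w.length := by
      rw [← hP]
      refine hp.mono ?_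
      have := hNs w
      simp only [enc_nat, List.length_replicate, size] at this
      have h3 : ∀ u, (encodeItem u).length = 2 * u.length + 1 := fun u => by
        simp [encodeItem, mul_comm]
      rw [hv', List.length_append, List.length_append, h3, h3]
      simp
      omega
    constructor
    · intro h
      rw [decide_eq_true h] at h1
      exact h1.mono h2
    · intro h
      rw [decide_eq_false h] at h1
      exact h1.mono h2

theorem PT.digit {α : Type} [Ctx α] {n j x : α → ℕ} (hn : PT n) (hj : PT j) (hx : PT x) :
    PT fun a => digit (n a) (j a) (x a) :=
  (hx.divPow hn hj).mod hn

/-- The number of ones in the string `v` at positions with `j`-th digit `i`. -/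
def countDigit (n j N : ℕ) (v : List Bool) (i : ℕ) : ℕ :=
  ∑ x ∈ range N, if digit n j x = i ∧ v[x]? = some true then 1 else 0

theorem countDigit_eq (n j N i : ℕ) {S : Finset ℕ} (hS : S ⊆ range N) :
    countDigit n j N ((List.range N).map fun x => decide (x ∈ S)) i = slice n j S i := by
  rw [countDigit, ← card_filter, slice]
  congr 1
  ext x
  simp only [Finset.mem_filter, indicator_get, Finset.mem_range]
  have := fun h => Finset.mem_range.1 (@hS x h)
  tauto

theorem PT.countDigit {α : Type} [Ctx α] {n j N i : α → ℕ} {v : α → List Bool} (hn : PT n)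
    (hj : PT j) (hN : PT N) (hv : PT v) (hi : PT i) :
    PT fun a => countDigit (n a) (j a) (N a) (v a) (i a) :=
  PT.sum hN (((PD.eq (PT.digit hn.weaken hj.weaken PT.snd) hi.weaken).and
    (PD.get hv.weaken PT.snd)).ite (PT.const 1) (PT.const 0))

/-! ### The decoder of partition matroids -/

/-- The strings which describe a partition matroid. -/
def PartitionValid (w : List Bool) : Prop :=
  2 ≤ field w 0 ∧ 2 ≤ field w 1 ∧ field w 0 ^ field w 1 = field w 2 ∧ field w 3 < field w 1 ∧
    (∀ i < field w 0, field w (4 + i) ≤ field w 0) ∧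
    2 ≤ ∑ i ∈ range (field w 0), field w (4 + i) ∧
    ∑ i ∈ range (field w 0), field w (4 + i) < field w 2

/-- The string contains `n ^ d` explicitly in unary, so the ground set is no larger than the string
is long, and the power needs only to be compared with the stored number. -/
theorem PD.partitionValid {α : Type} [Ctx α] {f : α → List Bool} (hf : PT f) :
    PD fun a => PartitionValid (f a) :=
  have hF (i : ℕ) : PT fun a => field (f a) i := hf.field (PT.const i)
  have hi : PT fun x : α × ℕ => field (f x.1) (4 + x.2) := hf.weaken.field ((PT.const 4).add PT.snd)
  (PD.le (PT.const 2) (hF 0)).and ((PD.le (PT.const 2) (hF 1)).and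
    ((PD.powEq (hF 0) (hF 1) (hF 2)).and ((PD.lt (hF 3) (hF 1)).and
    ((PD.all (hF 0) (P := fun a i => field (f a) (4 + i) ≤ field (f a) 0)
      (PD.le hi (hF 0).weaken)).and
    ((PD.le (PT.const 2) (PT.sum (f := fun a i => field (f a) (4 + i)) (hF 0) hi)).and
      (PD.lt (PT.sum (f := fun a i => field (f a) (4 + i)) (hF 0) hi) (hF 2)))))))

/-- The description of a partition matroid. -/
def encodePartition (n d N j : ℕ) (c : ℕ → ℕ) : List Bool :=
  encodeSeq ((List.range (4 + n)).map fun i => if i = 0 then n else if i = 1 then d else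
    if i = 2 then N else if i = 3 then j else c (i - 4))

section

variable {n d N j : ℕ} {c : ℕ → ℕ}

theorem field_encodePartition : field (encodePartition n d N j c) 0 = n ∧
    field (encodePartition n d N j c) 1 = d ∧ field (encodePartition n d N j c) 2 = N ∧
    field (encodePartition n d N j c) 3 = j ∧
    ∀ i < n, field (encodePartition n d N j c) (4 + i) = c i := by
  refine ⟨?_, ?_, ?_, ?_, fun i hi => ?_⟩
  all_goals
    rw [encodePartition, field_encodeSeq_range _ (by omega)]
  iterate 4 simp
  rw [if_neg (by omega), if_neg (by omega), if_neg (by omega), if_neg (by omega),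
    Nat.add_sub_cancel_left]

theorem partitionValid_encode (hn : 2 ≤ n) (hd : 2 ≤ d) (hN : n ^ d = N) (hj : j < d)
    (hc : ∀ i < n, c i ≤ n) (hs : 2 ≤ ∑ i ∈ range n, c i) (hs' : ∑ i ∈ range n, c i < N) :
    PartitionValid (encodePartition n d N j c) := by
  obtain ⟨h0, h1, h2, h3, h4⟩ := field_encodePartition (n := n) (d := d) (N := N) (j := j) (c := c)
  have : ∑ i ∈ range n, field (encodePartition n d N j c) (4 + i) = ∑ i ∈ range n, c i :=
    sum_congr rfl fun i hi => h4 i (Finset.mem_range.1 hi)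
  rw [PartitionValid, h0, h1, h2, h3, this]
  exact ⟨hn, hd, hN, hj, fun i hi => (h4 i hi).trans_le (hc i hi), hs, hs'⟩

end

open Classical in
/-- The string `w`, or a valid string if `w` is not valid. -/
noncomputable def normPartition (w : List Bool) : List Bool :=
  if PartitionValid w then w else encodePartition 2 2 4 0 fun _ => 1

theorem PT.normPartition {α : Type} [Ctx α] {f : α → List Bool} (hf : PT f) :
    PT fun a => normPartition (f a) := by
  classical exact (PD.partitionValid hf).ite hf (PT.list _)

theorem normPartition_valid (w : List Bool) : PartitionValid (normPartition w) := by
  rw [normPartition]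
  split_ifs with h
  · exact h
  · exact partitionValid_encode le_rfl le_rfl rfl two_pos (by simp) (by simp) (by simp)

/-- The partition matroid described by a valid string. -/
def stringPartition (w : List Bool) : SetSystem :=
  digitMatroid (field w 0) (field w 1) (field w 3) fun i => field w (4 + i)

/-- The decoder of partition matroids. -/
noncomputable def partitionDecoder (w : List Bool) : SetSystem :=
  stringPartition (normPartition w)

theorem partitionDecoder_of_valid {w : List Bool} (h : PartitionValid w) :
    partitionDecoder w = stringPartition w := by
  rw [partitionDecoder, normPartition, if_pos h]

theorem digitMatroid_congr {n d j : ℕ} {c c' : ℕ → ℕ} (h : ∀ i < n, c i = c' i) :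
    digitMatroid n d j c = digitMatroid n d j c' :=
  SetSystem.ext rfl <| Set.ext fun _ => and_congr_right fun _ =>
    forall₂_congr fun i hi => by rw [h i hi]

theorem partitionDecoder_encode {n d N j : ℕ} {c : ℕ → ℕ} (hn : 2 ≤ n) (hd : 2 ≤ d)
    (hN : n ^ d = N) (hj : j < d) (hc : ∀ i < n, c i ≤ n) (hs : 2 ≤ ∑ i ∈ range n, c i)
    (hs' : ∑ i ∈ range n, c i < N) :
    partitionDecoder (encodePartition n d N j c) = digitMatroid n d j c := by
  rw [partitionDecoder_of_valid (partitionValid_encode hn hd hN hj hc hs hs'), stringPartition]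
  obtain ⟨h0, h1, -, h3, h4⟩ := field_encodePartition (n := n) (d := d) (N := N) (j := j) (c := c)
  rw [h0, h1, h3]
  exact digitMatroid_congr h4

theorem isMatroidDecoder_partitionDecoder : IsMatroidDecoder partitionDecoder := by
  refine ⟨isSetSystemDecoder_of (N := fun w => field (normPartition w) 2)
    (Q := fun w v => ∀ i < field (normPartition w) 0,
      countDigit (field (normPartition w) 0) (field (normPartition w) 3)
        (field (normPartition w) 2) v i ≤ field (normPartition w) (4 + i))
    (PT.id.normPartition.field (PT.const 2)) (fun w => ?_) (fun {α} _ g h hg hh => ?_)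
    fun w S hS => ?_, fun w => ?_⟩
  · rw [← (normPartition_valid w).2.2.1]
    rfl
  · have hF (i : ℕ) : PT fun a => field (normPartition (g a)) i :=
      hg.normPartition.field (PT.const i)
    exact PD.all (hF 0) (P := fun a i => countDigit (field (normPartition (g a)) 0)
      (field (normPartition (g a)) 3) (field (normPartition (g a)) 2) (h a) i ≤
        field (normPartition (g a)) (4 + i))
      (PD.le (PT.countDigit (hF 0).weaken (hF 3).weaken (hF 2).weaken hh.weaken PT.snd)
        (hg.normPartition.weaken.field ((PT.const 4).add PT.snd)))
  · refine (and_iff_right ?_).trans (forall₂_congr fun i _ => ?_)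
    · rwa [(normPartition_valid w).2.2.1]
    · rw [countDigit_eq _ _ _ _ hS]
  · have := (normPartition_valid w).1
    exact digitMatroid_isMatroid (by omega) _ _ _

theorem isPartitionDecoder_partitionDecoder : IsPartitionDecoder partitionDecoder := by
  refine Set.ext fun X => ⟨?_, ?_⟩
  · rintro ⟨w, rfl⟩
    obtain ⟨hn, hd, hN, hj, hc, hs, hs'⟩ := normPartition_valid w
    rw [partitionDecoder]
    generalize normPartition w = w at *
    have hsum : ∑ i : Fin (field w 0), field w (4 + i) = ∑ i ∈ range (field w 0), field w (4 + i) :=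
      Fin.sum_univ_eq_sum_range (fun i => field w (4 + i)) _
    exact ⟨field w 0, field w 1, hn, hd, fun i _ => field w (4 + i),
      ⟨fun i _ => hc i i.2, fun _ => hsum ▸ hs, fun _ => by rwa [hsum, hN], fun _ _ => rfl⟩,
      ⟨field w 3, hj⟩, (partitionMatroid_eq _ ⟨field w 3, hj⟩ _ fun _ => rfl).symm⟩
  · rintro ⟨n, d, hn, hd, L, hL, j, rfl⟩
    -- Only the column `j` is stored in the string; the conditions on `L` restrict to it.
    let c : ℕ → ℕ := fun i => if h : i < n then L ⟨i, h⟩ j else 0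
    have hc : ∀ i : Fin n, L i j = c i := fun i => by simp [c]
    have hsum : ∑ i ∈ range n, c i = ∑ i, L i j := by
      rw [← Fin.sum_univ_eq_sum_range]
      exact sum_congr rfl fun i _ => (hc i).symm
    refine ⟨encodePartition n d (n ^ d) j c, ?_⟩
    rw [partitionDecoder_encode hn hd rfl j.2 (fun i hi => ?_) (hsum ▸ hL.two_le_sum j)
      (hsum ▸ hL.sum_lt j), partitionMatroid_eq L j c hc]
    rw [← hc ⟨i, hi⟩]
    exact hL.entry_le _ _

/-! ### The decoder of SAT-matroids -/

/-- The clauses described by a string. -/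
def stringLits (w : List Bool) (c q : ℕ) : ℕ :=
  field w (5 + field w 0 * field w 1 + c * (2 * field w 2) + q)

/-- The matrix described by a string. -/
def stringMatrix (w : List Bool) (i j : ℕ) : ℕ := field w (5 + i * field w 1 + j)

/-- The strings which describe a SAT-matroid. -/
def PavingValid (w : List Bool) : Prop :=
  2 ≤ field w 0 ∧ 2 ≤ field w 1 ∧ field w 0 ^ field w 1 = field w 2 ∧
    (∀ i < field w 0, ∀ j < field w 1, stringMatrix w i j ≤ field w 0) ∧
    (∀ j < field w 1, ∑ i ∈ range (field w 0), stringMatrix w i j =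
      ∑ i ∈ range (field w 0), stringMatrix w i 0) ∧
    2 ≤ ∑ i ∈ range (field w 0), stringMatrix w i 0 ∧
    ∑ i ∈ range (field w 0), stringMatrix w i 0 < field w 2 ∧
    ∀ c < field w 4, ((range (2 * field w 2)).filter fun q => 0 < stringLits w c q).card = field w 3

section

variable {α : Type} [Ctx α]

theorem PT.stringLits {f : α → List Bool} {c q : α → ℕ} (hf : PT f) (hc : PT c) (hq : PT q) :
    PT fun a => stringLits (f a) (c a) (q a) :=
  hf.field ((((PT.const 5).add ((hf.field (PT.const 0)).mul (hf.field (PT.const 1)))).add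
    (hc.mul ((PT.const 2).mul (hf.field (PT.const 2))))).add hq)

theorem PT.stringMatrix {f : α → List Bool} {i j : α → ℕ} (hf : PT f) (hi : PT i) (hj : PT j) :
    PT fun a => stringMatrix (f a) (i a) (j a) :=
  hf.field (((PT.const 5).add (hi.mul (hf.field (PT.const 1)))).add hj)

theorem PD.pavingValid {f : α → List Bool} (hf : PT f) : PD fun a => PavingValid (f a) := by
  have hF (i : ℕ) : PT fun a => field (f a) i := hf.field (PT.const i)
  have h0 : PT fun a => ∑ i ∈ range (field (f a) 0), DecodedMI.stringMatrix (f a) i 0 :=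
    PT.sum (hF 0) (f := fun a i => DecodedMI.stringMatrix (f a) i 0)
      (hf.weaken.stringMatrix PT.snd (PT.const 0))
  refine (PD.le (PT.const 2) (hF 0)).and ((PD.le (PT.const 2) (hF 1)).and
    ((PD.powEq (hF 0) (hF 1) (hF 2)).and (PD.and ?_ (PD.and ?_ ((PD.le (PT.const 2) h0).and
      ((PD.lt h0 (hF 2)).and ?_))))))
  · exact PD.all (hF 0) (P := fun a i => ∀ j < field (f a) 1,
      DecodedMI.stringMatrix (f a) i j ≤ field (f a) 0) <|
      PD.all (hF 1).weaken (P := fun x j =>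
        DecodedMI.stringMatrix (f x.1) x.2 j ≤ field (f x.1) 0) <|
        PD.le (hf.weaken.weaken.stringMatrix PT.snd.weaken PT.snd) (hF 0).weaken.weaken
  · exact PD.all (hF 1) (P := fun a j => ∑ i ∈ range (field (f a) 0),
      DecodedMI.stringMatrix (f a) i j =
      ∑ i ∈ range (field (f a) 0), DecodedMI.stringMatrix (f a) i 0) <|
      PD.eq (PT.sum (hF 0).weaken (f := fun x i => DecodedMI.stringMatrix (f x.1) i x.2)
        (hf.weaken.weaken.stringMatrix PT.snd PT.snd.weaken)) h0.weaken
  · simp only [card_filter]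
    exact PD.all (hF 4) (P := fun a c => (∑ q ∈ range (2 * field (f a) 2),
      if 0 < DecodedMI.stringLits (f a) c q then 1 else 0) = field (f a) 3) <|
      PD.eq (PT.sum ((PT.const 2).mul (hF 2)).weaken
        (f := fun x q => if 0 < DecodedMI.stringLits (f x.1) x.2 q then 1 else 0)
        ((PD.pos (hf.weaken.weaken.stringLits PT.snd.weaken PT.snd)).ite
          (PT.const 1) (PT.const 0))) (hF 3).weaken

end

/-- The description of a SAT-matroid. -/
def encodePaving (n d N r m : ℕ) (L B : ℕ → ℕ → ℕ) : List Bool :=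
  encodeSeq ((List.range (5 + n * d + m * (2 * N))).map fun i => if i = 0 then n else
    if i = 1 then d else if i = 2 then N else if i = 3 then r else if i = 4 then m else
    if i < 5 + n * d then L ((i - 5) / d) ((i - 5) % d) else
    B ((i - (5 + n * d)) / (2 * N)) ((i - (5 + n * d)) % (2 * N)))

section

variable {n d N r m : ℕ} {L B : ℕ → ℕ → ℕ}

theorem field_encodePaving : field (encodePaving n d N r m L B) 0 = n ∧
    field (encodePaving n d N r m L B) 1 = d ∧ field (encodePaving n d N r m L B) 2 = N ∧
    field (encodePaving n d N r m L B) 3 = r ∧ field (encodePaving n d N r m L B) 4 = m := by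
  refine ⟨?_, ?_, ?_, ?_, ?_⟩
  all_goals
    rw [encodePaving, field_encodeSeq_range _ (by omega)]
    simp

theorem stringMatrix_encodePaving {i j : ℕ} (hi : i < n) (hj : j < d) :
    stringMatrix (encodePaving n d N r m L B) i j = L i j := by
  have h1 : i * d + j < n * d := by nlinarith
  rw [stringMatrix, field_encodePaving.2.1, encodePaving, field_encodeSeq_range _ (by omega)]
  have h2 : 5 + i * d + j - 5 = j + d * i := by rw [mul_comm]; omega
  rw [if_neg (by omega), if_neg (by omega), if_neg (by omega), if_neg (by omega),
    if_neg (by omega), if_pos (by omega), h2, Nat.add_mul_div_left _ _ (by omega),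
    Nat.add_mul_mod_self_left, Nat.div_eq_of_lt hj, Nat.mod_eq_of_lt hj, zero_add]

theorem stringLits_encodePaving {c q : ℕ} (hc : c < m) (hq : q < 2 * N) :
    stringLits (encodePaving n d N r m L B) c q = B c q := by
  have h1 : c * (2 * N) + q < m * (2 * N) := by nlinarith
  rw [stringLits, field_encodePaving.1, field_encodePaving.2.1, field_encodePaving.2.2.1,
    encodePaving, field_encodeSeq_range _ (by omega)]
  have h2 : 5 + n * d + c * (2 * N) + q - (5 + n * d) = q + 2 * N * c := by
    rw [mul_comm (2 * N)]; omega
  rw [if_neg (by omega), if_neg (by omega), if_neg (by omega), if_neg (by omega),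
    if_neg (by omega), if_neg (by omega), h2, Nat.add_mul_div_left _ _ (by omega),
    Nat.add_mul_mod_self_left, Nat.div_eq_of_lt hq, Nat.mod_eq_of_lt hq, zero_add]

theorem pavingValid_encode (hn : 2 ≤ n) (hd : 2 ≤ d) (hN : n ^ d = N)
    (hL : ∀ i < n, ∀ j < d, L i j ≤ n)
    (hs : ∀ j < d, ∑ i ∈ range n, L i j = ∑ i ∈ range n, L i 0)
    (hs2 : 2 ≤ ∑ i ∈ range n, L i 0) (hsN : ∑ i ∈ range n, L i 0 < N)
    (hB : ∀ c < m, ((range (2 * N)).filter fun q => 0 < B c q).card = r) :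
    PavingValid (encodePaving n d N r m L B) := by
  obtain ⟨h0, h1, h2, h3, h4⟩ := field_encodePaving (n := n) (d := d) (N := N) (r := r) (m := m)
    (L := L) (B := B)
  have hsum : ∀ j < d, ∑ i ∈ range n, stringMatrix (encodePaving n d N r m L B) i j =
      ∑ i ∈ range n, L i j := fun j hj =>
    sum_congr rfl fun i hi => stringMatrix_encodePaving (Finset.mem_range.1 hi) hj
  have hsum0 := hsum 0 (by omega)
  rw [PavingValid, h0, h1, h2, h3, h4, hsum0]
  refine ⟨hn, hd, hN, fun i hi j hj => ?_, fun j hj => ?_, hs2, hsN, fun c hc => ?_⟩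
  · rw [stringMatrix_encodePaving hi hj]
    exact hL i hi j hj
  · rw [hsum j hj, hs j hj]
  · rw [← hB c hc]
    congr 1
    refine filter_congr fun q hq => ?_
    rw [stringLits_encodePaving hc (Finset.mem_range.1 hq)]

end

open Classical in
/-- The string `w`, or a valid string if `w` is not valid. -/
noncomputable def normPaving (w : List Bool) : List Bool :=
  if PavingValid w then w else encodePaving 2 2 4 0 0 (fun _ _ => 1) fun _ _ => 0

theorem PT.normPaving {α : Type} [Ctx α] {f : α → List Bool} (hf : PT f) :
    PT fun a => normPaving (f a) := by
  classical exact (PD.pavingValid hf).ite hf (PT.list _)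

theorem normPaving_valid (w : List Bool) : PavingValid (normPaving w) := by
  rw [normPaving]
  split_ifs with h
  · exact h
  · exact pavingValid_encode le_rfl le_rfl rfl (by simp) (by simp) (by simp) (by simp) (by simp)

/-- The SAT-matroid described by a valid string. -/
def stringPaving (w : List Bool) : SetSystem :=
  pavingMatroid (field w 0) (field w 1) (stringMatrix w)
    (ClauseSat (field w 2) (field w 4) fun c q => 0 < stringLits w c q)

/-- The decoder of SAT-matroids. -/
noncomputable def pavingDecoder (w : List Bool) : SetSystem := stringPaving (normPaving w)

theorem pavingDecoder_of_valid {w : List Bool} (h : PavingValid w) :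
    pavingDecoder w = stringPaving w := by
  rw [pavingDecoder, normPaving, if_pos h]

theorem pavingMatroid_congr {n d : ℕ} {L L' : ℕ → ℕ → ℕ} {P P' : Finset ℕ → Prop} (hd : 0 < d)
    (hL : ∀ i < n, ∀ j < d, L i j = L' i j) (hP : ∀ S, P S ↔ P' S) :
    pavingMatroid n d L P = pavingMatroid n d L' P' := by
  have h1 : ∑ i ∈ range n, L i 0 = ∑ i ∈ range n, L' i 0 :=
    sum_congr rfl fun i hi => hL i (Finset.mem_range.1 hi) 0 hd
  refine SetSystem.ext rfl <| Set.ext fun S => and_congr_right fun _ => ?_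
  rw [h1, hP]
  have h2 : Perf n d L S ↔ Perf n d L' S :=
    forall₂_congr fun i hi => forall₂_congr fun j hj => by rw [hL i hi j hj]
  rw [h2]

theorem pavingDecoder_encode {n d N r m : ℕ} {L B : ℕ → ℕ → ℕ} (hn : 2 ≤ n) (hd : 2 ≤ d)
    (hN : n ^ d = N) (hL : ∀ i < n, ∀ j < d, L i j ≤ n)
    (hs : ∀ j < d, ∑ i ∈ range n, L i j = ∑ i ∈ range n, L i 0)
    (hs2 : 2 ≤ ∑ i ∈ range n, L i 0) (hsN : ∑ i ∈ range n, L i 0 < N)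
    (hB : ∀ c < m, ((range (2 * N)).filter fun q => 0 < B c q).card = r) :
    pavingDecoder (encodePaving n d N r m L B) =
      pavingMatroid n d L (ClauseSat N m fun c q => 0 < B c q) := by
  rw [pavingDecoder_of_valid (pavingValid_encode hn hd hN hL hs hs2 hsN hB), stringPaving]
  obtain ⟨h0, h1, h2, h3, h4⟩ := field_encodePaving (n := n) (d := d) (N := N) (r := r) (m := m)
    (L := L) (B := B)
  rw [h0, h1, h2, h4]
  refine pavingMatroid_congr (by omega) (fun i hi j hj => stringMatrix_encodePaving hi hj)
    fun S => forall₂_congr fun c hc => exists_congr fun q => and_congr_right fun hq => ?_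
  simp only [stringLits_encodePaving hc hq]

theorem PavingValid.pow {w : List Bool} (h : PavingValid w) :
    field w 0 ^ field w 1 = field w 2 := h.2.2.1

attribute [local irreducible] countDigit stringMatrix stringLits normPaving

theorem isMatroidDecoder_pavingDecoder : IsMatroidDecoder pavingDecoder := by
  refine ⟨isSetSystemDecoder_of (N := fun w => field (normPaving w) 2)
    (Q := fun w v => ∑ x ∈ range (field (normPaving w) 2), (if v[x]? = some true then 1 else 0) <
        ∑ i ∈ range (field (normPaving w) 0), stringMatrix (normPaving w) i 0 ∨
      ∑ x ∈ range (field (normPaving w) 2), (if v[x]? = some true then 1 else 0) =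
        ∑ i ∈ range (field (normPaving w) 0), stringMatrix (normPaving w) i 0 ∧
      (¬ (∀ i < field (normPaving w) 0, ∀ j < field (normPaving w) 1,
        countDigit (field (normPaving w) 0) j (field (normPaving w) 2) v i =
          stringMatrix (normPaving w) i j) ∨
      ∀ c < field (normPaving w) 4, ∃ q < 2 * field (normPaving w) 2,
        0 < stringLits (normPaving w) c q ∧ (q % 2 = 0 ↔ v[q / 2]? = some true)))
    (PT.id.normPaving.field (PT.const 2)) (fun w => ?_) (fun {α} _ g h hg hh => ?_)
    fun w S hS => ?_, fun w => ?_⟩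
  · rw [← (normPaving_valid w).pow]
    rfl
  · have hw : PT fun a => normPaving (g a) := hg.normPaving
    have hF (i : ℕ) : PT fun a => field (normPaving (g a)) i := hw.field (PT.const i)
    have hc : PT fun a => ∑ x ∈ range (field (normPaving (g a)) 2),
        if (h a)[x]? = some true then 1 else 0 :=
      PT.sum (f := fun a x => if (h a)[x]? = some true then 1 else 0) (hF 2)
        ((PD.get hh.weaken PT.snd).ite (PT.const 1) (PT.const 0))
    have hk : PT fun a => ∑ i ∈ range (field (normPaving (g a)) 0),
        stringMatrix (normPaving (g a)) i 0 :=
      PT.sum (f := fun a i => stringMatrix (normPaving (g a)) i 0) (hF 0)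
        (hw.weaken.stringMatrix PT.snd (PT.const 0))
    refine (PD.lt hc hk).or ((PD.eq hc hk).and ((PD.not ?_).or ?_))
    · refine PD.all (hF 0) (P := fun a i => ∀ j < field (normPaving (g a)) 1,
        countDigit (field (normPaving (g a)) 0) j (field (normPaving (g a)) 2) (h a) i =
          stringMatrix (normPaving (g a)) i j) ?_
      refine PD.all (hF 1).weaken (P := fun x j =>
        countDigit (field (normPaving (g x.1)) 0) j (field (normPaving (g x.1)) 2) (h x.1) x.2 =
          stringMatrix (normPaving (g x.1)) x.2 j) ?_
      exact PD.eq (PT.countDigit (hF 0).weaken.weaken PT.snd (hF 2).weaken.weaken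
        hh.weaken.weaken PT.snd.weaken) (hw.weaken.weaken.stringMatrix PT.snd.weaken PT.snd)
    · refine PD.all (hF 4) (P := fun a c => ∃ q < 2 * field (normPaving (g a)) 2,
        0 < stringLits (normPaving (g a)) c q ∧ (q % 2 = 0 ↔ (h a)[q / 2]? = some true)) ?_
      refine PD.ex ((PT.const 2).mul (hF 2)).weaken (P := fun x q =>
        0 < stringLits (normPaving (g x.1)) x.2 q ∧ (q % 2 = 0 ↔ (h x.1)[q / 2]? = some true)) ?_
      exact (PD.pos (hw.weaken.weaken.stringLits PT.snd.weaken PT.snd)).and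
        ((PD.eq (PT.snd.mod (PT.const 2)) (PT.const 0)).iff
          (PD.get hh.weaken.weaken (PT.snd.div (PT.const 2))))
  · have hS' : S ⊆ range (field (normPaving w) 0 ^ field (normPaving w) 1) := by
      rwa [(normPaving_valid w).pow]
    have h1 : ∑ x ∈ range (field (normPaving w) 2),
        (if ((List.range (field (normPaving w) 2)).map fun x => decide (x ∈ S))[x]? = some true
          then 1 else 0) = S.card := by
      rw [← card_filter]
      congr 1
      ext x
      simp only [Finset.mem_filter, indicator_get, Finset.mem_range]
      have := fun h => Finset.mem_range.1 (@hS x h)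
      tauto
    rw [h1]
    refine (and_iff_right hS').trans (or_congr Iff.rfl (and_congr Iff.rfl (or_congr
      (not_congr (forall₂_congr fun i _ => forall₂_congr fun j _ => ?_))
      (forall₂_congr fun c _ => exists_congr fun q => and_congr_right fun hq =>
        and_congr_right fun _ => ?_))))
    · rw [countDigit_eq _ _ _ _ hS]
    · rw [indicator_get, and_iff_right]
      omega
  · obtain ⟨h0, -, -, -, -, h2, -⟩ := normPaving_valid w
    exact pavingMatroid_isMatroid (by omega) (by omega)

theorem isMatroidSATDecoder_pavingDecoder : IsMatroidSATDecoder pavingDecoder := by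
  classical
  refine Set.ext fun X => ⟨?_, ?_⟩
  · rintro ⟨w, rfl⟩
    obtain ⟨hn, hd, hN, hL, hs, hs2, hsN, hB⟩ := normPaving_valid w
    rw [pavingDecoder, stringPaving]
    generalize normPaving w = w at *
    have hsum : ∀ j, ∑ i : Fin (field w 0), stringMatrix w i j =
        ∑ i ∈ range (field w 0), stringMatrix w i j := fun j =>
      Fin.sum_univ_eq_sum_range (fun i => stringMatrix w i j) _
    let A : SATInstance (field w 3) (field w 0 ^ field w 1) :=
      ⟨(List.range (field w 4)).map fun c => clauseOf _ fun q => 0 < stringLits w c q, by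
        simp only [List.mem_map, List.mem_range, forall_exists_index, and_imp,
          forall_apply_eq_imp_iff₂]
        intro c hc
        rw [card_clauseOf, hN, ← hB c hc]
        congr⟩
    have hSU : IsSU (n := field w 0) (d := field w 1) fun i j => stringMatrix w i j :=
      ⟨fun i j => hL i i.2 j j.2, fun j => by rw [hsum, hs j j.2]; exact hs2,
        fun j => by rw [hsum, hs j j.2, hN]; exact hsN,
        fun j₁ j₂ => by rw [hsum, hsum, hs _ j₁.2, hs _ j₂.2]⟩
    -- The clause width `r` is itself stored in the string, so a single decoder covers the
    -- SAT-matroids for all `r`.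
    refine ⟨field w 0, field w 1, hn, hd, _, hSU, field w 3, A, ?_⟩
    rw [← hN]
    exact (satMatroid_eq hd hSU (fun _ _ => rfl) rfl).symm
  · rintro ⟨n, d, hn, hd, L, hL, r, A, rfl⟩
    obtain ⟨B, hB⟩ := exists_clauseOf A
    let L' : ℕ → ℕ → ℕ := fun i j => if h : i < n ∧ j < d then L ⟨i, h.1⟩ ⟨j, h.2⟩ else 0
    have hL' : ∀ (i : Fin n) (j : Fin d), L i j = L' i j := fun i j => by simp [L']
    have hsum : ∀ j : Fin d, ∑ i ∈ range n, L' i j = ∑ i, L i j := fun j => by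
      rw [← Fin.sum_univ_eq_sum_range (fun i => L' i j)]
      exact sum_congr rfl fun i _ => (hL' i j).symm
    have hsum0 : ∑ i ∈ range n, L' i 0 = ∑ i, L i ⟨0, by omega⟩ := hsum ⟨0, by omega⟩
    have hpos : ∀ c q, 0 < (if B c q then 1 else 0) ↔ B c q := fun c q => by
      by_cases h : B c q <;> simp [h]
    refine ⟨encodePaving n d (n ^ d) r A.clauses.length L' fun c q => if B c q then 1 else 0, ?_⟩
    rw [pavingDecoder_encode hn hd rfl, satMatroid_eq hd hL hL' hB]
    · simp only [hpos]
    · intro i hi j hj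
      rw [← hL' ⟨i, hi⟩ ⟨j, hj⟩]
      exact hL.entry_le _ _
    · intro j hj
      rw [hsum ⟨j, hj⟩, hsum0]
      exact hL.sum_eq _ _
    · rw [hsum0]
      exact hL.two_le_sum _
    · rw [hsum0]
      exact hL.sum_lt _
    · intro c hc
      have h1 : clauseOf (n ^ d) (B c) ∈ A.clauses := by
        rw [hB]
        exact List.mem_map.2 ⟨c, List.mem_range.2 hc, rfl⟩
      rw [← A.card_eq _ h1, card_clauseOf]
      simp only [hpos]

/-! ### Counting in base `b` -/

/-- The carry rule: in passing from `t` to `t + 1`, a carry reaches position `k` exactly when all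
lower digits are maximal. -/
theorem pow_dvd_succ_iff (b k t : ℕ) (hb : 0 < b) :
    b ^ k ∣ t + 1 ↔ ∀ l < k, digit b l t = b - 1 := by
  induction k with
  | zero => simp
  | succ k ih =>
    have h1 : b ^ (k + 1) ∣ t + 1 ↔ b ^ k ∣ t + 1 ∧ digit b k t = b - 1 := by
      constructor
      · intro h
        have h2 : b ^ k ∣ t + 1 := (pow_dvd_pow b k.le_succ).trans h
        refine ⟨h2, ?_⟩
        have h3 := Nat.succ_div_of_dvd h2
        rw [pow_succ] at h
        obtain ⟨c, hc⟩ := h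
        have h4 : (t + 1) / b ^ k = b * c := by
          rw [hc, mul_assoc, Nat.mul_div_cancel_left _ (by positivity)]
        rw [h4] at h3
        obtain ⟨c, rfl⟩ : ∃ c', c = c' + 1 := ⟨c - 1, by
          rcases c with _ | c
          · simp at hc
          · rfl⟩
        have h5 : t / b ^ k = (b - 1) + b * c := by
          rw [Nat.mul_succ] at h3
          omega
        rw [digit, h5, Nat.add_mul_mod_self_left, Nat.mod_eq_of_lt (by omega)]
      · rintro ⟨h2, h3⟩
        have h4 := Nat.succ_div_of_dvd h2
        have h5 : b ∣ (t + 1) / b ^ k := by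
          rw [h4]
          refine ⟨t / b ^ k / b + 1, ?_⟩
          have := Nat.mod_add_div (t / b ^ k) b
          rw [digit] at h3
          rw [Nat.mul_succ]
          omega
        rw [pow_succ]
        exact Nat.mul_dvd_of_dvd_div h2 h5
    rw [h1, ih]
    exact ⟨fun ⟨h, h'⟩ l hl => (Nat.lt_succ_iff_lt_or_eq.1 hl).elim (h l) fun e => e ▸ h',
      fun h => ⟨fun l hl => h l (by omega), h k (by omega)⟩⟩

theorem digit_succ {b : ℕ} (hb : 1 < b) (k t : ℕ) : digit b k (t + 1) =
    if ∀ l < k, digit b l t = b - 1 then if digit b k t = b - 1 then 0 else digit b k t + 1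
      else digit b k t := by
  split_ifs with h h'
  · rw [digit, Nat.succ_div_of_dvd ((pow_dvd_succ_iff b k t (by omega)).2 h), Nat.add_mod]
    rw [digit] at h'
    rw [h', Nat.mod_eq_of_lt hb, Nat.sub_add_cancel hb.le, Nat.mod_self]
  · rw [digit, Nat.succ_div_of_dvd ((pow_dvd_succ_iff b k t (by omega)).2 h), Nat.add_mod,
      Nat.mod_eq_of_lt hb]
    refine Nat.mod_eq_of_lt ?_
    have := Nat.mod_lt (t / b ^ k) (show b > 0 by omega)
    rw [digit] at h'
    omega
  · rw [digit, Nat.succ_div_of_not_dvd (by rwa [pow_dvd_succ_iff b k t (by omega)])]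
    rfl

theorem exists_digits {b : ℕ} (K : ℕ) (x : ℕ → ℕ) (hx : ∀ k < K, x k < b) :
    ∃ t < b ^ K, ∀ k < K, digit b k t = x k := by
  let f : Fin K → Fin b := fun k => ⟨x k, hx k k.2⟩
  refine ⟨finFunctionFinEquiv f, (finFunctionFinEquiv f).2, fun k hk => ?_⟩
  exact digit_gridCode (n := b) (d := K) f ⟨k, hk⟩

/-! ### The encoding of a SAT instance -/

theorem getElem?_flatMap_block {ι : Type} {K : ℕ} {g : ι → List Bool}
    (l : List ι) (hg : ∀ x ∈ l, (g x).length = K) (i q : ℕ) (hi : i < l.length) (hq : q < K) :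
    (l.flatMap g)[i * K + q]? = (g l[i])[q]? := by
  induction l generalizing i with
  | nil => simp at hi
  | cons x l ih =>
    have hx := hg x List.mem_cons_self
    rw [List.flatMap_cons]
    cases i with
    | zero => rw [List.getElem?_append_left (by omega)]; simp
    | succ i =>
      have : (i + 1) * K + q - (g x).length = i * K + q := by
        rw [Nat.succ_mul]
        omega
      rw [List.getElem?_append_right (by rw [Nat.succ_mul]; omega), this,
        ih (fun y hy => hg y (List.mem_cons_of_mem _ hy)) i (by simpa using hi)]
      simp

/-- The number of clauses of an encoded SAT instance. -/
def clauseCount (w : List Bool) : ℕ :=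
  (w.length - (leadingOnes w + 1)) / (2 * leadingOnes w + 1)

/-- The characteristic vectors of the clauses of an encoded SAT instance. -/
def litBit (w : List Bool) (c q : ℕ) : ℕ :=
  if q < 2 * leadingOnes w ∧
    w[leadingOnes w + 1 + (c * (2 * leadingOnes w + 1) + (q + 1))]? = some true then 1 else 0

section

variable {r m : ℕ} (A : SATInstance r m)

theorem leadingOnes_encode : leadingOnes A.encode = m := leadingOnes_replicate _ _

theorem length_clause_block (C : Finset (Fin m × Bool)) :
    (true :: (List.finRange m).flatMap fun i =>
      [decide ((i, true) ∈ C), decide ((i, false) ∈ C)]).length = 2 * m + 1 := by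
  simp [List.length_flatMap, mul_comm]

theorem clauseCount_encode : clauseCount A.encode = A.clauses.length := by
  have h : A.encode.length = m + 1 + A.clauses.length * (2 * m + 1) := by
    rw [SATInstance.encode, List.length_append, List.length_cons, List.length_flatMap]
    simp only [length_clause_block, List.map_const', List.sum_replicate, List.length_replicate,
      smul_eq_mul]
    ring
  rw [clauseCount, leadingOnes_encode, h, Nat.add_sub_cancel_left,
    Nat.mul_div_cancel _ (by omega)]

/-- The guard `q < 2 * m` prevents reading into the next clause. With it, the clauses may be read
over more than `m` variables, the additional ones occurring nowhere. -/
theorem litBit_encode {B : ℕ → ℕ → Prop}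
    (hB : A.clauses = (List.range A.clauses.length).map fun c => clauseOf m (B c))
    {c : ℕ} (hc : c < A.clauses.length) (q : ℕ) :
    0 < litBit A.encode c q ↔ q < 2 * m ∧ B c q := by
  have h1 : 0 < litBit A.encode c q ↔ q < 2 * m ∧
      A.encode[m + 1 + (c * (2 * m + 1) + (q + 1))]? = some true := by
    rw [litBit, leadingOnes_encode]
    split_ifs with h <;> simp [h]
  rw [h1]
  refine and_congr_right fun hq => ?_
  have h2 : A.clauses[c] = clauseOf m (B c) := by
    have : A.clauses[c]? = some (clauseOf m (B c)) := by
      rw [hB]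
      simp [hc]
    rw [List.getElem?_eq_getElem hc] at this
    exact Option.some_injective _ this
  have h3 : q = q / 2 * 2 + q % 2 := by omega
  rw [SATInstance.encode, List.getElem?_append_right (by simp; omega), List.length_replicate,
    show m + 1 + (c * (2 * m + 1) + (q + 1)) - m = c * (2 * m + 1) + (q + 1) + 1 by omega,
    List.getElem?_cons_succ, getElem?_flatMap_block _ (fun C _ => length_clause_block C) c _ hc
      (by omega), List.getElem?_cons_succ, h2]
  nth_rw 1 [h3]
  rw [getElem?_flatMap_block (K := 2) _ (by simp) _ _ (by simp; omega) (by omega)]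
  rcases Nat.mod_two_eq_zero_or_one q with h | h
  · have h4 : 2 * (q / 2) = q := by omega
    simp [h, mem_clauseOf, litIndex, h4]
  · have h4 : 2 * (q / 2) + 1 = q := by omega
    simp [h, mem_clauseOf, litIndex, h4]

theorem card_litBit {N c : ℕ} (hN : m ≤ N) (hc : c < A.clauses.length) :
    ((range (2 * N)).filter fun q => 0 < litBit A.encode c q).card = r := by
  classical
  obtain ⟨B, hB⟩ := exists_clauseOf A
  have h1 : clauseOf m (B c) ∈ A.clauses := by
    rw [hB]
    exact List.mem_map.2 ⟨c, List.mem_range.2 hc, rfl⟩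
  have h2 := A.card_eq _ h1
  rw [card_clauseOf] at h2
  refine Eq.trans ?_ h2
  congr 1
  ext q
  simp only [Finset.mem_filter, Finset.mem_range, litBit_encode A hB hc]
  constructor
  · exact fun h => h.2
  · exact fun h => ⟨by omega, h⟩

/-- The variables from `m` on are free. Making `m` and `m + 1` true gives at least two elements, and
`m + 2 < N` keeps the set proper; these are the bounds that simple-uniformity imposes on the column
sum. -/
theorem solutions_nonempty_iff {N : ℕ} (hN : m + 3 ≤ N) : A.solutions.Nonempty ↔
    ∃ T ⊆ range N, (2 ≤ T.card ∧ T.card < N) ∧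
      ClauseSat N A.clauses.length (fun c q => 0 < litBit A.encode c q) T := by
  obtain ⟨B, hB⟩ := exists_clauseOf A
  constructor
  · rintro ⟨S, hS⟩
    rw [mem_solutions_iff hB] at hS
    have hm : S.map Fin.valEmbedding ⊆ range m := fun x hx => by
      obtain ⟨i, -, rfl⟩ := Finset.mem_map.1 hx
      exact Finset.mem_range.2 i.2
    have hT : S.map Fin.valEmbedding ∪ {m, m + 1} ⊆ range (m + 2) :=
      union_subset (hm.trans (range_subset_range.2 (by omega)))
        (by simp [insert_subset_iff])
    refine ⟨S.map Fin.valEmbedding ∪ {m, m + 1},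
      hT.trans (range_subset_range.2 (by omega)), ⟨?_, ?_⟩, fun c hc => ?_⟩
    · refine (card_le_card subset_union_right).trans' ?_
      rw [card_pair (by omega)]
    · have := card_le_card hT
      rw [card_range] at this
      omega
    · obtain ⟨q, hq, hBq, h⟩ := hS c hc
      refine ⟨q, by omega, (litBit_encode A hB hc q).2 ⟨hq, hBq⟩, h.trans ?_⟩
      rw [mem_union, iff_self_or]
      simp
      omega
  · rintro ⟨T, -, -, hT⟩
    refine ⟨univ.filter fun i => (i : ℕ) ∈ T, (mem_solutions_iff hB _).2 fun c hc => ?_⟩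
    obtain ⟨q, -, hBq, h⟩ := hT c hc
    rw [litBit_encode A hB hc] at hBq
    refine ⟨q, hBq.1, hBq.2, h.trans ?_⟩
    simp only [Finset.mem_map, Finset.mem_filter, Finset.mem_univ, true_and,
      Fin.valEmbedding_apply]
    exact ⟨fun h => ⟨⟨q / 2, by omega⟩, h, rfl⟩, fun ⟨i, h, hi⟩ => hi ▸ h⟩

end

/-! ### The instances of matroid intersection for a SAT instance -/

/-- The side length of the grid for an encoded SAT instance. -/
def side (w : List Bool) : ℕ := (leadingOnes w).sqrt + 2

/-- With `s = ⌊√m⌋` one has `m < (s + 1)²`, and `(s + 2)²` exceeds `(s + 1)²` by `2 s + 3`; this is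
the room for the unused variables. -/
theorem le_side_sq (w : List Bool) : leadingOnes w + 3 ≤ side w * side w := by
  have := Nat.sqrt_lt'.1 (Nat.lt_succ_self (leadingOnes w).sqrt)
  rw [Nat.succ_eq_add_one] at this
  rw [side]
  nlinarith

/-- Simple-uniform matrices with two columns. -/
def GoodMatrix (n : ℕ) (L : ℕ → ℕ → ℕ) : Prop :=
  (∀ i < n, ∀ j < 2, L i j ≤ n) ∧ ∑ i ∈ range n, L i 1 = ∑ i ∈ range n, L i 0 ∧
    2 ≤ ∑ i ∈ range n, L i 0 ∧ ∑ i ∈ range n, L i 0 < n * n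

open Classical in
/-- The matrix described by the state `s`, or a simple-uniform matrix if it is not one. -/
noncomputable def stateMatrix (w s : List Bool) (i j : ℕ) : ℕ :=
  if GoodMatrix (side w) fun i j => field s (2 * i + j) then field s (2 * i + j)
  else if i = 0 then 2 else 0

/-- The fallback has the entry 2 in both columns of row 0 and is simple-uniform since the side is at
least 2. Thus every state of the search yields a legitimate instance, and a positive answer is
meaningful even where the state is not a good matrix. -/
theorem stateMatrix_good (w s : List Bool) : GoodMatrix (side w) (stateMatrix w s) := by
  by_cases h : GoodMatrix (side w) fun i j => field s (2 * i + j)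
  · have : stateMatrix w s = fun i j => field s (2 * i + j) := by
      ext i j
      rw [stateMatrix, if_pos h]
    rwa [this]
  · have h1 : stateMatrix w s = fun i _ => if i = 0 then 2 else 0 := by
      ext i j
      rw [stateMatrix, if_neg h]
    have h2 : 2 ≤ side w := by simp [side]
    have h3 : ∑ i ∈ range (side w), (if i = 0 then 2 else 0) = 2 := by
      rw [sum_ite_eq' (range (side w)) 0 fun _ => 2, if_pos (by simp; omega)]
    rw [h1, GoodMatrix]
    refine ⟨fun i _ j _ => ?_, rfl, h3.ge, h3.trans_lt (by nlinarith)⟩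
    split_ifs <;> omega

/-- The strings of an instance of matroid intersection. -/
noncomputable def miStrings (ℓ r : ℕ) (w s : List Bool) (i : Fin ℓ) : List Bool :=
  if (i : ℕ) + 1 < ℓ then
    -- The column index `min i 1` runs through `0, 1, 1, …`, so for `ℓ > 3` the second partition
    -- matroid is repeated.
    encodePartition (side w) 2 (side w * side w) (min i 1) fun k => stateMatrix w s k (min i 1)
  else encodePaving (side w) 2 (side w * side w) r (clauseCount w) (stateMatrix w s) (litBit w)

section

variable {α : Type} [Ctx α]

theorem PT.side {f : α → List Bool} (hf : PT f) : PT fun a => side (f a) :=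
  hf.leadingOnes.sqrt.add (PT.const 2)

theorem PT.clauseCount {f : α → List Bool} (hf : PT f) : PT fun a => clauseCount (f a) :=
  (hf.length.sub (hf.leadingOnes.add (PT.const 1))).div
    (((PT.const 2).mul hf.leadingOnes).add (PT.const 1))

theorem PT.litBit {f : α → List Bool} {c q : α → ℕ} (hf : PT f) (hc : PT c) (hq : PT q) :
    PT fun a => litBit (f a) (c a) (q a) :=
  ((PD.lt hq ((PT.const 2).mul hf.leadingOnes)).and (PD.get hf
    ((hf.leadingOnes.add (PT.const 1)).add ((hc.mul (((PT.const 2).mul hf.leadingOnes).add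
      (PT.const 1))).add (hq.add (PT.const 1)))))).ite (PT.const 1) (PT.const 0)

theorem PD.goodMatrix {w s : α → List Bool} (hw : PT w) (hs : PT s) :
    PD fun a => GoodMatrix (DecodedMI.side (w a)) fun i j => field (s a) (2 * i + j) := by
  have hn := hw.side
  have hsum (j : ℕ) : PT fun a =>
      ∑ i ∈ range (DecodedMI.side (w a)), field (s a) (2 * i + j) :=
    PT.sum (f := fun a i => field (s a) (2 * i + j)) hn
      (hs.weaken.field (((PT.const 2).mul PT.snd).add (PT.const j)))
  refine PD.and ?_ ((PD.eq (hsum 1) (hsum 0)).and ((PD.le (PT.const 2) (hsum 0)).and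
    (PD.lt (hsum 0) (hn.mul hn))))
  refine PD.all hn (P := fun a i => ∀ j < 2, field (s a) (2 * i + j) ≤ DecodedMI.side (w a)) ?_
  refine PD.all (PT.const 2)
    (P := fun (x : α × ℕ) j => field (s x.1) (2 * x.2 + j) ≤ DecodedMI.side (w x.1)) ?_
  exact PD.le (hs.weaken.weaken.field (((PT.const 2).mul PT.snd.weaken).add PT.snd))
    hn.weaken.weaken

theorem PT.stateMatrix {w s : α → List Bool} {i j : α → ℕ} (hw : PT w) (hs : PT s) (hi : PT i)
    (hj : PT j) : PT fun a => stateMatrix (w a) (s a) (i a) (j a) := by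
  classical
  exact (PD.goodMatrix hw hs).ite (hs.field (((PT.const 2).mul hi).add hj))
    ((PD.eq hi (PT.const 0)).ite (PT.const 2) (PT.const 0))

theorem PT.miStrings {w s : α → List Bool} (hw : PT w) (hs : PT s) (ℓ r : ℕ) (i : Fin ℓ) :
    PT fun a => miStrings ℓ r (w a) (s a) i := by
  have hn := hw.side
  have hN := hn.mul hn
  by_cases hi : (i : ℕ) + 1 < ℓ
  · simp only [DecodedMI.miStrings, if_pos hi]
    refine PT.encodeSeq (f := fun a k => if k = 0 then DecodedMI.side (w a) else
      if k = 1 then 2 else if k = 2 then DecodedMI.side (w a) * DecodedMI.side (w a) else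
      if k = 3 then (Min.min (i : ℕ) 1) else
        DecodedMI.stateMatrix (w a) (s a) (k - 4) (Min.min (i : ℕ) 1)) ((PT.const 4).add hn) ?_
    have hk (c : ℕ) : PD fun x : α × ℕ => x.2 = c := PD.eq PT.snd (PT.const c)
    exact (hk 0).ite hn.weaken ((hk 1).ite (PT.const 2) ((hk 2).ite hN.weaken
      ((hk 3).ite (PT.const _) (PT.stateMatrix hw.weaken hs.weaken (PT.snd.sub (PT.const 4))
        (PT.const _)))))
  · simp only [DecodedMI.miStrings, if_neg hi]
    have h5 : PT fun a => 5 + DecodedMI.side (w a) * 2 := (PT.const 5).add (hn.mul (PT.const 2))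
    have h2N : PT fun a => 2 * (DecodedMI.side (w a) * DecodedMI.side (w a)) :=
      (PT.const 2).mul hN
    refine PT.encodeSeq (f := fun a k => if k = 0 then DecodedMI.side (w a) else
      if k = 1 then 2 else if k = 2 then DecodedMI.side (w a) * DecodedMI.side (w a) else
      if k = 3 then r else if k = 4 then DecodedMI.clauseCount (w a) else
      if k < 5 + DecodedMI.side (w a) * 2 then
        DecodedMI.stateMatrix (w a) (s a) ((k - 5) / 2) ((k - 5) % 2) else
      DecodedMI.litBit (w a) ((k - (5 + DecodedMI.side (w a) * 2)) /
          (2 * (DecodedMI.side (w a) * DecodedMI.side (w a))))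
        ((k - (5 + DecodedMI.side (w a) * 2)) %
          (2 * (DecodedMI.side (w a) * DecodedMI.side (w a)))))
      (h5.add (hw.clauseCount.mul h2N)) ?_
    have hk (c : ℕ) : PD fun x : α × ℕ => x.2 = c := PD.eq PT.snd (PT.const c)
    have h6 : PT fun x : α × ℕ => x.2 - 5 := PT.snd.sub (PT.const 5)
    have h7 : PT fun x : α × ℕ => x.2 - (5 + DecodedMI.side (w x.1) * 2) := PT.snd.sub h5.weaken
    exact (hk 0).ite hn.weaken ((hk 1).ite (PT.const 2) ((hk 2).ite hN.weaken
      ((hk 3).ite (PT.const _) ((hk 4).ite hw.clauseCount.weaken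
      ((PD.lt PT.snd h5.weaken).ite (PT.stateMatrix hw.weaken hs.weaken (h6.div (PT.const 2))
        (h6.mod (PT.const 2))) (PT.litBit hw.weaken (h7.div h2N.weaken) (h7.mod h2N.weaken)))))))

theorem PT.encodeMI {ℓ : ℕ} {I : α → Fin ℓ → List Bool} (h : ∀ i, PT fun a => I a i) :
    PT fun a => encodeMI (I a) := by
  simp only [DecodedMI.encodeMI, encodeTuple_eq]
  induction ℓ with
  | zero => simpa using PT.nil
  | succ ℓ ih =>
    simp only [List.ofFn_succ, List.flatMap_cons]
    exact (h 0).encodeItem.append (ih fun i => h i.succ)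

end

theorem decode_miStrings {ℓ r m : ℕ} (A : SATInstance r m) (s : List Bool) (i : Fin ℓ) :
    (if (i : ℕ) + 1 < ℓ then partitionDecoder else pavingDecoder) (miStrings ℓ r A.encode s i) =
      if (i : ℕ) + 1 < ℓ then digitMatroid (side A.encode) 2 (min i 1)
        fun k => stateMatrix A.encode s k (min i 1)
      else pavingMatroid (side A.encode) 2 (stateMatrix A.encode s)
        (ClauseSat (side A.encode * side A.encode) A.clauses.length
          fun c q => 0 < litBit A.encode c q) := by
  obtain ⟨h1, h2, h3, h4⟩ := stateMatrix_good A.encode s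
  have hn : 2 ≤ side A.encode := by simp [side]
  have hm := le_side_sq A.encode
  rw [leadingOnes_encode] at hm
  have hs : ∀ j < 2, ∑ i ∈ range (side A.encode), stateMatrix A.encode s i j =
      ∑ i ∈ range (side A.encode), stateMatrix A.encode s i 0 := fun j hj => by
    obtain rfl | rfl : j = 0 ∨ j = 1 := by omega
    · rfl
    · exact h2
  rw [miStrings]
  split_ifs with hi
  · have hj : min (i : ℕ) 1 < 2 := by omega
    exact partitionDecoder_encode hn le_rfl (sq _) hj (fun k hk => h1 k hk _ hj)
      (by rwa [hs _ hj]) (by rwa [hs _ hj])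
  · rw [← clauseCount_encode]
    refine pavingDecoder_encode hn le_rfl (sq _) h1 hs h3 h4 fun c hc => ?_
    rw [clauseCount_encode] at hc
    exact card_litBit A (by omega) hc

/-! ### The search through the simple-uniform matrices -/

/-- The state number `t` of the search: `2 * n` digits in base `n + 1`. -/
def searchState (n t : ℕ) : List Bool :=
  encodeSeq ((List.range (2 * n)).map fun k => digit (n + 1) k t)

open Classical in
/-- The state which follows the state `s`. -/
noncomputable def nextState (n : ℕ) (s : List Bool) : List Bool :=
  encodeSeq ((List.range (2 * n)).map fun k =>
    if ∀ l < k, field s l = n then if field s k = n then 0 else field s k + 1 else field s k)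

theorem field_searchState {n k : ℕ} (t : ℕ) (hk : k < 2 * n) :
    field (searchState n t) k = digit (n + 1) k t :=
  field_encodeSeq_range _ hk

theorem searchState_succ {n : ℕ} (hn : 0 < n) (t : ℕ) :
    searchState n (t + 1) = nextState n (searchState n t) := by
  rw [searchState, nextState]
  congr 1
  refine List.map_congr_left fun k hk => ?_
  rw [List.mem_range] at hk
  rw [digit_succ (by omega), Nat.add_sub_cancel, field_searchState t hk]
  have : (∀ l < k, field (searchState n t) l = n) ↔ ∀ l < k, digit (n + 1) l t = n :=
    forall₂_congr fun l hl => by rw [field_searchState t (hl.trans hk)]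
  simp only [this]

theorem searchState_zero (n : ℕ) :
    searchState n 0 = encodeSeq ((List.range (2 * n)).map fun _ => 0) := by
  simp [searchState, digit]

theorem length_searchState_le (n t : ℕ) : (searchState n t).length ≤ 2 * n * (n + 1) := by
  have h : ∀ (l : List ℕ), (∀ x ∈ l, x ≤ n) → (encodeSeq l).length ≤ l.length * (n + 1) := by
    intro l hl
    induction l with
    | nil => simp [encodeSeq]
    | cons x l ih =>
      have h1 := ih fun y hy => hl y (List.mem_cons_of_mem _ hy)
      have h2 := hl x List.mem_cons_self
      rw [encodeSeq] at h1 ⊢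
      rw [List.flatMap_cons, List.length_append, List.length_cons, Nat.succ_mul]
      simp only [List.length_append, List.length_replicate, List.length_singleton]
      omega
  refine (h _ fun x hx => ?_).trans_eq (by simp)
  obtain ⟨k, -, rfl⟩ := List.mem_map.1 hx
  exact Nat.lt_succ_iff.1 (digit_lt (Nat.succ_pos n) _ _)

/-- All `2 * n` digits are maximal iff `(n + 1) ^ (2 * n)` divides `t + 1`, which does not exceed
it. -/
theorem searchState_last {n t : ℕ} (ht : t < (n + 1) ^ (2 * n)) :
    (∀ k < 2 * n, field (searchState n t) k = n) ↔ t + 1 = (n + 1) ^ (2 * n) := by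
  have h1 : (∀ k < 2 * n, field (searchState n t) k = n) ↔ (n + 1) ^ (2 * n) ∣ t + 1 := by
    rw [pow_dvd_succ_iff (n + 1) _ _ (by omega), Nat.add_sub_cancel]
    exact forall₂_congr fun k hk => by rw [field_searchState t hk]
  rw [h1]
  exact ⟨fun h => le_antisymm ht (Nat.le_of_dvd (Nat.succ_pos t) h), fun h => h ▸ dvd_rfl⟩

section

variable {α : Type} [Ctx α]

theorem PT.nextState {n : α → ℕ} {s : α → List Bool} (hn : PT n) (hs : PT s) :
    PT fun a => nextState (n a) (s a) := by
  classical
  refine PT.encodeSeq (f := fun a k => if ∀ l < k, DecodedMI.field (s a) l = n a then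
    if DecodedMI.field (s a) k = n a then 0 else DecodedMI.field (s a) k + 1
      else DecodedMI.field (s a) k)
    ((PT.const 2).mul hn) ?_
  have hk : PT fun x : α × ℕ => DecodedMI.field (s x.1) x.2 := hs.weaken.field PT.snd
  refine PD.ite (PD.all PT.snd (P := fun x l => DecodedMI.field (s x.1) l = n x.1)
    (PD.eq (hs.weaken.weaken.field PT.snd) hn.weaken.weaken)) ?_ hk
  exact (PD.eq hk hn.weaken).ite (PT.const 0) (hk.add (PT.const 1))

end

/-- As `ℓ ≥ 3`, the indices 0 and 1 are both partition matroids and cover the two columns, the last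
index is the SAT-matroid, and the other indices add no condition. -/
theorem bases_miStrings {ℓ r m : ℕ} (hℓ : 3 ≤ ℓ) (A : SATInstance r m) (s : List Bool) :
    (∃ S, ∀ i : Fin ℓ, S ∈ ((if (i : ℕ) + 1 < ℓ then partitionDecoder else pavingDecoder)
      (miStrings ℓ r A.encode s i)).bases) ↔
    ∃ S ⊆ range (side A.encode ^ 2), Perf (side A.encode) 2 (stateMatrix A.encode s) S ∧
      ClauseSat (side A.encode * side A.encode) A.clauses.length
        (fun c q => 0 < litBit A.encode c q) S := by
  obtain ⟨-, h2, h3, h4⟩ := stateMatrix_good A.encode s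
  rw [← exists_common_basis_iff (k := ∑ i ∈ range (side A.encode), stateMatrix A.encode s i 0)
    (by simp [side]) (h4.trans_eq (sq _).symm) (fun j hj => ?_) (by omega)]
  · simp only [decode_miStrings]
    refine exists_congr fun S => ⟨fun h => ⟨fun j hj => ?_, ?_⟩, fun h i => ?_⟩
    · have := h ⟨j, by omega⟩
      rwa [if_pos (show j + 1 < ℓ by omega), show min j 1 = j by omega] at this
    · have := h ⟨ℓ - 1, by omega⟩
      rwa [if_neg (show ¬ ℓ - 1 + 1 < ℓ by omega)] at this
    · split_ifs
      · exact h.1 _ (by omega)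
      · exact h.2
  · obtain rfl | rfl : j = 0 ∨ j = 1 := by omega
    · rfl
    · exact h2

/-- The slice counts of a padded solution are the digits of some counter value. Conversely, a
perfect set for any state has as many elements as the column sum of a good matrix, hence between 2
and `N - 1`. -/
theorem solutions_nonempty_iff_search {r m : ℕ} (A : SATInstance r m) : A.solutions.Nonempty ↔
    ∃ t < (side A.encode + 1) ^ (2 * side A.encode), ∃ S ⊆ range (side A.encode ^ 2),
      Perf (side A.encode) 2 (stateMatrix A.encode (searchState (side A.encode) t)) S ∧
      ClauseSat (side A.encode * side A.encode) A.clauses.length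
        (fun c q => 0 < litBit A.encode c q) S := by
  have hm := le_side_sq A.encode
  rw [leadingOnes_encode] at hm
  rw [solutions_nonempty_iff A hm]
  set n := side A.encode with hn
  have hn2 : 2 ≤ n := by simp [hn, side]
  rw [sq]
  constructor
  · rintro ⟨T, hT, hc, hsat⟩
    rw [← sq] at hT
    -- Digit `2 * i + j` of the counter is the entry in row `i` and column `j`.
    obtain ⟨t, ht, hdig⟩ := exists_digits (b := n + 1) (2 * n) (fun k => slice n (k % 2) T (k / 2))
      fun k _ => Nat.lt_succ_of_le (slice_le hT (Nat.mod_lt _ two_pos))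
    have hL : ∀ i < n, ∀ j < 2, field (searchState n t) (2 * i + j) = slice n j T i := by
      intro i hi j hj
      rw [field_searchState t (by omega), hdig _ (by omega), Nat.mul_add_mod, Nat.mod_eq_of_lt hj,
        Nat.mul_add_div two_pos, Nat.div_eq_of_lt hj, add_zero]
    have hsum : ∀ j < 2, ∑ i ∈ range n, field (searchState n t) (2 * i + j) = T.card := by
      intro j hj
      rw [← sum_slice (by omega : 0 < n) j T]
      exact sum_congr rfl fun i hi => hL i (Finset.mem_range.1 hi) j hj
    have hgood : GoodMatrix n fun i j => field (searchState n t) (2 * i + j) := by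
      rw [GoodMatrix, hsum 0 two_pos, hsum 1 one_lt_two]
      refine ⟨fun i hi j hj => ?_, rfl, hc⟩
      rw [hL i hi j hj]
      exact slice_le hT hj
    refine ⟨t, ht, T, sq n ▸ hT, fun i hi j hj => ?_, hsat⟩
    rw [stateMatrix, ← hn, if_pos hgood, hL i hi j hj]
  · rintro ⟨t, -, S, hS, hp, hsat⟩
    obtain ⟨-, -, h3, h4⟩ := stateMatrix_good A.encode (searchState n t)
    rw [← hn] at h3 h4
    have : S.card = ∑ i ∈ range n, stateMatrix A.encode (searchState n t) i 0 := by
      rw [← sum_slice (by omega : 0 < n) 0 S]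
      exact sum_congr rfl fun i hi => hp i (Finset.mem_range.1 hi) 0 two_pos
    exact ⟨S, hS, this ▸ ⟨h3, h4⟩, hsat⟩

/-! ### The running time -/

/-- The left side is `O(s log s)`. The logarithm is bounded by a linear function of small slope,
which leaves `ε / 4 * s ^ 2` and a linear term; the latter is absorbed by completing a square. -/
theorem exists_log_bound {ε : ℝ} (hε : 0 < ε) : ∃ K : ℝ, ∀ s : ℝ, 0 ≤ s →
    2 * (s + 2) * Real.logb 2 (s + 3) + 4 * s + 4 ≤ ε / 2 * s ^ 2 + K := by
  have hl : 0 < Real.log 2 := Real.log_pos one_lt_two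
  obtain ⟨D, hD0, hD⟩ : ∃ D : ℝ, 0 ≤ D ∧ ∀ x : ℝ, 0 < x → Real.logb 2 x ≤ ε / 8 * x + D := by
    set δ := ε / 8 * Real.log 2 with hδ
    have hδ0 : 0 < δ := by positivity
    refine ⟨|Real.log δ| / Real.log 2, by positivity, fun x hx => ?_⟩
    have h1 := Real.log_le_sub_one_of_pos (mul_pos hδ0 hx)
    rw [Real.log_mul hδ0.ne' hx.ne'] at h1
    have h2 := neg_abs_le (Real.log δ)
    rw [Real.logb, div_le_iff₀ hl, add_mul, div_mul_cancel₀ _ hl.ne']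
    nlinarith
  -- This is the coefficient of `s` once `logb 2 (s + 3)` is replaced by `ε / 8 * (s + 3) + D` and
  -- the product is expanded.
  set B := 5 * ε / 4 + 2 * D + 4 with hB
  refine ⟨ε / 4 * 6 + 4 * D + 4 + B ^ 2 / ε, fun s hs => ?_⟩
  have h1 := mul_le_mul_of_nonneg_left (hD (s + 3) (by linarith))
    (by linarith : (0 : ℝ) ≤ 2 * (s + 2))
  have h2 : B * s ≤ ε / 4 * s ^ 2 + B ^ 2 / ε := by
    have h3 : ε / 4 * s ^ 2 + B ^ 2 / ε - B * s = (ε * s / 2 - B) ^ 2 / ε := by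
      field_simp
      ring
    have h4 : 0 ≤ (ε * s / 2 - B) ^ 2 / ε := by positivity
    linarith
  rw [hB] at h2
  nlinarith

/-- With `s = ⌊√m⌋` one has `n² = s² + 4 s + 4` and `s² ≤ m`. The `4 s + 4` and the logarithm of the
number of matrices together cost at most `ε / 2 * s²` and a constant, by `exists_log_bound`. -/
theorem exists_time_bound {ε : ℝ} (hε : 0 < ε) (hε1 : ε ≤ 1) : ∃ C : ℕ, ∀ m n : ℕ,
    n = m.sqrt + 2 → (((n + 1) ^ (2 * n) : ℕ) : ℝ) * (2 : ℝ) ^ ((1 - ε) * ((n * n : ℕ) : ℝ)) ≤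
      (2 : ℝ) ^ ((1 - ε / 2) * (m : ℝ)) * C := by
  obtain ⟨K, hK⟩ := exists_log_bound hε
  refine ⟨⌈(2 : ℝ) ^ K⌉₊, fun m n hn => ?_⟩
  refine le_trans ?_ (mul_le_mul_of_nonneg_left (Nat.le_ceil _) (by positivity))
  rw [← Real.rpow_add two_pos]
  set s := m.sqrt with hs
  have hsm : (s : ℝ) ^ 2 ≤ m := by exact_mod_cast Nat.sqrt_le' m
  have h1 : (((n + 1) ^ (2 * n) : ℕ) : ℝ) =
      (2 : ℝ) ^ (2 * ((s : ℝ) + 2) * Real.logb 2 ((s : ℝ) + 3)) := by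
    rw [mul_comm (2 * ((s : ℝ) + 2)), Real.rpow_mul two_pos.le,
      Real.rpow_logb two_pos (by norm_num) (by positivity), hn]
    have : (2 * ((s : ℝ) + 2)) = ((2 * (s + 2) : ℕ) : ℝ) := by push_cast; ring
    rw [this, Real.rpow_natCast]
    push_cast
    ring
  rw [h1, ← Real.rpow_add two_pos]
  refine Real.rpow_le_rpow_of_exponent_le one_le_two ?_
  have h2 := hK s (Nat.cast_nonneg s)
  rw [hn]
  push_cast
  have h3 : (0 : ℝ) ≤ s := Nat.cast_nonneg s
  nlinarith

/-! ### From matroid intersection to satisfiability -/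

theorem IsPoly.exists_polynomial {p : ℕ → ℕ} (hp : IsPoly p) :
    ∃ P : Polynomial ℕ, ∀ n, p n = P.eval n := hp

theorem Answers.mono {M : TM2ComputableAux Bool Bool} {w : List Bool} {P : Prop} {s t : ℕ}
    (h : Answers M w P s) (hst : s ≤ t) : Answers M w P t :=
  ⟨fun hP => (h.1 hP).mono hst, fun hP => (h.2 hP).mono hst⟩

theorem side_encode {r m : ℕ} (A : SATInstance r m) : side A.encode = m.sqrt + 2 := by
  rw [side, leadingOnes_encode]

/-- The machine searches through all matrices and asks `M` about each instance. The clause size `r`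
affects only the polynomial factor, so one exponent below 1 serves all `r`. -/
theorem satSolvable_of_miSolvable {ℓ : ℕ} (hℓ : 3 ≤ ℓ) (hℓ0 : 0 < ℓ) {ε : ℝ} (hε : 0 < ε)
    (hε1 : ε ≤ 1) (h : MISolvable hℓ0
      (fun i : Fin ℓ => if (i : ℕ) + 1 < ℓ then partitionDecoder else pavingDecoder) (1 - ε))
    (r : ℕ) : SATSolvable r (1 - ε / 2) := by
  classical
  obtain ⟨M, P, hM⟩ := h
  obtain ⟨C, hC⟩ := exists_time_bound hε hε1
  have hw : PT fun x : List Bool × List Bool => x.1 := PT.id.weaken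
  have hs : PT fun x : List Bool × List Bool => x.2 := PT.snd
  have h_inst : PT fun x : List Bool × List Bool => encodeMI (miStrings ℓ r x.1 x.2) :=
    PT.encodeMI fun i => PT.miStrings hw hs ℓ r i
  obtain ⟨q, hq, hql⟩ := h_inst.exists_bound
  obtain ⟨M', p, hp, hM'⟩ := exists_search M
    (init := fun w => encodeSeq ((List.range (2 * side w)).map fun _ => 0))
    (inst := fun x => encodeMI (miStrings ℓ r x.1 x.2))
    (next := fun x => nextState (side x.1) x.2)
    (fin := fun x => if ∀ k < 2 * side x.1, field x.2 k = side x.1 then [true] else [])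
    (PT.encodeSeq (f := fun _ _ => 0) ((PT.const 2).mul PT.id.side) (PT.const 0)) h_inst
    (PT.nextState hw.side hs)
    ((PD.all (P := fun x k => field x.2 k = side x.1) ((PT.const 2).mul hw.side)
      (PD.eq (hs.weaken.field PT.snd) hw.side.weaken)).ite (PT.bit true) PT.nil)
  have hP : IsPoly fun n => P.eval n := ⟨P, fun _ => rfl⟩
  -- This bounds the length of the input and a state together: the side is at most `x + 2`, and a
  -- state has at most `2 * n * (n + 1)` bits.
  let u : ℕ → ℕ := fun x => x + 2 * (x + 2) * (x + 3)
  have hu : IsPoly u := IsPoly.id.add (((IsPoly.const 2).mul (IsPoly.id.add (IsPoly.const 2))).mul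
    (IsPoly.id.add (IsPoly.const 3)))
  obtain ⟨R, hR⟩ := ((IsPoly.const C).mul (((hP.comp (hq.comp hu)).add (hp.comp hu)).add
    (hp.comp hu))).exists_polynomial
  refine ⟨M', R, fun m A => ?_⟩
  set w := A.encode with hwA
  set n := side w with hn
  have hnm : n = m.sqrt + 2 := side_encode A
  set a : ℝ := (2 : ℝ) ^ ((1 - ε) * ((n * n : ℕ) : ℝ)) with ha
  have ha1 : 1 ≤ a := Real.one_le_rpow one_le_two (by
    have : (0 : ℝ) ≤ ((n * n : ℕ) : ℝ) := Nat.cast_nonneg _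
    nlinarith)
  have hlen : ∀ t, w.length + (searchState n t).length ≤ u w.length := by
    intro t
    have h1 := length_searchState_le n t
    have h2 : n ≤ w.length + 2 := by
      have := Nat.sqrt_le_self m
      have : m ≤ w.length := by simp [hwA, SATInstance.encode]
      omega
    have h3 : 2 * n * (n + 1) ≤ 2 * (w.length + 2) * (w.length + 3) :=
      Nat.mul_le_mul (by omega) (by omega)
    simp only [u]
    omega
  -- One time bound valid for all queries: each has ground set of size `n * n` and length at most `q
  -- (u w.length)`.
  set τ := ⌊a * (P.eval (q (u w.length)) : ℕ)⌋₊ with hτ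
  refine ⟨(n + 1) ^ (2 * n) * (τ + p (u w.length)) + p (u w.length), ?_, ?_⟩
  · rw [← hR]
    have h1 : (τ : ℝ) ≤ a * (P.eval (q (u w.length)) : ℕ) := Nat.floor_le (by positivity)
    have h2 : (1 : ℝ) ≤ ((n + 1) ^ (2 * n) : ℕ) := by
      exact_mod_cast Nat.one_le_pow _ _ (Nat.succ_pos n)
    have h3 := hC m n hnm
    rw [← ha] at h3
    set b : ℝ := (((n + 1) ^ (2 * n) : ℕ) : ℝ) with hb
    set x : ℝ := ((P.eval (q (u w.length)) : ℕ) : ℝ) with hx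
    have hx0 : 0 ≤ x := Nat.cast_nonneg _
    set y : ℝ := (p (u w.length) : ℝ) with hy
    have hy0 : 0 ≤ y := Nat.cast_nonneg _
    calc (((n + 1) ^ (2 * n) * (τ + p (u w.length)) + p (u w.length) : ℕ) : ℝ)
        = b * (τ + y) + y := by rw [Nat.cast_add, Nat.cast_mul, Nat.cast_add]
      -- The polynomial overheads are enlarged, using `1 ≤ a` (from `ε ≤ 1`) and `1 ≤ b`, so that
      -- the exponential factor `b * a` can be taken out.
      _ ≤ b * (a * x + a * y) + b * (a * y) := by
        have h4 : y ≤ a * y := le_mul_of_one_le_left hy0 ha1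
        have h5 : a * y ≤ b * (a * y) := le_mul_of_one_le_left (by positivity) h2
        have h6 : b * (τ + y) ≤ b * (a * x + a * y) := by gcongr
        linarith
      _ = b * a * (x + y + y) := by ring
      _ ≤ (2 : ℝ) ^ ((1 - ε / 2) * (m : ℝ)) * C * (x + y + y) := by gcongr
      _ = _ := by
        rw [mul_assoc]
        push_cast
        rfl
  · have hQ := solutions_nonempty_iff_search A
    rw [← hwA, ← hn] at hQ
    rw [hQ]
    refine hM' w (searchState n) _ (u w.length) τ _ (by positivity) (searchState_zero n)
      (searchState_succ (by omega)) (fun t _ => hlen t) (fun t ht => ?_) fun t _ => ?_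
    · rw [← searchState_last ht]
      dsimp only
      rw [← hn]
      split_ifs with h <;> simpa using h
    · have hdec := decode_miStrings (ℓ := ℓ) (r := r) A (searchState n t)
      have hground : ∀ i : Fin ℓ, ((if (i : ℕ) + 1 < ℓ then partitionDecoder else pavingDecoder)
          (miStrings ℓ r w (searchState n t) i)).ground = range (n ^ 2) := by
        intro i
        rw [hdec]
        split_ifs <;> rfl
      obtain ⟨τ', hτ', hans⟩ := hM (miStrings ℓ r w (searchState n t))
        fun i j => (hground i).trans (hground j).symm
      rw [bases_miStrings hℓ A] at hans
      refine hans.mono (Nat.le_floor (hτ'.trans ?_))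
      rw [hground, card_range, sq, ← ha]
      have h1 : (encodeMI (miStrings ℓ r w (searchState n t))).length ≤ q (u w.length) :=
        (hql (w, searchState n t)).trans (hq.mono (hlen t))
      have h2 := hP.mono h1
      gcongr

theorem MISolvable.mono {ℓ : ℕ} {hℓ : 0 < ℓ} {f : Fin ℓ → List Bool → SetSystem} {c c' : ℝ}
    (h : MISolvable hℓ f c) (hc : c ≤ c') : MISolvable hℓ f c' := by
  obtain ⟨M, p, hM⟩ := h
  refine ⟨M, p, fun I hI => ?_⟩
  obtain ⟨t, ht, hans⟩ := hM I hI
  refine ⟨t, ht.trans ?_, hans⟩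
  gcongr
  exact one_le_two

/-- All `s_r` would be at most `c`, and so would their limit. -/
theorem not_SETH_of_satSolvable {c : ℝ} (hc0 : 0 ≤ c) (hc : c < 1)
    (h : ∀ r, SATSolvable r c) : ¬ SETH := fun hS =>
  (le_of_tendsto' hS fun r => csInf_le ⟨0, fun _ hx => hx.1⟩ ⟨hc0, h r⟩).not_gt hc

end DecodedMI

theorem mainTheorem10 (hSETH : DecodedMI.SETH) :
    ∃ fP fMS : List Bool → DecodedMI.SetSystem,
      DecodedMI.IsMatroidDecoder fP ∧ DecodedMI.IsMatroidDecoder fMS ∧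
      DecodedMI.IsPartitionDecoder fP ∧ DecodedMI.IsMatroidSATDecoder fMS ∧
      ∀ (ℓ : ℕ) (hℓ : 3 ≤ ℓ) (ε : ℝ), 0 < ε →
        ¬ DecodedMI.MISolvable (by omega : 0 < ℓ)
          (fun i : Fin ℓ => if (i : ℕ) + 1 < ℓ then fP else fMS) (1 - ε) := by
  refine ⟨_, _, DecodedMI.isMatroidDecoder_partitionDecoder,
    DecodedMI.isMatroidDecoder_pavingDecoder, DecodedMI.isPartitionDecoder_partitionDecoder,
    DecodedMI.isMatroidSATDecoder_pavingDecoder, fun ℓ hℓ ε hε h => ?_⟩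
  -- Replacing `ε` by `min ε 1` only weakens the assumed time bound and makes the exponent
  -- nonnegative.
  have hε' : 0 < min ε 1 := lt_min hε one_pos
  have h1 : min ε 1 ≤ 1 := min_le_right _ _
  refine DecodedMI.not_SETH_of_satSolvable (c := 1 - min ε 1 / 2) (by linarith) (by linarith)
    (DecodedMI.satSolvable_of_miSolvable hℓ _ hε' h1 (h.mono ?_)) hSETH
  linarith [min_le_left ε 1]
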